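/- Consider the following downlink network. Base stations (BSs) form a homogeneous Poisson point process on $\mathbb R^2$ of density $\lambda>0$, and the typical user is at the origin. The antenna height difference is $L\ge 0$, so a BS at 2D distance $u$ has 3D distance $w=\sqrt{u^2+L^2}$. Let $N\ge 1$ and $L=d_0<d_1<\dots<d_{N-1}<d_N=+\infty$; the $n$-th piece is $d_{n-1}<w\le d_n$ (with $w=L$ included in the first piece). For each link type $Q\in\{\mathrm L,\mathrm{NL}\}$ (line of sight, non line of sight), $\zeta^Q(w)=\zeta^Q_n(w)=A^Q_n w^{-\alpha^Q_n}$ on the $n$-th piece, with $A^Q_n>0$ and parameters such that $\zeta^Q$ is continuous and strictly decreasing for $w\ge L$, $w>0$. Likewise $\mathrm{Pr}^{\mathrm L}(w)=\mathrm{Pr}^{\mathrm L}_n(w)\in[0,1]$ on the $n$-th piece, where $\mathrm{Pr}^{\mathrm L}_n$ is non-increasing. Given the BS positions, the links to the user are independently LoS with probability $\mathrm{Pr}^{\mathrm L}(w)$ and NLoS otherwise. The channel gains are i.i.d. exponential with mean $1$ (Rayleigh fading), independent of positions and link types. The user is served by the BS $b_o$ with the largest $\beta_i=\zeta^{Q_i}(w_i)$,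 where $Q_i$ and $w_i$ are the type and 3D length of the $i$-th link. With transmit power $P>0$, noise power $P_{\mathrm N}\ge0$, serving gain $h$ and interfering gains $g_i$, let $$I_{\mathrm{agg}}=\sum_{i:\,b_i\ne b_o}P\beta_i g_i\in[0,\infty],\qquad \mathrm{SINR}=\frac{P\beta_{o}h}{I_{\mathrm{agg}}+P_{\mathrm N}},$$ where $\beta_o$ is the value of $\beta_i$ for the serving BS. Let $\gamma>0$ and $1\le n\le N$. For $Q\in\{\mathrm L,\mathrm{NL}\}$ denote by $\Pr[\,\cdot\mid Q,r]$ and $\mathscr L^{Q}_{I_{\mathrm{agg}}}(s)=\mathbb E[e^{-sI_{\mathrm{agg}}}\mid Q,r]$ the (regular) conditional probability and Laplace transform given that the serving link has type $Q$ and 2D length $r$. Conventions: $e^{-\infty}=0$, and divergent integrals of non-negative functions equal $+\infty$. (LoS) For almost every $r$ (with respect to the law of the serving 2D distance on the event that the serving link is LoS) with $\sqrt{r^2+L^2}$ in the $n$-th piece, $$\Pr[\mathrm{SINR}>\gamma\mid \mathrm L,r]=\exp\Big(-\frac{\gamma P_{\mathrm N}}{P\zeta^{\mathrm L}_n(\sqrt{r^2+L^2})}\Big)\,\mathscr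 L^{\mathrm L}_{I_{\mathrm{agg}}}\Big(\frac{\gamma}{P\zeta^{\mathrm L}_n(\sqrt{r^2+L^2})}\Big),$$ and for all $s>0$ $$\mathscr L^{\mathrm L}_{I_{\mathrm{agg}}}(s)=\exp\Big(-2\pi\lambda\int_r^{\infty}\frac{\mathrm{Pr}^{\mathrm L}(\sqrt{u^2+L^2})\,u}{1+(sP\zeta^{\mathrm L}(\sqrt{u^2+L^2}))^{-1}}du\Big)\exp\Big(-2\pi\lambda\int_{r_1}^{\infty}\frac{[1-\mathrm{Pr}^{\mathrm L}(\sqrt{u^2+L^2})]\,u}{1+(sP\zeta^{\mathrm{NL}}(\sqrt{u^2+L^2}))^{-1}}du\Big),$$ where $r_1\ge0$ solves $\zeta^{\mathrm{NL}}(\sqrt{r_1^2+L^2})=\zeta^{\mathrm L}_n(\sqrt{r^2+L^2})$, and $r_1=0$ if there is no solution. (NLoS) For almost every $r$ (with respect to the law of the serving 2D distance on the event that the serving link is NLoS) with $\sqrt{r^2+L^2}$ in the $n$-th piece, $$\Pr[\mathrm{SINR}>\gamma\mid \mathrm{NL},r]=\exp\Big(-\frac{\gamma P_{\mathrm N}}{P\zeta^{\mathrm{NL}}_n(\sqrt{r^2+L^2})}\Big)\,\mathscr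 L^{\mathrm{NL}}_{I_{\mathrm{agg}}}\Big(\frac{\gamma}{P\zeta^{\mathrm{NL}}_n(\sqrt{r^2+L^2})}\Big),$$ and for all $s>0$ $$\mathscr L^{\mathrm{NL}}_{I_{\mathrm{agg}}}(s)=\exp\Big(-2\pi\lambda\int_{r_2}^{\infty}\frac{\mathrm{Pr}^{\mathrm L}(\sqrt{u^2+L^2})\,u}{1+(sP\zeta^{\mathrm L}(\sqrt{u^2+L^2}))^{-1}}du\Big)\exp\Big(-2\pi\lambda\int_{r}^{\infty}\frac{[1-\mathrm{Pr}^{\mathrm L}(\sqrt{u^2+L^2})]\,u}{1+(sP\zeta^{\mathrm{NL}}(\sqrt{u^2+L^2}))^{-1}}du\Big),$$ where $r_2\ge0$ solves $\zeta^{\mathrm L}(\sqrt{r_2^2+L^2})=\zeta^{\mathrm{NL}}_n(\sqrt{r^2+L^2})$, and $r_2=0$ if there is no solution. -/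

import Mathlib

open MeasureTheory ProbabilityTheory Set
open scoped ENNReal

noncomputable section

namespace CellNet

/-- The type of a radio link: line of sight or non line of sight. -/
inductive Path where
  | LoS : Path
  | NLoS : Path

instance : MeasurableSpace Path := ⊤

instance : DiscreteMeasurableSpace Path := ⟨fun _ => trivial⟩

instance : Countable Path :=
  Function.Injective.countable (f := fun q : Path => Path.rec (motive := fun _ => ℕ) 0 1 q)
    (by rintro (_ | _) (_ | _) h <;> first | rfl | cases h)

/-- The plane that carries the base stations; the typical user sits at the origin. -/
abbrev Plane := EuclideanSpace ℝ (Fin 2)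

/-- Parameters of the piecewise path loss model. The pieces are numbered `1, …, N`, the `n`-th
one ranging between `d (n - 1)` and `d n`, with `d 0 = L` and the last piece unbounded (values
of the parameters at other indices play no role). -/
structure PathLossModel where
  /-- absolute antenna height difference -/
  L : ℝ
  /-- number of pieces -/
  N : ℕ
  /-- breakpoints -/
  d : ℕ → ℝ
  /-- path loss at the reference distance `1` -/
  A : Path → ℕ → ℝ
  /-- path loss exponents -/
  α : Path → ℕ → ℝ
  /-- pieces of the LoS probability function -/
  prL : ℕ → ℝ → ℝ

namespace PathLossModel

variable (M : PathLossModel)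

/-- The 3D distance belonging to the 2D distance `r`. -/
def dist3 (r : ℝ) : ℝ := √(r ^ 2 + M.L ^ 2)

/-- The range of 3D distances of the `n`-th piece: `[L, d 1]` for the first piece,
`(d (n - 1), d n]` for the next ones, without upper limit for the last one. -/
def piece (n : ℕ) : Set ℝ :=
  {w | ((n = 1 ∧ w = M.L) ∨ M.d (n - 1) < w) ∧ (n < M.N → w ≤ M.d n)}

/-- The `n`-th piece `A w ^ (-α)` of the path loss function of a link type. -/
def zetaPiece (q : Path) (n : ℕ) (w : ℝ) : ℝ := M.A q n * w ^ (-M.α q n)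

/-- The piecewise path loss function of a link type. -/
def zeta (q : Path) (w : ℝ) : ℝ :=
  ∑ n ∈ Finset.Icc 1 M.N, (M.piece n).indicator (M.zetaPiece q n) w

/-- The piecewise LoS probability function. -/
def prLoS (w : ℝ) : ℝ := ∑ n ∈ Finset.Icc 1 M.N, (M.piece n).indicator (M.prL n) w

/-- The probability that a link of 3D length `w` has the given type. -/
def prPath : Path → ℝ → ℝ
  | .LoS, w => M.prLoS w
  | .NLoS, w => 1 - M.prLoS w

/-- Standing assumptions on the path loss model. The distance `0` (which occurs for `L = 0` only)
is left out of the domain of the path loss functions, which are powers with negative exponent. -/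
structure Valid : Prop where
  L_nonneg : 0 ≤ M.L
  N_pos : 1 ≤ M.N
  d_zero : M.d 0 = M.L
  d_lt : ∀ n, 1 ≤ n → n < M.N → M.d (n - 1) < M.d n
  A_pos : ∀ q, ∀ n ∈ Finset.Icc 1 M.N, 0 < M.A q n
  continuous_zeta : ∀ q, ContinuousOn (M.zeta q) (Ici M.L ∩ Ioi 0)
  decreasing_zeta : ∀ q, StrictAntiOn (M.zeta q) (Ici M.L ∩ Ioi 0)
  prL_mem : ∀ n ∈ Finset.Icc 1 M.N, ∀ w ∈ M.piece n, M.prL n w ∈ Icc (0 : ℝ) 1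
  prL_anti : ∀ n ∈ Finset.Icc 1 M.N, AntitoneOn (M.prL n) (M.piece n)

/-- The 2D distance `u ≥ 0` at which a link of type `q` has path loss exactly `c`; it is `0` if
there is none (for `c > 0` this means that every link of type `q` has path loss below `c`). -/
def crossDist (q : Path) (c : ℝ) : ℝ := sSup {u | 0 ≤ u ∧ M.zeta q (M.dist3 u) = c}

/-- `∫_a^∞ Pr^q(√(u²+L²)) u / (1 + (s P ζ^q(√(u²+L²)))⁻¹) du`, with value `∞` if it diverges. -/
def interfIntegral (P s : ℝ) (q : Path) (a : ℝ) : ℝ≥0∞ :=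
  ∫⁻ u in Ioi a, ENNReal.ofReal
    (M.prPath q (M.dist3 u) * u / (1 + (s * P * M.zeta q (M.dist3 u))⁻¹))

end PathLossModel

/-- `exp (-x)` for `x ∈ [0, ∞]`, with `exp (-∞) = 0`. -/
def expNeg (x : ℝ≥0∞) : ℝ≥0∞ := EReal.exp (-(x : EReal))

section Model

variable {Ω : Type*} [MeasurableSpace Ω]

/-- The random counting measure `∑ i, δ_{X i}` of a random sequence of points. -/
def pointMeasure {E : Type*} [MeasurableSpace E] (X : ℕ → Ω → E) (ω : Ω) : Measure E :=
  Measure.sum fun i => Measure.dirac (X i ω)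

/-- `X` enumerates the points of a Poisson point process with intensity measure `ν`: the number
of points in a set `B` of finite intensity is Poisson with parameter `ν B`, and the numbers of
points in disjoint sets are independent. -/
structure IsPoissonProcess {E : Type*} [MeasurableSpace E] (μ : Measure Ω) (X : ℕ → Ω → E)
    (ν : Measure E) : Prop where
  measurable : ∀ i, Measurable (X i)
  law : ∀ B : Set E, MeasurableSet B → ν B ≠ ∞ →
    μ.map (fun ω => pointMeasure X ω B) =
      (poissonMeasure (ν B).toNNReal).map (fun k : ℕ => (k : ℝ≥0∞))
  indep : ∀ (m : ℕ) (B : Fin m → Set E), (∀ j, MeasurableSet (B j)) → (∀ j, ν (B j) ≠ ∞) →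
    Pairwise (fun j k => Disjoint (B j) (B k)) →
    iIndepFun (fun j ω => pointMeasure X ω (B j)) μ

/-- The cellular network seen by the typical user at the origin: `X i` is the position of the
`i`-th base station, `T i` the type of its link to the user and `G i` the channel gain.
The positions form a homogeneous Poisson process of density `lam`; given the positions the link
types are independent, with the probabilities of the path loss model; the gains are i.i.d.
exponential with mean one (Rayleigh fading), independent of positions and link types. -/
structure IsNetwork (M : PathLossModel) (lam : ℝ) (μ : Measure Ω) (X : ℕ → Ω → Plane)
    (T : ℕ → Ω → Path) (G : ℕ → Ω → ℝ) : Prop where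
  poisson : IsPoissonProcess μ X (ENNReal.ofReal lam • (volume : Measure Plane))
  measurable_T : ∀ i, Measurable (T i)
  measurable_G : ∀ i, Measurable (G i)
  types : ∀ (s : Finset ℕ) (t : ℕ → Path) (B : Set (ℕ → Plane)), MeasurableSet B →
    μ {ω | (fun i => X i ω) ∈ B ∧ ∀ i ∈ s, T i ω = t i} =
      ∫⁻ ω in {ω | (fun i => X i ω) ∈ B},
        ∏ i ∈ s, ENNReal.ofReal (M.prPath (t i) (M.dist3 ‖X i ω‖)) ∂μ
  gain_law : ∀ i, μ.map (G i) = expMeasure 1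
  gain_iIndep : iIndepFun G μ
  gain_indep : IndepFun (fun ω i => G i ω) (fun ω => ((fun i => X i ω), fun i => T i ω)) μ

variable (M : PathLossModel) (X : ℕ → Ω → Plane) (T : ℕ → Ω → Path) (G : ℕ → Ω → ℝ)

/-- The path loss of the `i`-th base station. -/
def beta (i : ℕ) (ω : Ω) : ℝ := M.zeta (T i ω) (M.dist3 ‖X i ω‖)

/-- The index of the serving base station, the one with the largest `beta`
(the first such index in case of a tie; `0` if the maximum is not attained). -/
def serving (ω : Ω) : ℕ := sInf {i | ∀ j, beta M X T j ω ≤ beta M X T i ω}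

/-- The type of the serving link and the 2D distance of the serving base station. -/
def servingLink (ω : Ω) : Path × ℝ := (T (serving M X T ω) ω, ‖X (serving M X T ω) ω‖)

/-- The aggregate interference, the sum of `P β_i g_i` over all base stations but the serving
one, with value `∞` if it diverges. -/
def interference (P : ℝ) (ω : Ω) : ℝ≥0∞ :=
  ∑' i, if i = serving M X T ω then 0 else ENNReal.ofReal (P * beta M X T i ω * G i ω)

/-- The signal-to-interference-plus-noise ratio. -/
def sinr (P PN : ℝ) (ω : Ω) : ℝ≥0∞ :=
  ENNReal.ofReal (P * beta M X T (serving M X T ω) ω * G (serving M X T ω) ω) /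
    (interference M X T G P ω + ENNReal.ofReal PN)

/-- The conditional probability of coverage, that is of `SINR > γ`, given that the serving link
has type `q` and 2D length `r` (through a regular conditional distribution). -/
def condCoverage (μ : Measure Ω) [IsFiniteMeasure μ] (P PN γ : ℝ) (q : Path) (r : ℝ) : ℝ≥0∞ :=
  condDistrib (sinr M X T G P PN) (servingLink M X T) μ (q, r) (Ioi (ENNReal.ofReal γ))

/-- The Laplace transform at `s` of the aggregate interference, given that the serving link
has type `q` and 2D length `r` (through a regular conditional distribution). -/
def condLaplace (μ : Measure Ω) [IsFiniteMeasure μ] (P : ℝ) (q : Path) (r s : ℝ) : ℝ≥0∞ :=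
  ∫⁻ x, expNeg (ENNReal.ofReal s * x)
    ∂(condDistrib (interference M X T G P) (servingLink M X T) μ (q, r))

/-- The law of the 2D distance to the serving base station on the event that the serving link
has type `q`. -/
def servingDistLaw (μ : Measure Ω) (q : Path) : Measure ℝ :=
  (μ.restrict {ω | T (serving M X T ω) ω = q}).map fun ω => ‖X (serving M X T ω) ω‖

/-! Measurability of the random variables above, so that their laws and conditional
distributions are the genuine ones. -/

variable {M X T G}

lemma measurableSet_piece (n : ℕ) : MeasurableSet (M.piece n) := by
  by_cases h1 : n = 1 <;> by_cases h2 : n < M.N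
  · have : M.piece n = ({M.L} ∪ Ioi (M.d (n - 1))) ∩ Iic (M.d n) := by
      ext w; simp [PathLossModel.piece, h1, h1 ▸ h2]
    rw [this]; measurability
  · have : M.piece n = {M.L} ∪ Ioi (M.d (n - 1)) := by
      ext w; simp [PathLossModel.piece, h2]; simp [h1]
    rw [this]; measurability
  · have : M.piece n = Ioi (M.d (n - 1)) ∩ Iic (M.d n) := by
      ext w; simp [PathLossModel.piece, h1, h2]
    rw [this]; measurability
  · have : M.piece n = Ioi (M.d (n - 1)) := by
      ext w; simp [PathLossModel.piece, h1, h2]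
    rw [this]; measurability

lemma measurable_zeta (q : Path) : Measurable (M.zeta q) := by
  unfold PathLossModel.zeta
  refine Finset.measurable_fun_sum _ fun n _ => Measurable.indicator ?_ (measurableSet_piece n)
  unfold PathLossModel.zetaPiece
  fun_prop

lemma measurable_beta (hX : ∀ i, Measurable (X i)) (hT : ∀ i, Measurable (T i)) (i : ℕ) :
    Measurable (beta M X T i) := by
  have h : Measurable fun p : Path × ℝ => M.zeta p.1 p.2 :=
    measurable_from_prod_countable_right fun q => measurable_zeta q
  have h2 : Measurable fun ω => M.dist3 ‖X i ω‖ := by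
    have := (hX i).norm
    unfold PathLossModel.dist3
    fun_prop
  exact h.comp ((hT i).prodMk h2)

lemma measurable_serving (hX : ∀ i, Measurable (X i)) (hT : ∀ i, Measurable (T i)) :
    Measurable (serving M X T) := by
  have hS : ∀ i, MeasurableSet {ω | ∀ j, beta M X T j ω ≤ beta M X T i ω} := fun i => by
    exact measurableSet_setOfPred.mpr (Measurable.forall fun j => measurableSet_setOfPred.mp
      (measurableSet_le (measurable_beta hX hT j) (measurable_beta hX hT i)))
  have hex : ∀ ω, ∃ i, (∀ j, beta M X T j ω ≤ beta M X T i ω) ∨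
      ∀ k, ¬ ∀ j, beta M X T j ω ≤ beta M X T k ω := fun ω => by
    by_cases h : ∃ i, ∀ j, beta M X T j ω ≤ beta M X T i ω
    · exact ⟨h.choose, Or.inl h.choose_spec⟩
    · exact ⟨0, Or.inr (not_exists.mp h)⟩
  classical
  have hm := measurable_find hex fun i => measurableSet_setOfPred.mpr
    ((measurableSet_setOfPred.mp (hS i)).or
      (Measurable.forall fun k => (measurableSet_setOfPred.mp (hS k)).not))
  convert hm using 1
  funext ω
  unfold serving
  by_cases h : ∃ i, ∀ j, beta M X T j ω ≤ beta M X T i ω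
  · refine le_antisymm (Nat.sInf_le ?_) (Nat.find_min' _ (Or.inl (Nat.sInf_mem h)))
    rcases Nat.find_spec (hex ω) with h' | h'
    · exact h'
    · exact absurd h.choose_spec (h' h.choose)
  · have h0 : {i | ∀ j, beta M X T j ω ≤ beta M X T i ω} = ∅ := by
      ext i; simpa using not_exists.mp h i
    rw [h0, Nat.sInf_empty, eq_comm, Nat.find_eq_zero]
    exact Or.inr (not_exists.mp h)

lemma measurable_servingLink (hX : ∀ i, Measurable (X i)) (hT : ∀ i, Measurable (T i)) :
    Measurable (servingLink M X T) := by
  have h1 : Measurable fun p : ℕ × Ω => (T p.1 p.2, ‖X p.1 p.2‖) :=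
    measurable_from_prod_countable_right fun i => (hT i).prodMk (hX i).norm
  exact h1.comp ((measurable_serving hX hT).prodMk measurable_id)

lemma measurable_interference (hX : ∀ i, Measurable (X i)) (hT : ∀ i, Measurable (T i))
    (hG : ∀ i, Measurable (G i)) (P : ℝ) : Measurable (interference M X T G P) := by
  unfold interference
  refine Measurable.tsum fun i => Measurable.ite ?_ measurable_const ?_
  · exact measurableSet_eq_fun measurable_const (measurable_serving hX hT)
  · exact ((measurable_const.mul (measurable_beta hX hT i)).mul (hG i)).ennreal_ofReal

lemma measurable_sinr (hX : ∀ i, Measurable (X i)) (hT : ∀ i, Measurable (T i))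
    (hG : ∀ i, Measurable (G i)) (P PN : ℝ) : Measurable (sinr M X T G P PN) := by
  have h1 : Measurable fun p : ℕ × Ω =>
      ENNReal.ofReal (P * beta M X T p.1 p.2 * G p.1 p.2) :=
    measurable_from_prod_countable_right fun i =>
      ((measurable_const.mul (measurable_beta hX hT i)).mul (hG i)).ennreal_ofReal
  exact (h1.comp ((measurable_serving hX hT).prodMk measurable_id)).div
    ((measurable_interference hX hT hG P).add measurable_const)

end Model

end CellNet

end

/-! Suppose a base station at `x` has a link of type `q` and path loss `c`. Up to ties it serves the
user exactly when no other link has path loss above `c`. If every link above `c` is charged an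
infinite cost, then the event "this station serves" and the factor `exp (-s I)` merge into one
product over the other stations. Summing these products over all stations leaves only the serving
one (`tsum_links_eq`), since almost surely the largest path loss is attained by a single station
(`ae_exists_strict_max`).

Averaging over the independent types and gains turns each factor of the product into a function
`linkFactor` of the position alone (`lintegral_link_prod`). Mecke's formula for the Poisson process
(`mecke_of_tendsto`) then gives the joint transform of serving link and interference, with density
`p_q(x) exp (-∫ (1 - linkFactor))` in `x` (`laplace_servingLink`). By Rayleigh fading an admissible
link contributes `1 / (1 + s P ζ)`, so `1 - linkFactor` is the sum of its value at `s = 0` and of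
`linkGap`. The first summand is a void probability and yields the law of the serving distance; the
second is the exponent of the conditional Laplace transform (`condLaplace_ae_eq`). In polar
coordinates the condition "path loss at most `c`" becomes "distance at least `r`" for the type of
the serving link and "distance at least the crossing distance" for the other type.

For coverage, the gain of the serving station is exponential and independent of the positions, the
types and the other gains. Given all of these, `SINR > γ` therefore has probability `exp (-γ (I +
PN) / (P β))` (`expMeasure_coverage`).

Mecke's formula is derived from the law of the counts. Independence of counts gives the Laplace
functional (`laplace`); its derivative in the direction of an indicator gives the formula with the
distinguished point included in the exponent; that point is then divided out. Dependence of the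
exponent on the distinguished point is reached through dyadic discretisation. The same formula, with
infinite exponents, rules out ties (`ae_ne_of_null_fibers_on`). -/

noncomputable section

namespace CellNet

open Filter Topology
open scoped NNReal

/-! ### The exponential `exp (-x)` on `[0, ∞]`. -/

section ExpNeg

lemma expNeg_eq_inv_exp (x : ℝ≥0∞) : expNeg x = (EReal.exp (x : EReal))⁻¹ := EReal.exp_neg _

@[simp] lemma expNeg_zero : expNeg 0 = 1 := by simp [expNeg]

@[simp] lemma expNeg_top : expNeg ∞ = 0 := by simp [expNeg]

lemma expNeg_add (x y : ℝ≥0∞) : expNeg (x + y) = expNeg x * expNeg y := by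
  -- Inverses are used because negation is not additive on all of `EReal`.
  rw [expNeg_eq_inv_exp, expNeg_eq_inv_exp, expNeg_eq_inv_exp, EReal.coe_ennreal_add,
    EReal.exp_add, ENNReal.mul_inv]
  · exact Or.inl (by rw [Ne, EReal.exp_eq_zero_iff]; exact EReal.coe_ennreal_ne_bot x)
  · exact Or.inr (by rw [Ne, EReal.exp_eq_zero_iff]; exact EReal.coe_ennreal_ne_bot y)

lemma expNeg_ofReal {x : ℝ} (hx : 0 ≤ x) :
    expNeg (ENNReal.ofReal x) = ENNReal.ofReal (Real.exp (-x)) := by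
  rw [expNeg, EReal.coe_ennreal_ofReal, max_eq_left hx, ← EReal.coe_neg, EReal.exp_coe]

lemma expNeg_coe (x : ℝ≥0) : expNeg x = ENNReal.ofReal (Real.exp (-x)) := by
  rw [← ENNReal.ofReal_coe_nnreal, expNeg_ofReal x.coe_nonneg]

lemma antitone_expNeg : Antitone expNeg := fun _ _ h =>
  EReal.exp_monotone (EReal.neg_le_neg_iff.2 (EReal.coe_ennreal_le_coe_ennreal_iff.2 h))

lemma expNeg_le_one (x : ℝ≥0∞) : expNeg x ≤ 1 := by
  simpa using antitone_expNeg (zero_le (a := x))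

lemma expNeg_ne_top (x : ℝ≥0∞) : expNeg x ≠ ∞ := ne_top_of_le_ne_top ENNReal.one_ne_top (expNeg_le_one x)

lemma continuous_expNeg : Continuous expNeg := by
  unfold expNeg
  exact ENNReal.continuous_exp.comp (continuous_neg.comp continuous_coe_ennreal_ereal)

@[fun_prop] lemma measurable_expNeg : Measurable expNeg := continuous_expNeg.measurable

lemma expNeg_nsmul (y : ℝ≥0∞) (k : ℕ) : expNeg (y * k) = expNeg y ^ k := by
  induction k with
  | zero => simp
  | succ k ih => rw [Nat.cast_succ, mul_add, mul_one, expNeg_add, ih, pow_succ]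

lemma expNeg_sum {ι : Type*} (s : Finset ι) (f : ι → ℝ≥0∞) :
    expNeg (∑ i ∈ s, f i) = ∏ i ∈ s, expNeg (f i) := by
  classical
  induction s using Finset.induction_on with
  | empty => simp
  | insert a s ha ih => rw [Finset.sum_insert ha, Finset.prod_insert ha, expNeg_add, ih]

/-- Any factor in `[0, 1]` is thus an `expNeg`, which lets products of averaged factors enter
formulas stated for exponentials of sums. -/
lemma exists_expNeg_eq {v : ℝ≥0∞} (hv : v ≤ 1) :
    expNeg (-ENNReal.log v).toENNReal = v := by
  have h : 0 ≤ -ENNReal.log v := by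
    rw [EReal.neg_nonneg, ← ENNReal.log_one]
    exact ENNReal.log_monotone hv
  rw [expNeg, EReal.coe_toENNReal h, neg_neg, ENNReal.exp_log]

end ExpNeg

/-! ### Transform and mean of the Poisson law. -/

section PoissonLaw

open scoped Nat

lemma lintegral_poissonMeasure (r : ℝ≥0) (f : ℕ → ℝ≥0∞) :
    ∫⁻ k, f k ∂poissonMeasure r =
      ∑' n : ℕ, ENNReal.ofReal (Real.exp (-r) * r ^ n / n !) * f n := by
  simp [poissonMeasure, lintegral_sum_measure, lintegral_smul_measure]

/-- The generating function of the Poisson law at `z = expNeg y`. The case `y = ∞`, that is `z = 0`,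
is the void probability. -/
lemma lintegral_expNeg_poissonMeasure (r : ℝ≥0) (y : ℝ≥0∞) :
    ∫⁻ k : ℕ, expNeg (y * k) ∂poissonMeasure r = expNeg (r * (1 - expNeg y)) := by
  obtain ⟨z, hz⟩ : ∃ z : ℝ≥0, (z : ℝ≥0∞) = expNeg y :=
    ⟨_, ENNReal.coe_toNNReal (expNeg_ne_top y)⟩
  have hz1 : z ≤ 1 := by
    have := expNeg_le_one y
    rw [← hz] at this; exact_mod_cast this
  have h0 : ∀ n : ℕ, 0 ≤ Real.exp (-r) * ((r * z : ℝ) ^ n / n !) := fun n => by positivity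
  have hs : HasSum (fun n : ℕ => Real.exp (-r) * ((r * z : ℝ) ^ n / n !))
      (Real.exp (-r) * Real.exp (r * z)) := by
    rw [Real.exp_eq_exp_ℝ]
    exact (NormedSpace.expSeries_div_hasSum_exp (r * z : ℝ)).mul_left _
  have h1 : ∀ n : ℕ, ENNReal.ofReal (Real.exp (-r) * r ^ n / n !) * expNeg (y * n)
      = ENNReal.ofReal (Real.exp (-r) * ((r * z : ℝ) ^ n / n !)) := fun n => by
    rw [expNeg_nsmul, ← hz, ← ENNReal.coe_pow, ← ENNReal.ofReal_coe_nnreal,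
      ← ENNReal.ofReal_mul (by positivity)]
    congr 1
    push_cast
    ring
  rw [lintegral_poissonMeasure]
  simp_rw [h1]
  rw [← ENNReal.ofReal_tsum_of_nonneg h0 hs.summable, hs.tsum_eq, ← Real.exp_add, ← hz]
  rw [← ENNReal.coe_one, ← ENNReal.coe_sub, ← ENNReal.coe_mul, expNeg_coe]
  congr 2
  push_cast [NNReal.coe_sub hz1]
  ring

lemma lintegral_id_poissonMeasure (r : ℝ≥0) :
    ∫⁻ k : ℕ, (k : ℝ≥0∞) ∂poissonMeasure r = r := by
  rw [lintegral_poissonMeasure, tsum_eq_zero_add' ENNReal.summable]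
  -- The factor `n + 1` cancels in the factorial. The trailing `* 1` lets the remaining sum be read
  -- as the total mass of the law.
  have h1 : ∀ n : ℕ, ENNReal.ofReal (Real.exp (-r) * r ^ (n + 1) / (n + 1)!) * ((n + 1 : ℕ) : ℝ≥0∞)
      = r * (ENNReal.ofReal (Real.exp (-r) * r ^ n / n !) * 1) := fun n => by
    rw [← ENNReal.ofReal_natCast, mul_one, ← ENNReal.ofReal_mul (by positivity),
      ← ENNReal.ofReal_coe_nnreal, ← ENNReal.ofReal_mul (by positivity)]
    congr 1
    rw [Nat.factorial_succ]
    push_cast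
    field_simp
    ring
  simp_rw [h1]
  rw [ENNReal.tsum_mul_left, ← lintegral_poissonMeasure]
  simp

end PoissonLaw

/-! ### The Laplace functional of a Poisson process. -/

section PointProcess

variable {Ω : Type*} [MeasurableSpace Ω] {E : Type*} [MeasurableSpace E]
  {μ : Measure Ω} {X : ℕ → Ω → E} {ν : Measure E}

omit [MeasurableSpace Ω] in
lemma lintegral_pointMeasure (ω : Ω) {f : E → ℝ≥0∞} (hf : Measurable f) :
    ∫⁻ x, f x ∂pointMeasure X ω = ∑' i, f (X i ω) := by
  rw [pointMeasure, lintegral_sum_measure]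
  exact tsum_congr fun i => lintegral_dirac' _ hf

lemma measurable_pointMeasure_apply (hX : ∀ i, Measurable (X i)) {B : Set E}
    (hB : MeasurableSet B) : Measurable fun ω => pointMeasure X ω B := by
  simp_rw [pointMeasure, Measure.sum_apply _ hB, Measure.dirac_apply' _ hB]
  exact Measurable.tsum fun i => (measurable_const.indicator hB).comp (hX i)

lemma measurable_lintegral_pointMeasure (hX : ∀ i, Measurable (X i)) {f : E → ℝ≥0∞}
    (hf : Measurable f) : Measurable fun ω => ∫⁻ x, f x ∂pointMeasure X ω := by
  simp_rw [lintegral_pointMeasure _ hf]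
  exact Measurable.tsum fun i => hf.comp (hX i)

namespace IsPoissonProcess

variable (h : IsPoissonProcess μ X ν)
include h

lemma lintegral_comp_count {B : Set E} (hB : MeasurableSet B) (hν : ν B ≠ ∞) {φ : ℝ≥0∞ → ℝ≥0∞}
    (hφ : Measurable φ) :
    ∫⁻ ω, φ (pointMeasure X ω B) ∂μ = ∫⁻ k : ℕ, φ k ∂poissonMeasure (ν B).toNNReal := by
  rw [← lintegral_map hφ (measurable_pointMeasure_apply h.measurable hB), h.law B hB hν,
    lintegral_map hφ .of_discrete]

lemma lintegral_count {B : Set E} (hB : MeasurableSet B) (hν : ν B ≠ ∞) :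
    ∫⁻ ω, pointMeasure X ω B ∂μ = ν B := by
  refine (h.lintegral_comp_count hB hν measurable_id).trans ?_
  simp only [id]
  rw [lintegral_id_poissonMeasure, ENNReal.coe_toNNReal hν]

lemma lintegral_expNeg_count {B : Set E} (hB : MeasurableSet B) (hν : ν B ≠ ∞) (y : ℝ≥0∞) :
    ∫⁻ ω, expNeg (y * pointMeasure X ω B) ∂μ = expNeg (ν B * (1 - expNeg y)) := by
  rw [h.lintegral_comp_count (φ := fun t => expNeg (y * t)) hB hν (by fun_prop),
    lintegral_expNeg_poissonMeasure, ENNReal.coe_toNNReal hν]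

/-- The fibres of the nonzero values are disjoint and of finite intensity, so their counts are
independent Poisson variables and the expectation factorises. -/
lemma laplace_simpleFunc (f : SimpleFunc E ℝ≥0∞) (hf : f.FinMeasSupp ν) :
    ∫⁻ ω, expNeg (∫⁻ x, f x ∂pointMeasure X ω) ∂μ =
      expNeg (∫⁻ x, (1 - expNeg (f x)) ∂ν) := by
  classical
  -- The value `0` is dropped: its fibre may have infinite intensity, and it contributes nothing to
  -- either side.
  set s := f.range \ {0} with hs
  let y : Fin s.card → ℝ≥0∞ := fun j => (s.equivFin.symm j : ℝ≥0∞)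
  have hs0 : ∀ t ∈ s, t ≠ 0 := fun t ht => by
    rw [hs, Finset.mem_sdiff, Finset.notMem_singleton] at ht
    exact ht.2
  have hy : ∀ j, y j ≠ 0 := fun j => hs0 _ (s.equivFin.symm j).2
  have hsum : ∀ a : ℝ≥0∞ → ℝ≥0∞, ∑ t ∈ s, a t = ∑ j, a (y j) := fun a => by
    rw [← Finset.sum_coe_sort, ← Equiv.sum_comp s.equivFin.symm]
  let B : Fin s.card → Set E := fun j => f ⁻¹' {y j}
  have hB : ∀ j, MeasurableSet (B j) := fun j => f.measurableSet_fiber _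
  have hνB : ∀ j, ν (B j) ≠ ∞ := fun j => (hf.meas_preimage_singleton_ne_zero (hy j)).ne
  have hdisj : Pairwise fun j k => Disjoint (B j) (B k) := fun j k hjk => by
    refine Disjoint.preimage _ (disjoint_singleton.2 fun he => hjk ?_)
    exact s.equivFin.symm.injective (Subtype.ext he)
  have h1 : ∀ ω, expNeg (∫⁻ x, f x ∂pointMeasure X ω) =
      ∏ j, expNeg (y j * pointMeasure X ω (B j)) := fun ω => by
    rw [f.lintegral_eq_lintegral, f.lintegral_eq_of_subset' (s := s) (by rw [hs]),
      hsum fun t => t * pointMeasure X ω (f ⁻¹' {t}), expNeg_sum]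
  have h2 : ∫⁻ x, (1 - expNeg (f x)) ∂ν = ∑ j, ν (B j) * (1 - expNeg (y j)) := by
    have : ∀ x, 1 - expNeg (f x) = (f.map fun t => 1 - expNeg t) x := fun x => rfl
    simp_rw [this]
    rw [SimpleFunc.lintegral_eq_lintegral, SimpleFunc.map_lintegral,
      ← Finset.sum_subset (s₁ := s) (by rw [hs]; exact Finset.sdiff_subset),
      hsum fun t => (1 - expNeg t) * ν (f ⁻¹' {t})]
    · simp_rw [mul_comm, B]
    · intro x hx hxs
      have : x = 0 := by
        by_contra h0
        exact hxs (by rw [hs, Finset.mem_sdiff, Finset.notMem_singleton]; exact ⟨hx, h0⟩)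
      simp [this]
  have hi : iIndepFun (fun j ω => expNeg (y j * pointMeasure X ω (B j))) μ :=
    (h.indep s.card B hB hνB hdisj).comp (fun j t => expNeg (y j * t)) fun j => by fun_prop
  simp_rw [h1]
  rw [lintegral_prod_eq_prod_lintegral_of_indepFun _ _ hi fun j => by
    have := measurable_pointMeasure_apply h.measurable (hB j)
    fun_prop, h2, expNeg_sum]
  exact Finset.prod_congr rfl fun j _ => h.lintegral_expNeg_count (hB j) (hνB j) _

variable [IsProbabilityMeasure μ] [SigmaFinite ν]

/-- `f` is an increasing limit of simple functions supported in sets of finite intensity. The left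
side passes to the limit by domination by `1`, the right side by monotone convergence. The value `∞`
of `f` is allowed. -/
lemma laplace {f : E → ℝ≥0∞} (hf : Measurable f) :
    ∫⁻ ω, expNeg (∫⁻ x, f x ∂pointMeasure X ω) ∂μ =
      expNeg (∫⁻ x, (1 - expNeg (f x)) ∂ν) := by
  let F : ℕ → SimpleFunc E ℝ≥0∞ := fun n => (SimpleFunc.eapprox f n).restrict (spanningSets ν n)
  have hFa : ∀ n x, F n x = (spanningSets ν n).indicator (SimpleFunc.eapprox f n) x := fun n x =>
    SimpleFunc.restrict_apply _ (measurableSet_spanningSets ν n) x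
  have hFfin : ∀ n, (F n).FinMeasSupp ν := fun n => by
    rw [SimpleFunc.finMeasSupp_iff_support]
    refine (measure_mono fun x hx => ?_).trans_lt (measure_spanningSets_lt_top ν n)
    by_contra hxs
    exact hx (by rw [hFa, indicator_of_notMem hxs])
  have hmono : ∀ x, Monotone fun n => F n x := fun x m n hmn => by
    simp only [hFa]
    exact (indicator_le_indicator (SimpleFunc.monotone_eapprox f hmn x)).trans
      (indicator_le_indicator_of_subset (spanningSets_mono hmn) (fun _ => zero_le) x)
  have hlim : ∀ x, Tendsto (fun n => F n x) atTop (𝓝 (f x)) := fun x => by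
    refine (SimpleFunc.tendsto_eapprox hf x).congr' ?_
    filter_upwards [eventually_mem_spanningSets ν x] with n hn
    rw [hFa, indicator_of_mem hn]
  have hl : Tendsto (fun n => ∫⁻ ω, expNeg (∫⁻ x, F n x ∂pointMeasure X ω) ∂μ) atTop
      (𝓝 (∫⁻ ω, expNeg (∫⁻ x, f x ∂pointMeasure X ω) ∂μ)) := by
    refine tendsto_lintegral_of_dominated_convergence (fun _ => 1) (fun n => ?_)
      (fun n => .of_forall fun ω => expNeg_le_one _) (by simp) (.of_forall fun ω => ?_)
    · exact measurable_expNeg.comp (measurable_lintegral_pointMeasure h.measurable (F n).measurable)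
    · refine (continuous_expNeg.tendsto _).comp ?_
      exact lintegral_tendsto_of_tendsto_of_monotone (fun n => (F n).measurable.aemeasurable)
        (.of_forall hmono) (.of_forall hlim)
  have hr : Tendsto (fun n => expNeg (∫⁻ x, (1 - expNeg (F n x)) ∂ν)) atTop
      (𝓝 (expNeg (∫⁻ x, (1 - expNeg (f x)) ∂ν))) := by
    refine (continuous_expNeg.tendsto _).comp ?_
    refine lintegral_tendsto_of_tendsto_of_monotone (fun n => ?_)
      (.of_forall fun x m n hmn => tsub_le_tsub_left (antitone_expNeg (hmono x hmn)) _)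
      (.of_forall fun x => ?_)
    · exact (measurable_const.sub (measurable_expNeg.comp (F n).measurable)).aemeasurable
    · exact ENNReal.Tendsto.sub tendsto_const_nhds ((continuous_expNeg.tendsto _).comp (hlim x))
        (Or.inl ENNReal.one_ne_top)
  refine tendsto_nhds_unique hl (hr.congr fun n => ?_)
  exact (h.laplace_simpleFunc (F n) (hFfin n)).symm

end IsPoissonProcess

end PointProcess

/-! ### Differentiating the Laplace functional. -/

section Mecke

lemma tendsto_succ_mul_of_hasDerivAt {g : ℝ → ℝ} {x : ℝ} (hg : HasDerivAt g x 0) (h0 : g 0 = 0) :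
    Tendsto (fun n : ℕ => ((n : ℝ) + 1) * g (1 / ((n : ℝ) + 1))) atTop (𝓝 x) := by
  have h1 : Tendsto (fun n : ℕ => 1 / ((n : ℝ) + 1)) atTop (𝓝[>] 0) :=
    tendsto_nhdsWithin_iff.2 ⟨tendsto_one_div_add_atTop_nhds_zero_nat,
      .of_forall fun n => by simp only [mem_Ioi]; positivity⟩
  have h2 := hg.tendsto_slope_zero_right.comp h1
  simpa [h0, Function.comp_def] using h2

lemma one_sub_expNeg_ofReal {x : ℝ} (hx : 0 ≤ x) :
    1 - expNeg (ENNReal.ofReal x) = ENNReal.ofReal (1 - Real.exp (-x)) := by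
  rw [expNeg_ofReal hx, ENNReal.ofReal_sub _ (Real.exp_nonneg _), ENNReal.ofReal_one]

lemma one_sub_expNeg_le (x : ℝ≥0∞) : 1 - expNeg x ≤ x := by
  rcases eq_or_ne x ∞ with rfl | hx
  · exact le_top
  · rw [← ENNReal.ofReal_toReal hx, one_sub_expNeg_ofReal ENNReal.toReal_nonneg]
    refine ENNReal.ofReal_le_ofReal ?_
    have := Real.add_one_le_exp (-x.toReal)
    linarith

/-- A difference quotient at `0` of `t ↦ 1 - exp (-e(t) x)`. It serves for `e(t) = t` and for `e(t)
= 1 - exp (-t)`, which occur on the two sides of the identity to be differentiated. -/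
lemma tendsto_succ_mul_one_sub_expNeg {x : ℝ≥0∞} (hx : x ≠ ∞) {e : ℝ → ℝ} (he : HasDerivAt e 1 0)
    (he0 : e 0 = 0) (hpos : ∀ t, 0 ≤ t → 0 ≤ e t) :
    Tendsto (fun n : ℕ => ((n : ℝ≥0∞) + 1) * (1 - expNeg (ENNReal.ofReal (e (1 / ((n : ℝ) + 1))) * x)))
      atTop (𝓝 x) := by
  have hd : HasDerivAt (fun t => 1 - Real.exp (-(e t * x.toReal))) x.toReal 0 := by
    have := (((he.mul_const x.toReal).neg).exp).const_sub 1
    simpa [he0] using this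
  have h1 := ENNReal.tendsto_ofReal (tendsto_succ_mul_of_hasDerivAt hd (by simp [he0]))
  rw [ENNReal.ofReal_toReal hx] at h1
  refine h1.congr fun n => ?_
  have hn := hpos (1 / ((n : ℝ) + 1)) (by positivity)
  rw [ENNReal.ofReal_mul (by positivity), ← one_sub_expNeg_ofReal (mul_nonneg hn ENNReal.toReal_nonneg),
    ENNReal.ofReal_mul hn, ENNReal.ofReal_toReal hx, ENNReal.ofReal_add (by positivity) zero_le_one]
  simp

variable {Ω : Type*} [MeasurableSpace Ω] {E : Type*} [MeasurableSpace E]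
  {μ : Measure Ω} {X : ℕ → Ω → E} {ν : Measure E}

lemma measure_ext_of_finite [SigmaFinite ν] {m₁ m₂ : Measure E}
    (hm : ∀ B, MeasurableSet B → ν B ≠ ∞ → m₁ B = m₂ B) : m₁ = m₂ := by
  ext B hB
  have hmono : Monotone fun n => B ∩ spanningSets ν n := fun m n hmn =>
    inter_subset_inter_right _ (spanningSets_mono hmn)
  have hU : B = ⋃ n, B ∩ spanningSets ν n := by
    rw [← inter_iUnion, iUnion_spanningSets, inter_univ]
  rw [hU, hmono.measure_iUnion, hmono.measure_iUnion]
  refine iSup_congr fun n => hm _ (hB.inter (measurableSet_spanningSets ν n)) ?_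
  exact ((measure_mono inter_subset_right).trans_lt (measure_spanningSets_lt_top ν n)).ne

/-- An identity for sums over a point process extends from indicators of sets of finite intensity
to all test functions. -/
lemma lintegral_tsum_weight_eq [SigmaFinite ν] (hX : ∀ i, Measurable (X i)) {W : ℕ → Ω → ℝ≥0∞}
    (hW : ∀ i, Measurable (W i)) {ρ : Measure E}
    (hB : ∀ B, MeasurableSet B → ν B ≠ ∞ →
      ∫⁻ ω, ∑' i, B.indicator 1 (X i ω) * W i ω ∂μ = ρ B)
    {g : E → ℝ≥0∞} (hg : Measurable g) :
    ∫⁻ ω, ∑' i, g (X i ω) * W i ω ∂μ = ∫⁻ x, g x ∂ρ := by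
  -- The intensity measure of the points weighted by `W`; both sides of the claim are integrals of
  -- `g`, so it suffices to identify two measures.
  set m : Measure E := Measure.sum fun i => (μ.withDensity (W i)).map (X i) with hm
  have hint : ∀ g : E → ℝ≥0∞, Measurable g →
      ∫⁻ x, g x ∂m = ∫⁻ ω, ∑' i, g (X i ω) * W i ω ∂μ := fun g hg => by
    have hgW : ∀ i, AEMeasurable (fun ω => g (X i ω) * W i ω) μ := fun i =>
      ((hg.comp (hX i)).mul (hW i)).aemeasurable
    rw [hm, lintegral_sum_measure, lintegral_tsum hgW]
    refine tsum_congr fun i => ?_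
    rw [lintegral_map hg (hX i)]
    refine (lintegral_withDensity_eq_lintegral_mul _ (hW i) (hg.comp (hX i))).trans ?_
    exact lintegral_congr fun ω => mul_comm _ _
  rw [← hint g hg, measure_ext_of_finite (ν := ν) (m₁ := m) (m₂ := ρ) fun B hBm hBν => ?_]
  rw [← lintegral_indicator_one hBm, hint _ (measurable_one.indicator hBm), hB B hBm hBν]

/-- Dominated convergence twice: for each `i`, and for the sum viewed as an integral against
counting measure. -/
lemma tendsto_lintegral_tsum {F : ℕ → ℕ → Ω → ℝ≥0∞} {f G : ℕ → Ω → ℝ≥0∞}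
    (hF : ∀ n i, Measurable (F n i)) (hG : ∀ i, Measurable (G i)) (hf : ∀ i, Measurable (f i))
    (hle : ∀ n i ω, F n i ω ≤ G i ω)
    (hfin : ∫⁻ ω, ∑' i, G i ω ∂μ ≠ ∞)
    (hlim : ∀ i ω, Tendsto (fun n => F n i ω) atTop (𝓝 (f i ω))) :
    Tendsto (fun n => ∫⁻ ω, ∑' i, F n i ω ∂μ) atTop (𝓝 (∫⁻ ω, ∑' i, f i ω ∂μ)) := by
  simp_rw [fun n => lintegral_tsum (μ := μ) fun i => (hF n i).aemeasurable]
  rw [lintegral_tsum fun i => (hf i).aemeasurable]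
  rw [lintegral_tsum fun i => (hG i).aemeasurable] at hfin
  simp_rw [← lintegral_count] at hfin ⊢
  refine tendsto_lintegral_of_dominated_convergence (fun i => ∫⁻ ω, G i ω ∂μ)
    (fun n => measurable_of_countable _) (fun n => .of_forall fun i => lintegral_mono (hle n i)) hfin
    (.of_forall fun i => ?_)
  refine tendsto_lintegral_of_dominated_convergence (G i) (fun n => hF n i)
    (fun n => .of_forall (hle n i)) ?_ (.of_forall (hlim i))
  exact ne_top_of_le_ne_top hfin (by rw [lintegral_count]; exact ENNReal.le_tsum i)

/-- The sum of `f` over all points of the sequence but the `i`-th one. -/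
def sumOthers (X : ℕ → Ω → E) (f : E → ℝ≥0∞) (i : ℕ) (ω : Ω) : ℝ≥0∞ :=
  ∑' j, if j = i then 0 else f (X j ω)

lemma measurable_sumOthers_coupled (hX : ∀ i, Measurable (X i)) {f : E → E → ℝ≥0∞}
    (hf : Measurable (Function.uncurry f)) (i : ℕ) :
    Measurable fun ω => sumOthers X (f (X i ω)) i ω := by
  unfold sumOthers
  refine Measurable.tsum fun j => ?_
  split_ifs
  · exact measurable_const
  · exact hf.comp ((hX i).prodMk (hX j))

lemma measurable_sumOthers (hX : ∀ i, Measurable (X i)) {f : E → ℝ≥0∞}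
    (hf : Measurable f) (i : ℕ) : Measurable fun ω => sumOthers X f i ω :=
  measurable_sumOthers_coupled hX (f := fun _ => f) (hf.comp measurable_snd) i

omit [MeasurableSpace Ω] [MeasurableSpace E] in
lemma tendsto_sumOthers (i : ℕ) (ω : Ω) {f : ℕ → E → ℝ≥0∞} {F : E → ℝ≥0∞}
    (hmono : ∀ y, Monotone fun n => f n y)
    (hlim : ∀ y, Tendsto (fun n => f n y) atTop (𝓝 (F y))) :
    Tendsto (fun n => sumOthers X (f n) i ω) atTop (𝓝 (sumOthers X F i ω)) := by
  unfold sumOthers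
  simp_rw [← lintegral_count]
  refine lintegral_tendsto_of_tendsto_of_monotone (fun n => (measurable_of_countable _).aemeasurable)
    (.of_forall fun j m n hmn => ?_) (.of_forall fun j => ?_)
  · dsimp only; split_ifs
    · exact le_rfl
    · exact hmono _ hmn
  · split_ifs
    · exact tendsto_const_nhds
    · exact hlim _

lemma tendsto_expNeg_intensity {f : ℕ → E → ℝ≥0∞} {F : E → ℝ≥0∞} (hf : ∀ n, Measurable (f n))
    (hmono : ∀ y, Monotone fun n => f n y)
    (hlim : ∀ y, Tendsto (fun n => f n y) atTop (𝓝 (F y))) :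
    Tendsto (fun n => expNeg (∫⁻ y, (1 - expNeg (f n y)) ∂ν)) atTop
      (𝓝 (expNeg (∫⁻ y, (1 - expNeg (F y)) ∂ν))) := by
  refine (continuous_expNeg.tendsto _).comp ?_
  refine lintegral_tendsto_of_tendsto_of_monotone
    (fun n => (measurable_const.sub (measurable_expNeg.comp (hf n))).aemeasurable)
    (.of_forall fun x m n hmn => tsub_le_tsub_left (antitone_expNeg (hmono x hmn)) _)
    (.of_forall fun x => ?_)
  exact ENNReal.Tendsto.sub tendsto_const_nhds ((continuous_expNeg.tendsto _).comp (hlim x))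
    (Or.inl ENNReal.one_ne_top)

namespace IsPoissonProcess

variable (h : IsPoissonProcess μ X ν) [IsProbabilityMeasure μ] [SigmaFinite ν]
include h

/-- The Laplace functional at `f + t 1_B`, where `1 - exp (-f - t 1_B)` is `1 - exp (-f)` plus `1_B
(1 - exp (-t)) exp (-f)`. The variable `t` is there to be differentiated. -/
lemma lintegral_expNeg_mul_expNeg_count {f : E → ℝ≥0∞} (hf : Measurable f) {B : Set E}
    (hB : MeasurableSet B) (t : ℝ≥0∞) :
    ∫⁻ ω, expNeg (∫⁻ x, f x ∂pointMeasure X ω) * expNeg (t * pointMeasure X ω B) ∂μ =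
      expNeg (∫⁻ x, (1 - expNeg (f x)) ∂ν) *
        expNeg ((1 - expNeg t) * ∫⁻ x in B, expNeg (f x) ∂ν) := by
  have hm : Measurable fun x => f x + B.indicator (fun _ => t) x :=
    hf.add (measurable_const.indicator hB)
  have h1 := h.laplace hm
  have h2 : ∀ ω, expNeg (∫⁻ x, f x + B.indicator (fun _ => t) x ∂pointMeasure X ω) =
      expNeg (∫⁻ x, f x ∂pointMeasure X ω) * expNeg (t * pointMeasure X ω B) := fun ω => by
    rw [lintegral_add_left hf, expNeg_add, lintegral_indicator_const hB]
  have h3 : ∀ x, 1 - expNeg (f x + B.indicator (fun _ => t) x) =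
      (1 - expNeg (f x)) + B.indicator (fun x => (1 - expNeg t) * expNeg (f x)) x := fun x => by
    by_cases hx : x ∈ B
    · rw [indicator_of_mem hx, indicator_of_mem hx, expNeg_add]
      rw [ENNReal.sub_mul fun _ _ => expNeg_ne_top _, one_mul,
        tsub_add_tsub_cancel (expNeg_le_one _) (mul_le_of_le_one_left' (expNeg_le_one t)), mul_comm]
    · simp [hx]
  simp_rw [h2, h3] at h1
  have hf1 : Measurable fun x => 1 - expNeg (f x) :=
    measurable_const.sub (measurable_expNeg.comp hf)
  have hf2 : Measurable fun x => expNeg (f x) := measurable_expNeg.comp hf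
  rw [h1, lintegral_add_left hf1, lintegral_indicator hB, expNeg_add, lintegral_const_mul _ hf2]

/-- The derivative at `t = 0` of the preceding identity, taken along `t = 1 / (n + 1)`. The
difference quotients on the left are dominated by the count of `B`, whose mean `ν B` is finite. -/
lemma lintegral_count_mul_expNeg {f : E → ℝ≥0∞} (hf : Measurable f) {B : Set E}
    (hB : MeasurableSet B) (hν : ν B ≠ ∞) :
    ∫⁻ ω, pointMeasure X ω B * expNeg (∫⁻ x, f x ∂pointMeasure X ω) ∂μ =
      (∫⁻ x in B, expNeg (f x) ∂ν) * expNeg (∫⁻ x, (1 - expNeg (f x)) ∂ν) := by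
  have hN := measurable_pointMeasure_apply h.measurable hB
  have hL : Measurable fun ω => expNeg (∫⁻ x, f x ∂pointMeasure X ω) :=
    measurable_expNeg.comp (measurable_lintegral_pointMeasure h.measurable hf)
  have hfin : ∀ᵐ ω ∂μ, pointMeasure X ω B < ∞ :=
    ae_lt_top hN (by rw [h.lintegral_count hB hν]; exact hν)
  set b := ∫⁻ x in B, expNeg (f x) ∂ν with hb
  have hbfin : b ≠ ∞ := ne_top_of_le_ne_top hν
    ((lintegral_mono fun x => expNeg_le_one (f x)).trans (by simp))
  set A := expNeg (∫⁻ x, (1 - expNeg (f x)) ∂ν) with hA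
  let t : ℕ → ℝ := fun n => 1 / ((n : ℝ) + 1)
  have ht : ∀ n, 0 ≤ t n := fun n => by positivity
  have hl : Tendsto (fun n : ℕ => ∫⁻ ω, expNeg (∫⁻ x, f x ∂pointMeasure X ω) *
      (((n : ℝ≥0∞) + 1) * (1 - expNeg (ENNReal.ofReal (t n) * pointMeasure X ω B))) ∂μ) atTop
      (𝓝 (∫⁻ ω, expNeg (∫⁻ x, f x ∂pointMeasure X ω) * pointMeasure X ω B ∂μ)) := by
    refine tendsto_lintegral_of_dominated_convergence (fun ω => pointMeasure X ω B) (fun n => ?_)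
      (fun n => .of_forall fun ω => ?_) (by rw [h.lintegral_count hB hν]; exact hν) ?_
    · exact hL.mul (by fun_prop)
    · have hc : ((n : ℝ≥0∞) + 1) * ENNReal.ofReal (t n) = 1 := by
        have : ((n : ℝ≥0∞) + 1) = ENNReal.ofReal ((n : ℝ) + 1) := by
          rw [ENNReal.ofReal_add (by positivity) zero_le_one]; simp
        rw [this, ← ENNReal.ofReal_mul (by positivity), mul_one_div_cancel (by positivity),
          ENNReal.ofReal_one]
      calc _ ≤ 1 * (((n : ℝ≥0∞) + 1) * (ENNReal.ofReal (t n) * pointMeasure X ω B)) :=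
            mul_le_mul' (expNeg_le_one _) (mul_le_mul' le_rfl (one_sub_expNeg_le _))
        _ = pointMeasure X ω B := by rw [one_mul, ← mul_assoc, hc, one_mul]
    · filter_upwards [hfin] with ω hω
      refine ENNReal.Tendsto.const_mul ?_ (Or.inr (expNeg_ne_top _))
      exact tendsto_succ_mul_one_sub_expNeg (e := fun s => s) hω.ne (hasDerivAt_id' 0) rfl
        fun _ h => h
  have hr : Tendsto (fun n : ℕ => A * (((n : ℝ≥0∞) + 1) *
      (1 - expNeg (ENNReal.ofReal (1 - Real.exp (-t n)) * b)))) atTop (𝓝 (A * b)) := by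
    refine ENNReal.Tendsto.const_mul ?_ (Or.inr (expNeg_ne_top _))
    refine tendsto_succ_mul_one_sub_expNeg (e := fun s => 1 - Real.exp (-s)) hbfin ?_ (by simp)
      fun s hs => ?_
    · have := ((hasDerivAt_id (0 : ℝ)).neg.exp).const_sub 1
      simpa using this
    · simp [hs]
  have heq : ∀ n : ℕ, ∫⁻ ω, expNeg (∫⁻ x, f x ∂pointMeasure X ω) *
      (((n : ℝ≥0∞) + 1) * (1 - expNeg (ENNReal.ofReal (t n) * pointMeasure X ω B))) ∂μ =
      A * (((n : ℝ≥0∞) + 1) * (1 - expNeg (ENNReal.ofReal (1 - Real.exp (-t n)) * b))) := fun n => by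
    have hn : ((n : ℝ≥0∞) + 1) ≠ ∞ := by simp
    have e1 : ∀ ω, expNeg (∫⁻ x, f x ∂pointMeasure X ω) *
      (((n : ℝ≥0∞) + 1) * (1 - expNeg (ENNReal.ofReal (t n) * pointMeasure X ω B))) =
      ((n : ℝ≥0∞) + 1) * (expNeg (∫⁻ x, f x ∂pointMeasure X ω) -
        expNeg (∫⁻ x, f x ∂pointMeasure X ω) *
          expNeg (ENNReal.ofReal (t n) * pointMeasure X ω B)) := fun ω => by
      rw [mul_left_comm, ENNReal.mul_sub fun _ _ => expNeg_ne_top _, mul_one]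
    simp_rw [e1]
    have hmul : Measurable fun ω => expNeg (∫⁻ x, f x ∂pointMeasure X ω) *
          expNeg (ENNReal.ofReal (t n) * pointMeasure X ω B) := hL.mul (by fun_prop)
    rw [lintegral_const_mul' _ _ hn, lintegral_sub hmul,
      h.lintegral_expNeg_mul_expNeg_count hf hB, h.laplace hf, one_sub_expNeg_ofReal (ht n),
      mul_left_comm A, ENNReal.mul_sub fun _ _ => expNeg_ne_top _, mul_one]
    · rw [h.lintegral_expNeg_mul_expNeg_count hf hB]
      exact ENNReal.mul_ne_top (expNeg_ne_top _) (expNeg_ne_top _)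
    · exact .of_forall fun ω => mul_le_of_le_one_right' (expNeg_le_one _)
  simp_rw [mul_comm (pointMeasure X _ B)]
  rw [mul_comm b]
  exact tendsto_nhds_unique hl (hr.congr fun n => (heq n).symm)

end IsPoissonProcess

end Mecke

/-! ### Mecke's formula, in increasing generality of the exponent. -/

section MeckeFormula

variable {Ω : Type*} [MeasurableSpace Ω] {E : Type*} [MeasurableSpace E]
  {μ : Measure Ω} {X : ℕ → Ω → E} {ν : Measure E}

omit [MeasurableSpace Ω] [MeasurableSpace E] in
lemma tsum_eq_add_sumOthers (X : ℕ → Ω → E) (f : E → ℝ≥0∞) (i : ℕ) (ω : Ω) :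
    ∑' j, f (X j ω) = f (X i ω) + sumOthers X f i ω := by
  rw [ENNReal.tsum_eq_add_tsum_ite (f := fun j => f (X j ω)) i, sumOthers]
  refine congrArg _ (tsum_congr fun j => ?_)
  split_ifs <;> rfl

namespace IsPoissonProcess

variable (h : IsPoissonProcess μ X ν)
include h

lemma lintegral_tsum_indicator {B : Set E} (hB : MeasurableSet B) (hν : ν B ≠ ∞) :
    ∫⁻ ω, ∑' i, B.indicator 1 (X i ω) ∂μ = ν B := by
  rw [← h.lintegral_count hB hν]
  refine lintegral_congr fun ω => ?_
  rw [← lintegral_pointMeasure ω (measurable_one.indicator hB), lintegral_indicator_one hB]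

lemma lintegral_tsum_indicator_ne_top {B : Set E} (hB : MeasurableSet B) (hν : ν B ≠ ∞) :
    ∫⁻ ω, ∑' i, B.indicator (1 : E → ℝ≥0∞) (X i ω) ∂μ ≠ ∞ := by
  rwa [h.lintegral_tsum_indicator hB hν]

lemma ae_forall_notMem {B : Set E} (hB : MeasurableSet B) (hν : ν B = 0) :
    ∀ᵐ ω ∂μ, ∀ i, X i ω ∉ B := by
  have h0 := h.lintegral_tsum_indicator hB (by simp [hν])
  have hm : Measurable fun ω => ∑' i, B.indicator (1 : E → ℝ≥0∞) (X i ω) :=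
    Measurable.tsum fun i => (measurable_one.indicator hB).comp (h.measurable i)
  rw [hν, lintegral_eq_zero_iff hm] at h0
  filter_upwards [h0] with ω hω i hi
  have := (ENNReal.tsum_eq_zero.1 hω) i
  simp [hi] at this

lemma ae_finite_mem {B : Set E} (hB : MeasurableSet B) (hν : ν B ≠ ∞) :
    ∀ᵐ ω ∂μ, {i | X i ω ∈ B}.Finite := by
  have h0 := h.lintegral_tsum_indicator hB hν
  have hm : Measurable fun ω => ∑' i, B.indicator (1 : E → ℝ≥0∞) (X i ω) :=
    Measurable.tsum fun i => (measurable_one.indicator hB).comp (h.measurable i)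
  filter_upwards [ae_lt_top hm (by rw [h0]; exact hν)] with ω hω
  refine (ENNReal.finite_const_le_of_tsum_ne_top hω.ne one_ne_zero).subset fun i hi => ?_
  simp only [mem_ofPred_eq] at hi ⊢
  simp [hi]

variable [SigmaFinite ν]

variable [IsProbabilityMeasure μ]

/-- The exponent on the left still includes the distinguished point, whence the factor `expNeg (f
x)` on the right. -/
lemma lintegral_tsum_mul_expNeg {f g : E → ℝ≥0∞} (hf : Measurable f) (hg : Measurable g) :
    ∫⁻ ω, ∑' i, g (X i ω) * expNeg (∫⁻ x, f x ∂pointMeasure X ω) ∂μ =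
      (∫⁻ x, g x * expNeg (f x) ∂ν) * expNeg (∫⁻ x, (1 - expNeg (f x)) ∂ν) := by
  have hf2 : Measurable fun x => expNeg (f x) := measurable_expNeg.comp hf
  rw [lintegral_tsum_weight_eq (ν := ν) h.measurable (W := fun _ ω => expNeg (∫⁻ x, f x ∂pointMeasure X ω))
    (fun _ => measurable_expNeg.comp (measurable_lintegral_pointMeasure h.measurable hf))
    (ρ := expNeg (∫⁻ x, (1 - expNeg (f x)) ∂ν) • ν.withDensity fun x => expNeg (f x)) ?_ hg]
  · rw [lintegral_smul_measure, lintegral_withDensity_eq_lintegral_mul _ hf2 hg, smul_eq_mul,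
      mul_comm]
    simp only [Pi.mul_apply, mul_comm]
  · intro B hB hν
    rw [Measure.smul_apply, withDensity_apply _ hB, smul_eq_mul, mul_comm,
      ← h.lintegral_count_mul_expNeg hf hB hν]
    refine lintegral_congr fun ω => ?_
    rw [ENNReal.tsum_mul_right, ← lintegral_pointMeasure ω (measurable_one.indicator hB),
      lintegral_indicator_one hB]

/-- Replacing `g` by `g exp f` cancels the contribution of the distinguished point; finiteness of
`f` keeps `exp (-f)` away from `0`. -/
lemma mecke_of_ne_top {f g : E → ℝ≥0∞} (hf : Measurable f) (hg : Measurable g)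
    (hfin : ∀ x, f x ≠ ∞) :
    ∫⁻ ω, ∑' i, g (X i ω) * expNeg (sumOthers X f i ω) ∂μ =
      (∫⁻ x, g x ∂ν) * expNeg (∫⁻ x, (1 - expNeg (f x)) ∂ν) := by
  have h0 : ∀ x, expNeg (f x) ≠ 0 := fun x => by
    rw [expNeg, Ne, EReal.exp_eq_zero_iff, EReal.neg_eq_bot_iff, EReal.coe_ennreal_eq_top_iff]
    exact hfin x
  have hc : ∀ x, g x * (expNeg (f x))⁻¹ * expNeg (f x) = g x := fun x => by
    rw [mul_assoc, ENNReal.inv_mul_cancel (h0 x) (expNeg_ne_top _), mul_one]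
  have key := h.lintegral_tsum_mul_expNeg hf (g := fun x => g x * (expNeg (f x))⁻¹)
    (hg.mul (measurable_expNeg.comp hf).inv)
  simp_rw [hc] at key
  rw [← key]
  refine lintegral_congr fun ω => tsum_congr fun i => ?_
  rw [lintegral_pointMeasure ω hf, tsum_eq_add_sumOthers X f i ω, expNeg_add, ← mul_assoc, hc]

/-- Mecke's formula for a product functional. -/
lemma mecke {f g : E → ℝ≥0∞} (hf : Measurable f) (hg : Measurable g) :
    ∫⁻ ω, ∑' i, g (X i ω) * expNeg (sumOthers X f i ω) ∂μ =
      (∫⁻ x, g x ∂ν) * expNeg (∫⁻ x, (1 - expNeg (f x)) ∂ν) := by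
  set A := expNeg (∫⁻ x, (1 - expNeg (f x)) ∂ν) with hA
  have hS : ∀ i, Measurable fun ω => expNeg (sumOthers X f i ω) := fun i =>
    measurable_expNeg.comp (measurable_sumOthers h.measurable hf i)
  rw [lintegral_tsum_weight_eq (ν := ν) h.measurable hS (ρ := A • ν) ?_ hg, lintegral_smul_measure,
    smul_eq_mul, mul_comm]
  intro B hB hν
  -- Truncation gives finite exponents. The infinite values reached in the limit are the ones that
  -- encode excluded points.
  let F : ℕ → E → ℝ≥0∞ := fun m x => min (f x) m
  have hF : ∀ m, Measurable (F m) := fun m => hf.min measurable_const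
  have hmono : ∀ y, Monotone fun m => F m y := fun y m n hmn =>
    min_le_min_left _ (by exact_mod_cast hmn)
  have hlim : ∀ y, Tendsto (fun m => F m y) atTop (𝓝 (f y)) := fun y => by
    have : Tendsto (fun m : ℕ => min (f y) (m : ℝ≥0∞)) atTop (𝓝 (min (f y) ∞)) :=
      tendsto_const_nhds.min ENNReal.tendsto_nat_nhds_top
    simpa using this
  have hB1 : ∀ i, Measurable fun ω => B.indicator (1 : E → ℝ≥0∞) (X i ω) := fun i =>
    (measurable_one.indicator hB).comp (h.measurable i)
  have hl := tendsto_lintegral_tsum (μ := μ)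
    (F := fun m i ω => B.indicator 1 (X i ω) * expNeg (sumOthers X (F m) i ω))
    (f := fun i ω => B.indicator 1 (X i ω) * expNeg (sumOthers X f i ω))
    (G := fun i ω => B.indicator 1 (X i ω))
    (fun m i => (hB1 i).mul (measurable_expNeg.comp (measurable_sumOthers h.measurable (hF m) i)))
    hB1 (fun i => (hB1 i).mul (hS i)) (fun m i ω => mul_le_of_le_one_right' (expNeg_le_one _))
    (h.lintegral_tsum_indicator_ne_top hB hν) fun i ω =>
      ENNReal.Tendsto.const_mul ((continuous_expNeg.tendsto _).comp
        (tendsto_sumOthers i ω hmono hlim)) (Or.inr (by by_cases hx : X i ω ∈ B <;> simp [hx]))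
  have hr : Tendsto (fun m => ν B * expNeg (∫⁻ x, (1 - expNeg (F m x)) ∂ν)) atTop (𝓝 (ν B * A)) :=
    ENNReal.Tendsto.const_mul (tendsto_expNeg_intensity hF hmono hlim) (Or.inr hν)
  rw [Measure.smul_apply, smul_eq_mul, mul_comm]
  refine tendsto_nhds_unique hl (hr.congr fun m => ?_)
  rw [h.mecke_of_ne_top (hF m) (measurable_one.indicator hB) fun x =>
    ne_top_of_le_ne_top (ENNReal.natCast_ne_top m) (min_le_right _ _), lintegral_indicator_one hB]

/-- On each of the countably many fibres of `k` the exponent no longer depends on the distinguished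
point, so `g` is split along the fibres. -/
lemma mecke_countable {ι : Type*} [Countable ι] [MeasurableSpace ι] [MeasurableSingletonClass ι]
    {k : E → ι} (hk : Measurable k) {f : ι → E → ℝ≥0∞} (hf : ∀ a, Measurable (f a))
    {g : E → ℝ≥0∞} (hg : Measurable g) :
    ∫⁻ ω, ∑' i, g (X i ω) * expNeg (sumOthers X (f (k (X i ω))) i ω) ∂μ =
      ∫⁻ x, g x * expNeg (∫⁻ y, (1 - expNeg (f (k x) y)) ∂ν) ∂ν := by
  have hs : ∀ (x : E) (c : ι → ℝ≥0∞),
      g x * c (k x) = ∑' a, (k ⁻¹' {a}).indicator g x * c a := fun x c => by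
    rw [tsum_eq_single (k x) fun a ha => by
      rw [indicator_of_notMem (fun hx => ha (by simpa using hx.symm)), zero_mul]]
    rw [indicator_of_mem (by simp)]
  have hm : ∀ a, Measurable ((k ⁻¹' {a}).indicator g) := fun a =>
    hg.indicator (hk (measurableSet_singleton a))
  have hS : ∀ i a, Measurable fun ω => (k ⁻¹' {a}).indicator g (X i ω) *
      expNeg (sumOthers X (f a) i ω) := fun i a => ((hm a).comp (h.measurable i)).mul
    (measurable_expNeg.comp (measurable_sumOthers h.measurable (hf a) i))
  have hm2 : ∀ a, AEMeasurable (fun x => (k ⁻¹' {a}).indicator g x *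
      expNeg (∫⁻ y, (1 - expNeg (f a y)) ∂ν)) ν := fun a =>
    ((hm a).mul measurable_const).aemeasurable
  simp_rw [fun i ω => hs (X i ω) fun a => expNeg (sumOthers X (f a) i ω),
    fun x => hs x fun a => expNeg (∫⁻ y, (1 - expNeg (f a y)) ∂ν), ENNReal.tsum_comm (α := ℕ)]
  rw [lintegral_tsum fun a => (Measurable.tsum fun i => hS i a).aemeasurable,
    lintegral_tsum hm2]
  refine tsum_congr fun a => ?_
  rw [h.mecke (hf a) (hm a), lintegral_mul_const _ (hm a)]

/-- Mecke's formula for a product functional that depends on the distinguished point through a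
monotone limit of functions of a discrete variable. -/
lemma mecke_of_tendsto {ι : Type*} [Countable ι] [MeasurableSpace ι] [MeasurableSingletonClass ι]
    {k : ℕ → E → ι} (hk : ∀ n, Measurable (k n)) {F : ℕ → ι → E → ℝ≥0∞}
    (hF : ∀ n a, Measurable (F n a)) {f : E → E → ℝ≥0∞} (hf : Measurable (Function.uncurry f))
    (hmono : ∀ x y, Monotone fun n => F n (k n x) y)
    (hlim : ∀ x y, Tendsto (fun n => F n (k n x) y) atTop (𝓝 (f x y)))
    {g : E → ℝ≥0∞} (hg : Measurable g) :
    ∫⁻ ω, ∑' i, g (X i ω) * expNeg (sumOthers X (f (X i ω)) i ω) ∂μ =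
      ∫⁻ x, g x * expNeg (∫⁻ y, (1 - expNeg (f x y)) ∂ν) ∂ν := by
  have hS : ∀ i, Measurable fun ω => expNeg (sumOthers X (f (X i ω)) i ω) := fun i =>
    measurable_expNeg.comp (measurable_sumOthers_coupled h.measurable hf i)
  have hFu : ∀ n, Measurable (Function.uncurry fun x y => F n (k n x) y) := fun n => by
    have : Measurable fun p : ι × E => F n p.1 p.2 := measurable_from_prod_countable_right (hF n)
    exact this.comp (((hk n).comp measurable_fst).prodMk measurable_snd)
  have hI : ∀ {f : E → E → ℝ≥0∞}, Measurable (Function.uncurry f) →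
      Measurable fun x => expNeg (∫⁻ y, (1 - expNeg (f x y)) ∂ν) := fun {f} hf =>
    have h1 : Measurable fun p : E × E => 1 - expNeg (f p.1 p.2) :=
      measurable_const.sub (measurable_expNeg.comp hf)
    measurable_expNeg.comp h1.lintegral_prod_right'
  rw [lintegral_tsum_weight_eq (ν := ν) h.measurable hS
    (ρ := ν.withDensity fun x => expNeg (∫⁻ y, (1 - expNeg (f x y)) ∂ν)) ?_ hg,
    lintegral_withDensity_eq_lintegral_mul _ (hI hf) hg]
  · simp only [Pi.mul_apply, mul_comm]
  intro B hB hν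
  have hB1 : ∀ i, Measurable fun ω => B.indicator (1 : E → ℝ≥0∞) (X i ω) := fun i =>
    (measurable_one.indicator hB).comp (h.measurable i)
  have hl := tendsto_lintegral_tsum (μ := μ)
    (F := fun m i ω => B.indicator 1 (X i ω) * expNeg (sumOthers X (F m (k m (X i ω))) i ω))
    (f := fun i ω => B.indicator 1 (X i ω) * expNeg (sumOthers X (f (X i ω)) i ω))
    (G := fun i ω => B.indicator 1 (X i ω))
    (fun m i => (hB1 i).mul (measurable_expNeg.comp
      (measurable_sumOthers_coupled h.measurable (hFu m) i)))
    hB1 (fun i => (hB1 i).mul (hS i)) (fun m i ω => mul_le_of_le_one_right' (expNeg_le_one _))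
    (h.lintegral_tsum_indicator_ne_top hB hν) fun i ω =>
      ENNReal.Tendsto.const_mul ((continuous_expNeg.tendsto _).comp
        (tendsto_sumOthers i ω (hmono _) (hlim _)))
        (Or.inr (by by_cases hx : X i ω ∈ B <;> simp [hx]))
  have hr : Tendsto (fun m => ∫⁻ x, B.indicator 1 x *
      expNeg (∫⁻ y, (1 - expNeg (F m (k m x) y)) ∂ν) ∂ν) atTop
      (𝓝 (∫⁻ x, B.indicator 1 x * expNeg (∫⁻ y, (1 - expNeg (f x y)) ∂ν) ∂ν)) := by
    refine tendsto_lintegral_of_dominated_convergence (B.indicator 1)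
      (fun m => (measurable_one.indicator hB).mul (hI (hFu m)))
      (fun m => .of_forall fun x => mul_le_of_le_one_right' (expNeg_le_one _))
      (by rwa [lintegral_indicator_one hB]) (.of_forall fun x => ?_)
    exact ENNReal.Tendsto.const_mul
      (tendsto_expNeg_intensity (fun n => hF n (k n x)) (hmono x) (hlim x))
      (Or.inr (by by_cases hx : x ∈ B <;> simp [hx]))
  have hlast : ∫⁻ x, B.indicator 1 x * expNeg (∫⁻ y, (1 - expNeg (f x y)) ∂ν) ∂ν =
      (ν.withDensity fun x => expNeg (∫⁻ y, (1 - expNeg (f x y)) ∂ν)) B := by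
    rw [withDensity_apply _ hB, ← lintegral_indicator hB]
    refine lintegral_congr fun x => ?_
    by_cases hx : x ∈ B <;> simp [hx]
  rw [← hlast]
  exact tendsto_nhds_unique hl
    (hr.congr fun m => (h.mecke_countable (hk m) (hF m) (measurable_one.indicator hB)).symm)

end IsPoissonProcess

end MeckeFormula

/-! ### Almost sure absence of ties. -/

section NoTies

variable {Ω : Type*} [MeasurableSpace Ω] {E : Type*} [MeasurableSpace E]
  {μ : Measure Ω} {X : ℕ → Ω → E} {ν : Measure E}

/-- The dyadic cell lies in `|b - c| ≤ 2 ^ (-n)`. These sets decrease to a null fibre, and `ν C` is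
finite, so continuity from above applies. -/
lemma tendsto_measure_floor_fiber {b : E → ℝ} (hb : Measurable b) {C : Set E}
    (hC : MeasurableSet C) (hν : ν C ≠ ∞) (hfib : ∀ c, ν (b ⁻¹' {c}) = 0) (c : ℝ) :
    Tendsto (fun n : ℕ => ν (C ∩ {y | ⌊2 ^ n * b y⌋ = ⌊2 ^ n * c⌋})) atTop (𝓝 0) := by
  have hlt : ∀ (n : ℕ) y, ⌊2 ^ n * b y⌋ = ⌊2 ^ n * c⌋ → |b y - c| ≤ (1 / 2) ^ n := fun n y hy => by
    have h1 := Int.abs_sub_lt_one_of_floor_eq_floor hy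
    rw [← mul_sub, abs_mul, abs_of_pos (by positivity : (0 : ℝ) < 2 ^ n)] at h1
    rw [one_div_pow, le_div_iff₀ (by positivity), mul_comm]
    exact h1.le
  let D : ℕ → Set E := fun n => C ∩ {y | |b y - c| ≤ (1 / 2) ^ n}
  have hD : ∀ n, MeasurableSet (D n) := fun n =>
    hC.inter (measurableSet_le (by fun_prop) measurable_const)
  have hanti : Antitone D := fun m n hmn => inter_subset_inter_right _ fun y hy =>
    le_trans hy (pow_le_pow_of_le_one (a := (1 / 2 : ℝ)) (by norm_num) (by norm_num) hmn)
  have hlim := tendsto_measure_iInter_atTop (μ := ν) (fun n => (hD n).nullMeasurableSet) hanti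
    ⟨0, ne_top_of_le_ne_top hν (measure_mono inter_subset_left)⟩
  have h0 : ν (⋂ n, D n) = 0 := by
    refine measure_mono_null (fun y hy => ?_) (hfib c)
    have h1 : ∀ n : ℕ, |b y - c| ≤ (1 / 2) ^ n := fun n => (mem_iInter.1 hy n).2
    have h2 : |b y - c| ≤ 0 := ge_of_tendsto
      (tendsto_pow_atTop_nhds_zero_of_lt_one (by norm_num) (by norm_num)) (.of_forall h1)
    exact sub_eq_zero.1 (abs_eq_zero.1 (le_antisymm h2 (abs_nonneg _)))
  rw [h0] at hlim
  exact tendsto_of_tendsto_of_tendsto_of_le_of_le tendsto_const_nhds hlim (fun _ => zero_le)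
    fun n => measure_mono (inter_subset_inter_right _ fun y hy => hlt n y hy)

namespace IsPoissonProcess

variable (h : IsPoissonProcess μ X ν) [SigmaFinite ν] [IsProbabilityMeasure μ]
include h

/-- With `f` infinite on coincidences, `expNeg (sumOthers …)` is the indicator that a point has no
partner in `B`. Mecke's formula shows that the mean number of points of `B` without partner is at
least `ν B`, the mean number of all points of `B`. Hence almost surely no point of `B` has a
partner. -/
lemma ae_ne_of_null_fibers_on {a b : E → ℝ} (ha : Measurable a) (hb : Measurable b)
    (hfib : ∀ c, ν (b ⁻¹' {c}) = 0) {B : Set E} (hB : MeasurableSet B) (hν : ν B ≠ ∞) :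
    ∀ᵐ ω ∂μ, ∀ i j, i ≠ j → X i ω ∈ B → X j ω ∈ B → a (X i ω) ≠ b (X j ω) := by
  let f : E → E → ℝ≥0∞ := fun x y => ({y | y ∈ B ∧ b y = a x} : Set E).indicator (fun _ => ∞) y
  let F : ℕ → ℤ → E → ℝ≥0∞ := fun n m => (B ∩ {y | ⌊2 ^ n * b y⌋ = m}).indicator fun _ => ∞
  have hDm : ∀ (n : ℕ) (m : ℤ), MeasurableSet (B ∩ {y | ⌊2 ^ n * b y⌋ = m}) := fun n m =>
    hB.inter ((Int.measurable_floor.comp (measurable_const.mul hb)) (measurableSet_singleton m))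
  have hk : ∀ n : ℕ, Measurable fun x => ⌊2 ^ n * a x⌋ := fun n =>
    Int.measurable_floor.comp (measurable_const.mul ha)
  have hF : ∀ n m, Measurable (F n m) := fun n m => measurable_const.indicator (hDm n m)
  have hf : Measurable (Function.uncurry f) := by
    have hs : MeasurableSet {p : E × E | p.2 ∈ B ∧ b p.2 = a p.1} :=
      (measurable_snd hB).inter
        (measurableSet_eq_fun (hb.comp measurable_snd) (ha.comp measurable_fst))
    exact (measurable_const (a := (∞ : ℝ≥0∞))).indicator hs
  have hle : ∀ n x y, f x y ≤ F n ⌊2 ^ n * a x⌋ y := fun n x y => by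
    by_cases hy : y ∈ B ∧ b y = a x
    · have : y ∈ B ∩ {y | ⌊2 ^ n * b y⌋ = ⌊2 ^ n * a x⌋} := ⟨hy.1, by simp [hy.2]⟩
      simp only [F, indicator_of_mem this, le_top]
    · simp only [f]
      rw [indicator_of_notMem (by simpa using hy)]
      exact zero_le
  have hB1 : ∀ i, Measurable fun ω => B.indicator (1 : E → ℝ≥0∞) (X i ω) := fun i =>
    (measurable_one.indicator hB).comp (h.measurable i)
  have hS : ∀ i, Measurable fun ω => expNeg (sumOthers X (f (X i ω)) i ω) := fun i =>
    measurable_expNeg.comp (measurable_sumOthers_coupled h.measurable hf i)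
  have hint : ∀ n x, ∫⁻ y, (1 - expNeg (F n ⌊2 ^ n * a x⌋ y)) ∂ν =
      ν (B ∩ {y | ⌊2 ^ n * b y⌋ = ⌊2 ^ n * a x⌋}) := fun n x => by
    rw [← lintegral_indicator_one (hDm n _)]
    refine lintegral_congr fun y => ?_
    by_cases hy : y ∈ B ∩ {y | ⌊2 ^ n * b y⌋ = ⌊2 ^ n * a x⌋} <;> simp [F, hy]
  have hge : ν B ≤ ∫⁻ ω, ∑' i, B.indicator 1 (X i ω) * expNeg (sumOthers X (f (X i ω)) i ω) ∂μ := by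
    have hlim : Tendsto (fun n : ℕ => ∫⁻ x, B.indicator 1 x *
        expNeg (∫⁻ y, (1 - expNeg (F n ⌊2 ^ n * a x⌋ y)) ∂ν) ∂ν) atTop
        (𝓝 (∫⁻ x, B.indicator 1 x * expNeg 0 ∂ν)) := by
      refine tendsto_lintegral_of_dominated_convergence (B.indicator 1) (fun n => ?_)
        (fun m => .of_forall fun x => mul_le_of_le_one_right' (expNeg_le_one _))
        (by rwa [lintegral_indicator_one hB]) (.of_forall fun x => ?_)
      · refine (measurable_one.indicator hB).mul (measurable_expNeg.comp ?_)
        exact (measurable_of_countable fun m : ℤ => ∫⁻ y, (1 - expNeg (F n m y)) ∂ν).comp (hk n)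
      · refine ENNReal.Tendsto.const_mul ((continuous_expNeg.tendsto _).comp ?_)
          (Or.inr (by by_cases hx : x ∈ B <;> simp [hx]))
        simp_rw [hint]
        exact tendsto_measure_floor_fiber hb hB hν hfib (a x)
    simp only [expNeg_zero, mul_one, lintegral_indicator_one hB] at hlim
    refine le_of_tendsto hlim (.of_forall fun n => ?_)
    rw [← h.mecke_countable (hk n) (hF n) (measurable_one.indicator hB)]
    refine lintegral_mono fun ω => ENNReal.tsum_le_tsum fun i => mul_le_mul' le_rfl
      (antitone_expNeg (ENNReal.tsum_le_tsum fun j => ?_))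
    split_ifs
    · exact le_rfl
    · exact hle _ _ _
  have hsplit : ∀ ω, ∑' i, B.indicator (1 : E → ℝ≥0∞) (X i ω) =
      ∑' i, B.indicator 1 (X i ω) * expNeg (sumOthers X (f (X i ω)) i ω) +
        ∑' i, B.indicator 1 (X i ω) * (1 - expNeg (sumOthers X (f (X i ω)) i ω)) := fun ω => by
    rw [← ENNReal.tsum_add]
    refine tsum_congr fun i => ?_
    rw [← mul_add, add_tsub_cancel_of_le (expNeg_le_one _), mul_one]
  have htot := h.lintegral_tsum_indicator hB hν
  simp_rw [hsplit] at htot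
  have hm2 : Measurable fun ω =>
      ∑' i, B.indicator 1 (X i ω) * (1 - expNeg (sumOthers X (f (X i ω)) i ω)) :=
    Measurable.tsum fun i => (hB1 i).mul (measurable_const.sub (hS i))
  rw [lintegral_add_right _ hm2] at htot
  have hzero : ∫⁻ ω, ∑' i, B.indicator 1 (X i ω) *
      (1 - expNeg (sumOthers X (f (X i ω)) i ω)) ∂μ = 0 := by
    -- Finiteness of `ν B` allows it to be cancelled.
    have h1 := (add_le_add_left hge _).trans_eq htot
    by_contra hne
    exact absurd h1 (not_le.2 (ENNReal.lt_add_right hν hne))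
  rw [lintegral_eq_zero_iff hm2] at hzero
  filter_upwards [hzero] with ω hω i j hij hi hj hab
  have h1 := (ENNReal.tsum_eq_zero.1 hω) i
  have h2 : sumOthers X (f (X i ω)) i ω = ∞ := by
    refine ENNReal.tsum_eq_top_of_eq_top ⟨j, ?_⟩
    rw [if_neg hij.symm]
    exact indicator_of_mem (show X j ω ∈ {y | y ∈ B ∧ b y = a (X i ω)} from ⟨hj, hab.symm⟩) _
  rw [h2] at h1
  simp [hi] at h1

lemma ae_ne_of_null_fibers {a b : E → ℝ} (ha : Measurable a) (hb : Measurable b)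
    (hfib : ∀ c, ν (b ⁻¹' {c}) = 0) :
    ∀ᵐ ω ∂μ, ∀ i j, i ≠ j → a (X i ω) ≠ b (X j ω) := by
  have h1 : ∀ᵐ ω ∂μ, ∀ n i j, i ≠ j → X i ω ∈ spanningSets ν n → X j ω ∈ spanningSets ν n →
      a (X i ω) ≠ b (X j ω) := ae_all_iff.2 fun n =>
    h.ae_ne_of_null_fibers_on ha hb hfib (measurableSet_spanningSets ν n)
      (measure_spanningSets_lt_top ν n).ne
  filter_upwards [h1] with ω hω i j hij
  obtain ⟨n, h1, h2⟩ := ((eventually_mem_spanningSets ν (X i ω)).and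
    (eventually_mem_spanningSets ν (X j ω))).exists
  exact hω n i j hij h1 h2

end IsPoissonProcess

end NoTies

/-! ### Pieces, monotonicity and decay of the path loss. -/

namespace PathLossModel

variable {M : PathLossModel}

lemma L_le_dist3 (r : ℝ) : M.L ≤ M.dist3 r :=
  Real.le_sqrt_of_sq_le (by nlinarith [sq_nonneg r])

lemma dist3_pos {r : ℝ} (hr : r ≠ 0) : 0 < M.dist3 r :=
  Real.sqrt_pos.2 (by positivity)

lemma dist3_mem {r : ℝ} (hr : r ≠ 0) : M.dist3 r ∈ Ici M.L ∩ Ioi 0 :=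
  ⟨L_le_dist3 r, dist3_pos hr⟩

lemma continuous_dist3 : Continuous M.dist3 := by
  unfold dist3; fun_prop

lemma dist3_strictMonoOn : StrictMonoOn M.dist3 (Ici 0) := fun a ha b _ hab =>
  Real.sqrt_lt_sqrt (by positivity) (by
    have : a ^ 2 < b ^ 2 := pow_lt_pow_left₀ hab ha two_ne_zero
    linarith)

lemma le_dist3 (r : ℝ) : r ≤ M.dist3 r :=
  Real.le_sqrt_of_sq_le (by nlinarith [sq_nonneg M.L])

lemma Valid.d_mono (hM : M.Valid) {m n : ℕ} (hmn : m ≤ n) (hn : n < M.N) : M.d m ≤ M.d n := by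
  induction n, hmn using Nat.le_induction with
  | base => exact le_rfl
  | succ n hmn ih =>
    exact (ih (by omega)).trans (hM.d_lt (n + 1) (by omega) hn).le

lemma Valid.exists_mem_piece (hM : M.Valid) {w : ℝ} (hw : M.L ≤ w) :
    ∃ n ∈ Finset.Icc 1 M.N, w ∈ M.piece n := by
  classical
  -- The least such index is the right piece: its minimality gives the lower bound `d (n - 1) < w`.
  have hex : ∃ n, 1 ≤ n ∧ (n < M.N → w ≤ M.d n) := ⟨M.N, hM.N_pos, fun h => absurd h (lt_irrefl _)⟩
  set n := Nat.find hex with hn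
  obtain ⟨h1, h2⟩ := Nat.find_spec hex
  have hle : n ≤ M.N := Nat.find_min' hex ⟨hM.N_pos, fun h => absurd h (lt_irrefl _)⟩
  refine ⟨n, Finset.mem_Icc.2 ⟨h1, hle⟩, ?_, h2⟩
  rcases h1.eq_or_lt with h | h
  · rcases hw.eq_or_lt with h' | h'
    · exact Or.inl ⟨h.symm, h'.symm⟩
    · right
      rw [hn, ← h, Nat.sub_self, hM.d_zero]
      exact h'
  · right
    have := Nat.find_min hex (show n - 1 < n by omega)
    simp only [not_and, Classical.not_imp, not_le] at this
    exact (this (by omega)).2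

lemma Valid.piece_unique (hM : M.Valid) {w : ℝ} {m n : ℕ} (hm : m ∈ Finset.Icc 1 M.N)
    (hn : n ∈ Finset.Icc 1 M.N) (hwm : w ∈ M.piece m) (hwn : w ∈ M.piece n) : m = n := by
  wlog hlt : m < n generalizing m n
  · by_contra hne
    exact hne (this hn hm hwn hwm (by omega)).symm
  exfalso
  rw [Finset.mem_Icc] at hm hn
  have h1 := hwm.2 (by omega)
  rcases hwn.1 with h | h
  · omega
  · exact absurd (h1.trans (hM.d_mono (show m ≤ n - 1 by omega) (by omega))) (not_le.2 h)

lemma Valid.sum_indicator_piece (hM : M.Valid) {w : ℝ} {n : ℕ} (hn : n ∈ Finset.Icc 1 M.N)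
    (hw : w ∈ M.piece n) (f : ℕ → ℝ → ℝ) :
    ∑ m ∈ Finset.Icc 1 M.N, (M.piece m).indicator (f m) w = f n w := by
  rw [Finset.sum_eq_single_of_mem n hn fun m hm hmn => ?_, indicator_of_mem hw]
  exact indicator_of_notMem (fun h => hmn (hM.piece_unique hm hn h hw)) _

lemma Valid.zeta_eq (hM : M.Valid) {w : ℝ} {n : ℕ} (hn : n ∈ Finset.Icc 1 M.N)
    (hw : w ∈ M.piece n) (q : Path) : M.zeta q w = M.zetaPiece q n w :=
  hM.sum_indicator_piece hn hw _

lemma Valid.prLoS_mem (hM : M.Valid) {w : ℝ} (hw : M.L ≤ w) : M.prLoS w ∈ Icc (0 : ℝ) 1 := by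
  obtain ⟨n, hn, hwn⟩ := hM.exists_mem_piece hw
  rw [prLoS, hM.sum_indicator_piece hn hwn]
  exact hM.prL_mem n hn w hwn

lemma Valid.prPath_nonneg (hM : M.Valid) (q : Path) {w : ℝ} (hw : M.L ≤ w) : 0 ≤ M.prPath q w := by
  have := hM.prLoS_mem hw
  cases q
  · exact this.1
  · exact sub_nonneg.2 this.2

lemma Valid.zeta_pos (hM : M.Valid) (q : Path) {w : ℝ} (hw : w ∈ Ici M.L ∩ Ioi 0) :
    0 < M.zeta q w := by
  obtain ⟨n, hn, hwn⟩ := hM.exists_mem_piece hw.1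
  rw [hM.zeta_eq hn hwn]
  exact mul_pos (hM.A_pos q n hn) (Real.rpow_pos_of_pos hw.2 _)

lemma Valid.zeta_nonneg (hM : M.Valid) (q : Path) {w : ℝ} (hw : 0 ≤ w) : 0 ≤ M.zeta q w :=
  Finset.sum_nonneg fun n hn => indicator_apply_nonneg fun _ =>
    mul_nonneg (hM.A_pos q n hn).le (Real.rpow_nonneg hw _)

/-- Monotonicity on each piece is what makes the LoS probability measurable. -/
lemma Valid.measurable_prLoS (hM : M.Valid) : Measurable M.prLoS := by
  unfold prLoS
  refine Finset.measurable_fun_sum _ fun n hn => ?_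
  have hs : MeasurableSet (M.piece n) := measurableSet_piece n
  have h1 : Antitone fun w : M.piece n => M.prL n w := fun a b hab =>
    hM.prL_anti n hn a.2 b.2 hab
  classical
  have h2 : Measurable fun w => if h : w ∈ M.piece n then M.prL n w else 0 :=
    Measurable.dite (f := fun w : M.piece n => M.prL n w) (g := fun _ => (0 : ℝ))
      h1.measurable measurable_const hs
  convert h2 using 1
  funext w
  by_cases hw : w ∈ M.piece n <;> simp [hw]

lemma Valid.measurable_prPath (hM : M.Valid) (q : Path) : Measurable (M.prPath q) := by
  cases q
  · exact hM.measurable_prLoS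
  · exact measurable_const.sub hM.measurable_prLoS

/-- On the last, unbounded piece the path loss is a single power, and strict decrease forces its
exponent `α` to be positive. -/
lemma Valid.tendsto_zeta (hM : M.Valid) (q : Path) : Tendsto (M.zeta q) atTop (𝓝 0) := by
  have hN : M.N ∈ Finset.Icc 1 M.N := Finset.mem_Icc.2 ⟨hM.N_pos, le_rfl⟩
  set D := max (max M.L 0) (M.d (M.N - 1)) with hD
  have hpiece : ∀ w, D < w → w ∈ M.piece M.N := fun w hw =>
    ⟨Or.inr ((le_max_right _ _).trans_lt hw), fun h => absurd h (lt_irrefl _)⟩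
  have hmem : ∀ w, D < w → w ∈ Ici M.L ∩ Ioi 0 := fun w hw =>
    ⟨((le_max_left _ _).trans (le_max_left _ _)).trans hw.le,
      ((le_max_right _ _).trans (le_max_left _ _)).trans_lt hw⟩
  have hA := hM.A_pos q M.N hN
  have hα : 0 < M.α q M.N := by
    by_contra hneg
    have h1 : D < D + 1 := by linarith
    have h2 : D < D + 2 := by linarith
    have h3 := hM.decreasing_zeta q (hmem _ h1) (hmem _ h2) (by linarith)
    rw [hM.zeta_eq hN (hpiece _ h1), hM.zeta_eq hN (hpiece _ h2)] at h3
    refine absurd h3 (not_lt.2 (mul_le_mul_of_nonneg_left ?_ hA.le))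
    exact Real.rpow_le_rpow (hmem _ h1).2.le (by linarith) (by linarith)
  have h1 := (tendsto_rpow_neg_atTop hα).const_mul (M.A q M.N)
  rw [mul_zero] at h1
  refine h1.congr' ?_
  filter_upwards [eventually_gt_atTop D] with w hw
  rw [hM.zeta_eq hN (hpiece w hw)]
  rfl

lemma Valid.zeta_dist3_strictAntiOn (hM : M.Valid) (q : Path) :
    StrictAntiOn (fun u => M.zeta q (M.dist3 u)) (Ioi 0) := fun _ ha _ hb hab =>
  hM.decreasing_zeta q (dist3_mem (ne_of_gt ha)) (dist3_mem (ne_of_gt hb))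
    (dist3_strictMonoOn (mem_Ici.2 (le_of_lt ha)) (mem_Ici.2 (le_of_lt hb)) hab)

lemma Valid.zeta_dist3_continuousOn (hM : M.Valid) (q : Path) :
    ContinuousOn (fun u => M.zeta q (M.dist3 u)) (Ioi 0) :=
  (hM.continuous_zeta q).comp continuous_dist3.continuousOn fun _ hu => dist3_mem (ne_of_gt hu)

lemma Valid.tendsto_zeta_dist3 (hM : M.Valid) (q : Path) :
    Tendsto (fun u => M.zeta q (M.dist3 u)) atTop (𝓝 0) :=
  (hM.tendsto_zeta q).comp (tendsto_atTop_mono le_dist3 tendsto_id)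

lemma Valid.zeta_dist3_le_iff (hM : M.Valid) (q : Path) {u r : ℝ} (hu : 0 < u) (hr : 0 < r) :
    M.zeta q (M.dist3 u) ≤ M.zeta q (M.dist3 r) ↔ r ≤ u :=
  (hM.zeta_dist3_strictAntiOn q).le_iff_ge hu hr

/-- If `c` is attained at a positive distance, that distance is unique by strict decrease. Otherwise
the path loss stays below `c` on all of `(0, ∞)`, and the convention that the crossing distance is
then `0` fits. -/
lemma Valid.zeta_dist3_le_iff_crossDist_le (hM : M.Valid) (q : Path) {c u : ℝ} (hc : 0 < c)
    (hu : 0 < u) : M.zeta q (M.dist3 u) ≤ c ↔ M.crossDist q c ≤ u := by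
  by_cases hex : ∃ u₀, 0 < u₀ ∧ M.zeta q (M.dist3 u₀) = c
  · obtain ⟨u₀, h0, rfl⟩ := hex
    have : IsGreatest {u | 0 ≤ u ∧ M.zeta q (M.dist3 u) = M.zeta q (M.dist3 u₀)} u₀ := by
      refine ⟨⟨h0.le, rfl⟩, fun v hv => ?_⟩
      rcases hv.1.eq_or_lt with h | h
      · exact h ▸ h0.le
      · exact ((hM.zeta_dist3_strictAntiOn q).injOn h h0 hv.2).le
    rw [crossDist, this.csSup_eq, hM.zeta_dist3_le_iff q hu h0]
  · push Not at hex
    have h0 : M.crossDist q c ≤ 0 := by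
      refine Real.sSup_nonpos fun v hv => ?_
      by_contra hv0
      exact hex v (not_le.1 hv0) hv.2
    refine iff_of_true ?_ (h0.trans hu.le)
    by_contra hlt
    rw [not_le] at hlt
    -- A value above `c` at `u` and the decay to `0` would give a solution by the intermediate value
    -- theorem.
    obtain ⟨b, hb1, hb2⟩ := (((hM.tendsto_zeta_dist3 q).eventually (gt_mem_nhds hc)).and
      (eventually_ge_atTop u)).exists
    obtain ⟨v, hv, hvc⟩ := intermediate_value_Icc' hb2
      ((hM.zeta_dist3_continuousOn q).mono fun x hx => hu.trans_le hx.1)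
      (show c ∈ Icc _ _ from ⟨hb1.le, hlt.le⟩)
    exact hex v (hu.trans_le hv.1) hvc

end PathLossModel

/-! ### Averaging over link types and gains. -/

instance : Fintype Path := ⟨⟨{.LoS, .NLoS}, by simp⟩, by rintro (_ | _) <;> simp⟩

lemma sum_path {β : Type*} [AddCommMonoid β] (f : Path → β) : ∑ t, f t = f .LoS + f .NLoS := by
  change Multiset.sum (Multiset.map f {.LoS, .NLoS}) = _
  simp

/-- The path loss of a link of type `q` to a base station at `x`. -/
def lossAt (M : PathLossModel) (q : Path) (x : Plane) : ℝ := M.zeta q (M.dist3 ‖x‖)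

/-- The probability that the link to a base station at `x` has type `q`. -/
def probAt (M : PathLossModel) (q : Path) (x : Plane) : ℝ≥0∞ :=
  ENNReal.ofReal (M.prPath q (M.dist3 ‖x‖))

lemma measurable_dist3_norm {M : PathLossModel} : Measurable fun x : Plane => M.dist3 ‖x‖ :=
  (PathLossModel.continuous_dist3.comp continuous_norm).measurable

lemma measurable_lossAt {M : PathLossModel} (q : Path) : Measurable (lossAt M q) :=
  (measurable_zeta q).comp measurable_dist3_norm

lemma measurable_probAt {M : PathLossModel} (hM : M.Valid) (q : Path) : Measurable (probAt M q) :=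
  ((hM.measurable_prPath q).comp measurable_dist3_norm).ennreal_ofReal

lemma sum_probAt {M : PathLossModel} (hM : M.Valid) (x : Plane) : ∑ t, probAt M t x = 1 := by
  rw [sum_path, probAt, probAt, ← ENNReal.ofReal_add
    (hM.prPath_nonneg _ (PathLossModel.L_le_dist3 _))
    (hM.prPath_nonneg _ (PathLossModel.L_le_dist3 _))]
  simp [PathLossModel.prPath]

namespace IsNetwork

variable {Ω : Type*} [MeasurableSpace Ω] {M : PathLossModel} {lam : ℝ} {μ : Measure Ω}
  {X : ℕ → Ω → Plane} {T : ℕ → Ω → Path} {G : ℕ → Ω → ℝ}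

lemma measurable_X (h : IsNetwork M lam μ X T G) : Measurable fun ω i => X i ω :=
  measurable_pi_lambda _ h.poisson.measurable

lemma measurableSet_types (h : IsNetwork M lam μ X T G) (s : Finset ℕ) (t : ℕ → Path) :
    MeasurableSet {ω | ∀ i ∈ s, T i ω = t i} := by
  have : {ω | ∀ i ∈ s, T i ω = t i} = ⋂ i ∈ s, T i ⁻¹' {t i} := by ext; simp
  rw [this]
  exact Finset.measurableSet_biInter s fun i _ => h.measurable_T i (measurableSet_singleton _)

variable (h : IsNetwork M lam μ X T G) (hM : M.Valid)
include h hM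

lemma lintegral_types (s : Finset ℕ) (t : ℕ → Path) {φ : (ℕ → Plane) → ℝ≥0∞} (hφ : Measurable φ) :
    ∫⁻ ω in {ω | ∀ i ∈ s, T i ω = t i}, φ (fun i => X i ω) ∂μ =
      ∫⁻ ω, (∏ i ∈ s, probAt M (t i) (X i ω)) * φ (fun i => X i ω) ∂μ := by
  have hd : Measurable fun ω => ∏ i ∈ s, probAt M (t i) (X i ω) :=
    Finset.measurable_fun_prod _ fun i _ => (measurable_probAt hM _).comp (h.poisson.measurable i)
  have hX := h.measurable_X
  have hms := h.measurableSet_types s t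
  have heq : (μ.restrict {ω | ∀ i ∈ s, T i ω = t i}).map (fun ω i => X i ω) =
      (μ.withDensity fun ω => ∏ i ∈ s, probAt M (t i) (X i ω)).map (fun ω i => X i ω) := by
    ext B hB
    rw [Measure.map_apply hX hB, Measure.map_apply hX hB, Measure.restrict_apply (hX hB),
      withDensity_apply _ (hX hB)]
    exact h.types s t B hB
  rw [← lintegral_map hφ hX, heq, lintegral_map hφ hX]
  exact lintegral_withDensity_eq_lintegral_mul _ hd (hφ.comp hX)

/-- The form needed for induction on `s`: the types on `s₀` are already prescribed and `φ` collects
the weights already separated. The inductive step splits according to the type of one link and moves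
its index from `s` to `s₀`. -/
lemma lintegral_prod_types_aux (s : Finset ℕ) {w : ℕ → Path → (ℕ → Plane) → ℝ≥0∞}
    (hw : ∀ j t, Measurable (w j t)) : ∀ (s₀ : Finset ℕ) (t₀ : ℕ → Path) (φ : (ℕ → Plane) → ℝ≥0∞),
    Measurable φ → Disjoint s₀ s →
    ∫⁻ ω in {ω | ∀ i ∈ s₀, T i ω = t₀ i},
        φ (fun i => X i ω) * ∏ j ∈ s, w j (T j ω) (fun i => X i ω) ∂μ =
      ∫⁻ ω, (∏ i ∈ s₀, probAt M (t₀ i) (X i ω)) * (φ (fun i => X i ω) *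
        ∏ j ∈ s, ∑ t, probAt M t (X j ω) * w j t (fun i => X i ω)) ∂μ := by
  classical
  have hX := h.measurable_X
  have hp : ∀ i t, Measurable fun ω => probAt M t (X i ω) := fun i t =>
    (measurable_probAt hM t).comp (h.poisson.measurable i)
  have hwX : ∀ j t, Measurable fun ω => w j t (fun i => X i ω) := fun j t => (hw j t).comp hX
  induction s using Finset.induction_on with
  | empty =>
    intro s₀ t₀ φ hφ _
    simpa using h.lintegral_types hM s₀ t₀ hφ
  | insert a s ha ih =>
    intro s₀ t₀ φ hφ hdisj
    have has₀ : a ∉ s₀ := fun h' => (Finset.disjoint_left.1 hdisj h') (Finset.mem_insert_self a s)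
    have hdisj' : Disjoint (insert a s₀) s := by
      rw [Finset.disjoint_insert_left]
      exact ⟨ha, hdisj.mono_right (Finset.subset_insert a s)⟩
    have hupd : ∀ t, ∀ i ∈ s₀, Function.update t₀ a t i = t₀ i := fun t i hi =>
      Function.update_of_ne (by rintro rfl; exact has₀ hi) _ _
    set A := {ω | ∀ i ∈ s₀, T i ω = t₀ i} with hA
    have hset : ∀ t, {ω | ∀ i ∈ insert a s₀, T i ω = Function.update t₀ a t i} = T a ⁻¹' {t} ∩ A :=
      fun t => by
        ext ω
        simp only [Finset.forall_mem_insert, Function.update_self, hA, mem_inter_iff,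
          mem_preimage, mem_singleton_iff, mem_ofPred_eq]
        refine and_congr_right fun _ => forall₂_congr fun i hi => ?_
        rw [hupd t i hi]
    have hTa : ∀ t, MeasurableSet (T a ⁻¹' {t}) := fun t =>
      h.measurable_T a (measurableSet_singleton _)
    have hsplit : ∀ ω, φ (fun i => X i ω) * ∏ j ∈ insert a s, w j (T j ω) (fun i => X i ω) =
        ∑ t, (T a ⁻¹' {t}).indicator (fun ω => (φ (fun i => X i ω) * w a t (fun i => X i ω)) *
          ∏ j ∈ s, w j (T j ω) (fun i => X i ω)) ω := fun ω => by
      rw [Finset.sum_eq_single_of_mem (T a ω) (Finset.mem_univ _) fun t _ ht =>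
          indicator_of_notMem (fun h' => ht (by simpa using h'.symm)) _,
        indicator_of_mem (by simp), Finset.prod_insert ha, mul_assoc]
    have hwT : ∀ j, Measurable fun ω => w j (T j ω) (fun i => X i ω) := fun j => by
      have : Measurable fun p : Path × (ℕ → Plane) => w j p.1 p.2 :=
        measurable_from_prod_countable_right (hw j)
      exact this.comp ((h.measurable_T j).prodMk hX)
    have hm : ∀ t, Measurable fun ω => (φ (fun i => X i ω) * w a t (fun i => X i ω)) *
          ∏ j ∈ s, w j (T j ω) (fun i => X i ω) := fun t =>
      ((hφ.comp hX).mul (hwX a t)).mul (Finset.measurable_fun_prod _ fun j _ => hwT j)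
    simp_rw [hsplit]
    rw [lintegral_finsetSum _ fun t _ => (hm t).indicator (hTa t)]
    have hstep : ∀ t, ∫⁻ ω in A, (T a ⁻¹' {t}).indicator
        (fun ω => (φ (fun i => X i ω) * w a t (fun i => X i ω)) *
          ∏ j ∈ s, w j (T j ω) (fun i => X i ω)) ω ∂μ =
        ∫⁻ ω, (∏ i ∈ s₀, probAt M (t₀ i) (X i ω)) * (φ (fun i => X i ω) *
          ((probAt M t (X a ω) * w a t (fun i => X i ω)) *
          ∏ j ∈ s, ∑ t, probAt M t (X j ω) * w j t (fun i => X i ω))) ∂μ := fun t => by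
      rw [lintegral_indicator (hTa t), Measure.restrict_restrict (hTa t), ← hset t,
        ih (insert a s₀) (Function.update t₀ a t) (fun x => φ x * w a t x) (hφ.mul (hw a t)) hdisj']
      refine lintegral_congr fun ω => ?_
      rw [Finset.prod_insert has₀, Function.update_self,
        Finset.prod_congr rfl fun i hi => congrArg (fun q => probAt M q (X i ω)) (hupd t i hi)]
      ring
    rw [Finset.sum_congr rfl fun t _ => hstep t, ← lintegral_finsetSum]
    · refine lintegral_congr fun ω => ?_
      rw [Finset.prod_insert ha, ← Finset.mul_sum, ← Finset.mul_sum, ← Finset.sum_mul]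
    · intro t _
      refine (Finset.measurable_fun_prod _ fun i _ => hp i _).mul ((hφ.comp hX).mul
        (((hp a t).mul (hwX a t)).mul (Finset.measurable_fun_prod _ fun j _ =>
          Finset.measurable_fun_sum _ fun t _ => (hp j t).mul (hwX j t))))

lemma lintegral_prod_types (s : Finset ℕ) {w : ℕ → Path → (ℕ → Plane) → ℝ≥0∞}
    (hw : ∀ j t, Measurable (w j t)) :
    ∫⁻ ω, ∏ j ∈ s, w j (T j ω) (fun i => X i ω) ∂μ =
      ∫⁻ ω, ∏ j ∈ s, ∑ t, probAt M t (X j ω) * w j t (fun i => X i ω) ∂μ := by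
  have := h.lintegral_prod_types_aux hM s hw ∅ (fun _ => .LoS) (fun _ => 1) measurable_const
    (Finset.disjoint_empty_left _)
  simpa using this

omit hM

lemma lintegral_comp_gain (i : ℕ) {f : ℝ → ℝ≥0∞} (hf : Measurable f) :
    ∫⁻ ω, f (G i ω) ∂μ = ∫⁻ g, f g ∂expMeasure 1 := by
  rw [← lintegral_map hf (h.measurable_G i), h.gain_law i]

lemma measurable_Z : Measurable fun ω => ((fun i => X i ω), fun i => T i ω) :=
  h.measurable_X.prodMk (measurable_pi_lambda _ h.measurable_T)

lemma measurable_gains : Measurable fun ω i => G i ω :=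
  measurable_pi_lambda _ h.measurable_G

/-- Overwriting the `i`-th gain by `0` keeps the index set `ℕ` and leaves a function of the other
gains only. -/
lemma indepFun_gain_update (i : ℕ) :
    IndepFun (G i) (fun ω => Function.update (fun j => G j ω) i 0) μ := by
  have h1 := indep_iSup_of_disjoint (fun j => (h.measurable_G j).comap_le) h.gain_iIndep
    (S := {i}) (T := {i}ᶜ) disjoint_compl_right
  rw [iSup_singleton] at h1
  refine indep_of_indep_of_le_right h1 ?_
  rw [← measurable_iff_comap_le]
  refine @measurable_pi_lambda _ _ _ (_) _ _ fun j => ?_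
  by_cases hj : j = i
  · subst hj
    simp only [Function.update_self]
    exact measurable_const
  · simp only [Function.update_of_ne hj]
    refine Measurable.mono (comap_measurable (G j)) ?_ le_rfl
    exact le_iSup₂_of_le j (by simpa using hj) le_rfl

variable [IsProbabilityMeasure μ]

/-- Independence and Fubini; the inner variable `ω'` supplies an independent copy of the gains on
the same space. -/
lemma lintegral_gains {F : (ℕ → ℝ) × ((ℕ → Plane) × (ℕ → Path)) → ℝ≥0∞} (hF : Measurable F) :
    ∫⁻ ω, F ((fun i => G i ω), ((fun i => X i ω), fun i => T i ω)) ∂μ =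
      ∫⁻ ω, ∫⁻ ω', F ((fun i => G i ω'), ((fun i => X i ω), fun i => T i ω)) ∂μ ∂μ := by
  have hZ := h.measurable_Z
  have hG := h.measurable_gains
  have h1 := (indepFun_iff_map_prod_eq_prod_map_map hG.aemeasurable hZ.aemeasurable).1 h.gain_indep
  have : IsProbabilityMeasure (μ.map fun ω i => G i ω) :=
    Measure.isProbabilityMeasure_map hG.aemeasurable
  have : IsProbabilityMeasure (μ.map fun ω => ((fun i => X i ω), fun i => T i ω)) :=
    Measure.isProbabilityMeasure_map hZ.aemeasurable
  rw [← lintegral_map hF (hG.prodMk hZ), h1, lintegral_prod_symm _ hF.aemeasurable,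
    lintegral_map hF.lintegral_prod_left' hZ]
  refine lintegral_congr fun ω => ?_
  exact lintegral_map (hF.comp (measurable_id.prodMk measurable_const)) hG

include hM in
/-- Averaging a product over finitely many links with respect to gains and link types. -/
lemma lintegral_prod_links (s : Finset ℕ) {w : ℕ → Path → ℝ → (ℕ → Plane) → ℝ≥0∞}
    (hw : ∀ j t, Measurable fun p : ℝ × (ℕ → Plane) => w j t p.1 p.2) :
    ∫⁻ ω, ∏ j ∈ s, w j (T j ω) (G j ω) (fun i => X i ω) ∂μ =
      ∫⁻ ω, ∏ j ∈ s, ∑ t, probAt M t (X j ω) *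
        ∫⁻ g, w j t g (fun i => X i ω) ∂expMeasure 1 ∂μ := by
  have hw' : ∀ j, Measurable fun p : Path × (ℝ × (ℕ → Plane)) => w j p.1 p.2.1 p.2.2 := fun j =>
    measurable_from_prod_countable_right (hw j)
  have : IsProbabilityMeasure (expMeasure 1) := isProbabilityMeasure_expMeasure one_pos
  rw [h.lintegral_gains (F := fun p => ∏ j ∈ s, w j (p.2.2 j) (p.1 j) p.2.1)
    (Finset.measurable_fun_prod _ fun j _ => (hw' j).comp
      (f := fun p : (ℕ → ℝ) × ((ℕ → Plane) × (ℕ → Path)) => (p.2.2 j, p.1 j, p.2.1)) (by fun_prop))]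
  have hin : ∀ ω, ∫⁻ ω', ∏ j ∈ s, w j (T j ω) (G j ω') (fun i => X i ω) ∂μ =
      ∏ j ∈ s, ∫⁻ g, w j (T j ω) g (fun i => X i ω) ∂expMeasure 1 := fun ω => by
    have hm : ∀ j, Measurable fun g => w j (T j ω) g (fun i => X i ω) := fun j =>
      (hw j (T j ω)).comp (measurable_id.prodMk measurable_const)
    rw [lintegral_prod_eq_prod_lintegral_of_indepFun s
      (fun j ω' => w j (T j ω) (G j ω') (fun i => X i ω)) (h.gain_iIndep.comp _ hm)
      fun j => (hm j).comp (h.measurable_G j)]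
    exact Finset.prod_congr rfl fun j _ => h.lintegral_comp_gain j (hm j)
  simp_rw [hin]
  exact h.lintegral_prod_types hM s (w := fun j t x => ∫⁻ g, w j t g x ∂expMeasure 1)
    fun j t => (hw j t).lintegral_prod_left'

/-- The gain of one link can be averaged separately. -/
lemma lintegral_single_gain (i : ℕ)
    {F : ℝ × (ℕ → ℝ) × ((ℕ → Plane) × (ℕ → Path)) → ℝ≥0∞} (hF : Measurable F) :
    ∫⁻ ω, F (G i ω, Function.update (fun j => G j ω) i 0,
        ((fun i => X i ω), fun i => T i ω)) ∂μ =
      ∫⁻ ω, ∫⁻ g, F (g, Function.update (fun j => G j ω) i 0,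
        ((fun i => X i ω), fun i => T i ω)) ∂expMeasure 1 ∂μ := by
  have : IsProbabilityMeasure (expMeasure 1) := isProbabilityMeasure_expMeasure one_pos
  have hu : Measurable fun γ : ℕ → ℝ => Function.update γ i 0 :=
    measurable_update_left
  have hG := h.measurable_gains
  have hR : Measurable fun ω => Function.update (fun j => G j ω) i 0 := hu.comp hG
  have h1 := (indepFun_iff_map_prod_eq_prod_map_map (h.measurable_G i).aemeasurable
    hR.aemeasurable).1 (h.indepFun_gain_update i)
  have : IsProbabilityMeasure (μ.map fun ω => Function.update (fun j => G j ω) i 0) :=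
    Measure.isProbabilityMeasure_map hR.aemeasurable
  have hH : Measurable fun p : (ℕ → ℝ) × ((ℕ → Plane) × (ℕ → Path)) =>
      ∫⁻ g, F (g, p) ∂expMeasure 1 := hF.lintegral_prod_left'
  rw [h.lintegral_gains (F := fun p => F (p.1 i, Function.update p.1 i 0, p.2))
      (hF.comp (by fun_prop)),
    h.lintegral_gains (F := fun p => ∫⁻ g, F (g, Function.update p.1 i 0, p.2) ∂expMeasure 1)
      (hH.comp ((hu.comp measurable_fst).prodMk measurable_snd))]
  refine lintegral_congr fun ω => ?_
  have hFω : Measurable fun p : ℝ × (ℕ → ℝ) =>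
      F (p.1, p.2, ((fun i => X i ω), fun i => T i ω)) := hF.comp (by fun_prop)
  rw [← lintegral_map hFω ((h.measurable_G i).prodMk hR), h1, h.gain_law i,
    lintegral_prod_symm _ hFω.aemeasurable, lintegral_map hFω.lintegral_prod_left' hR]

end IsNetwork

/-! ### The exponential law, the intensity measure and uniqueness of the serving station. -/

lemma lintegral_expNeg_expMeasure {a : ℝ} (ha : 0 ≤ a) :
    ∫⁻ g, expNeg (ENNReal.ofReal (a * g)) ∂expMeasure 1 = ENNReal.ofReal (1 / (1 + a)) := by
  have hpos : 0 < 1 + a := by linarith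
  have hm : Measurable fun g : ℝ => expNeg (ENNReal.ofReal (a * g)) := by fun_prop
  -- `exp (-g) exp (-a g)` is `1 / (1 + a)` times the exponential density of rate `1 + a`.
  have hpt : ∀ g, exponentialPDF 1 g * expNeg (ENNReal.ofReal (a * g)) =
      ENNReal.ofReal (1 / (1 + a)) * exponentialPDF (1 + a) g := fun g => by
    rcases lt_or_ge g 0 with hg | hg
    · rw [exponentialPDF_of_neg hg, exponentialPDF_of_neg hg, zero_mul, mul_zero]
    · rw [exponentialPDF_of_nonneg hg, exponentialPDF_of_nonneg hg,
        expNeg_ofReal (mul_nonneg ha hg), ← ENNReal.ofReal_mul (by positivity),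
        ← ENNReal.ofReal_mul (by positivity)]
      congr 1
      rw [one_mul, one_mul, ← Real.exp_add, ← mul_assoc, one_div_mul_cancel hpos.ne', one_mul]
      congr 1
      ring
  rw [expMeasure, gammaMeasure]
  refine (lintegral_withDensity_eq_lintegral_mul _ (measurable_gammaPDFReal 1 1).ennreal_ofReal hm).trans ?_
  change ∫⁻ g, exponentialPDF 1 g * expNeg (ENNReal.ofReal (a * g)) = _
  simp_rw [hpt]
  rw [lintegral_const_mul' _ _ ENNReal.ofReal_ne_top, lintegral_exponentialPDF_eq_one hpos, mul_one]

lemma expMeasure_Ioi {t : ℝ} (ht : 0 ≤ t) :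
    expMeasure 1 (Ioi t) = ENNReal.ofReal (Real.exp (-t)) := by
  have : IsProbabilityMeasure (expMeasure 1) := isProbabilityMeasure_expMeasure one_pos
  have h1 : expMeasure 1 (Iic t) = ENNReal.ofReal (1 - Real.exp (-t)) := by
    rw [← ofReal_cdf, cdf_expMeasure_eq one_pos, if_pos ht, one_mul]
  rw [← compl_Iic, prob_compl_eq_one_sub measurableSet_Iic, h1, ← ENNReal.ofReal_one,
    ← ENNReal.ofReal_sub _ (by simp [ht])]
  congr 1
  ring

/-- The intensity measure of the base stations. -/
def intensity (lam : ℝ) : Measure Plane := ENNReal.ofReal lam • volume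

instance (lam : ℝ) : SigmaFinite (intensity lam) := by
  change SigmaFinite (lam.toNNReal • (volume : Measure Plane))
  infer_instance

lemma intensity_null {lam : ℝ} {B : Set Plane} (hB : volume B = 0) : intensity lam B = 0 := by
  rw [intensity, Measure.smul_apply, hB, smul_zero]

lemma intensity_closedBall_ne_top (lam r : ℝ) : intensity lam (Metric.closedBall 0 r) ≠ ∞ := by
  rw [intensity, Measure.smul_apply]
  exact ENNReal.mul_ne_top ENNReal.ofReal_ne_top measure_closedBall_lt_top.ne

/-- The path loss is strictly decreasing in the distance, so a fibre is contained in the origin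
together with at most one circle. -/
lemma intensity_lossAt_fiber {M : PathLossModel} (hM : M.Valid) (lam : ℝ) (q : Path) (c : ℝ) :
    intensity lam (lossAt M q ⁻¹' {c}) = 0 := by
  refine intensity_null ?_
  by_cases hex : ∃ x : Plane, x ≠ 0 ∧ lossAt M q x = c
  · obtain ⟨x, hx, hxc⟩ := hex
    refine measure_mono_null (t := {0} ∪ Metric.sphere 0 ‖x‖) (fun y hy => ?_)
      (measure_union_null (measure_singleton _)
        (Measure.addHaar_sphere_of_ne_zero _ _ (norm_ne_zero_iff.2 hx)))
    by_cases hy0 : y = 0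
    · exact Or.inl hy0
    · right
      rw [mem_sphere_zero_iff_norm]
      exact (hM.zeta_dist3_strictAntiOn q).injOn (norm_pos_iff.2 hy0) (norm_pos_iff.2 hx)
        (show lossAt M q y = lossAt M q x from Eq.trans hy hxc.symm)
  · push Not at hex
    refine measure_mono_null (t := {0}) (fun y hy => ?_) (measure_singleton _)
    by_contra hy0
    exact hex y hy0 hy

lemma lossAt_nonneg {M : PathLossModel} (hM : M.Valid) (q : Path) (x : Plane) :
    0 ≤ lossAt M q x := hM.zeta_nonneg q (Real.sqrt_nonneg _)

lemma lossAt_pos {M : PathLossModel} (hM : M.Valid) (q : Path) {x : Plane} (hx : x ≠ 0) :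
    0 < lossAt M q x := hM.zeta_pos q (PathLossModel.dist3_mem (norm_ne_zero_iff.2 hx))

lemma serving_eq {Ω : Type*} {M : PathLossModel} {X : ℕ → Ω → Plane} {T : ℕ → Ω → Path} {ω : Ω}
    {i : ℕ} (hi : ∀ j, j ≠ i → beta M X T j ω < beta M X T i ω) : serving M X T ω = i := by
  have : {k | ∀ j, beta M X T j ω ≤ beta M X T k ω} = {i} := by
    ext k
    simp only [mem_ofPred_eq, mem_singleton_iff]
    refine ⟨fun hk => ?_, ?_⟩
    · by_contra hki
      exact absurd (hk i) (not_le.2 (hi k hki))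
    · rintro rfl j
      rcases eq_or_ne j k with rfl | hj
      · exact le_rfl
      · exact (hi j hj).le
  rw [serving, this, csInf_singleton]

namespace IsNetwork

variable {Ω : Type*} [MeasurableSpace Ω] {M : PathLossModel} {lam : ℝ} {μ : Measure Ω}
  {X : ℕ → Ω → Plane} {T : ℕ → Ω → Path} {G : ℕ → Ω → ℝ}
  (h : IsNetwork M lam μ X T G)
include h

lemma poisson_intensity : IsPoissonProcess μ X (intensity lam) := h.poisson

lemma ae_ne_zero : ∀ᵐ ω ∂μ, ∀ i, X i ω ≠ 0 := by
  filter_upwards [h.poisson_intensity.ae_forall_notMem (measurableSet_singleton 0)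
    (intensity_null (measure_singleton _))] with ω hω i
  exact hω i

variable (hM : M.Valid) [IsProbabilityMeasure μ]
include hM

/-- Ties are excluded for all pairs of types at once, so the law of the types plays no role. -/
lemma ae_beta_ne : ∀ᵐ ω ∂μ, ∀ i j, i ≠ j → beta M X T i ω ≠ beta M X T j ω := by
  have : ∀ᵐ ω ∂μ, ∀ q q' : Path, ∀ i j, i ≠ j → lossAt M q (X i ω) ≠ lossAt M q' (X j ω) := by
    refine ae_all_iff.2 fun q => ae_all_iff.2 fun q' => ?_
    exact h.poisson_intensity.ae_ne_of_null_fibers (measurable_lossAt q) (measurable_lossAt q')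
      (intensity_lossAt_fiber hM lam q')
  filter_upwards [this] with ω hω i j hij
  exact hω (T i ω) (T j ω) i j hij

/-- Almost surely there is a unique base station with the largest path loss. -/
lemma ae_exists_strict_max :
    ∀ᵐ ω ∂μ, ∃ i, ∀ j, j ≠ i → beta M X T j ω < beta M X T i ω := by
  have hfin : ∀ᵐ ω ∂μ, ∀ n : ℕ, {i | X i ω ∈ Metric.closedBall 0 (n : ℝ)}.Finite :=
    ae_all_iff.2 fun n => h.poisson_intensity.ae_finite_mem Metric.isClosed_closedBall.measurableSet
      (intensity_closedBall_ne_top lam n)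
  filter_upwards [hfin, h.ae_ne_zero, h.ae_beta_ne hM] with ω hω h0 hne
  have hpos : 0 < beta M X T 0 ω := lossAt_pos hM _ (h0 0)
  -- Far stations lose against station `0`, so the maximum is taken over the finitely many stations
  -- of a ball.
  obtain ⟨n, hn⟩ : ∃ n : ℕ, ∀ q, ∀ u, (n : ℝ) ≤ u → M.zeta q (M.dist3 u) < beta M X T 0 ω := by
    have h1 : ∀ᶠ u : ℝ in atTop, ∀ q, M.zeta q (M.dist3 u) < beta M X T 0 ω :=
      eventually_all.2 fun q => (hM.tendsto_zeta_dist3 q).eventually (gt_mem_nhds hpos)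
    obtain ⟨R, hR⟩ := eventually_atTop.1 h1
    obtain ⟨n, hn⟩ := exists_nat_ge R
    exact ⟨n, fun q u hu => hR u (hn.trans hu) q⟩
  have hS : {j | beta M X T 0 ω ≤ beta M X T j ω}.Finite := (hω n).subset fun j hj => by
    by_contra hj'
    simp only [mem_ofPred_eq, mem_closedBall_zero_iff, not_le] at hj'
    exact absurd hj (not_le.2 (hn (T j ω) _ hj'.le))
  obtain ⟨i, hi, hmax⟩ := exists_max_image _ (fun j => beta M X T j ω) hS ⟨0, by simp⟩
  refine ⟨i, fun j hj => lt_of_le_of_ne ?_ (hne j i hj)⟩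
  rcases le_or_gt (beta M X T 0 ω) (beta M X T j ω) with hle | hlt
  · exact hmax j hle
  · exact hlt.le.trans hi

end IsNetwork

instance : DecidableEq Path := Classical.decEq _

/-! ### The factor contributed by one interfering link. -/

section LinkFactor

variable (M : PathLossModel) (P s : ℝ)

/-- The exponent that a link of type `t` and gain `g` to a base station at `y` contributes to the
Laplace transform of the interference; it is infinite if the path loss exceeds `c`. -/
def linkCost (c : ℝ) (t : Path) (g : ℝ) (y : Plane) : ℝ≥0∞ :=
  (if lossAt M t y ≤ c then 0 else ∞) + ENNReal.ofReal s * ENNReal.ofReal (P * lossAt M t y * g)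

/-- The mean of `expNeg (linkCost c t g y)` over link types and gains. -/
def linkFactor (c : ℝ) (y : Plane) : ℝ≥0∞ :=
  ∑ t, probAt M t y * if lossAt M t y ≤ c then ENNReal.ofReal (1 / (1 + s * (P * lossAt M t y))) else 0

/-- The density of the exponent of the Laplace transform of the interference, when all path
losses are at most `c`. -/
def linkGap (c : ℝ) (y : Plane) : ℝ≥0∞ :=
  ∑ t, probAt M t y * if lossAt M t y ≤ c then
    ENNReal.ofReal (s * (P * lossAt M t y) / (1 + s * (P * lossAt M t y))) else 0

variable {M P s}

lemma measurable_linkCost (t : Path) :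
    Measurable fun p : ℝ × ℝ × Plane => linkCost M P s p.1 t p.2.1 p.2.2 := by
  have h1 : Measurable fun p : ℝ × ℝ × Plane => lossAt M t p.2.2 :=
    (measurable_lossAt t).comp (measurable_snd.comp measurable_snd)
  unfold linkCost
  refine Measurable.add (Measurable.ite (measurableSet_le h1 measurable_fst) measurable_const
    measurable_const) ?_
  fun_prop

lemma measurable_linkFactor (hM : M.Valid) :
    Measurable fun p : ℝ × Plane => linkFactor M P s p.1 p.2 := by
  unfold linkFactor
  refine Finset.measurable_fun_sum _ fun t _ => ?_
  have h1 : Measurable fun p : ℝ × Plane => lossAt M t p.2 :=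
    (measurable_lossAt t).comp measurable_snd
  refine ((measurable_probAt hM t).comp measurable_snd).mul
    (Measurable.ite (measurableSet_le h1 measurable_fst) ?_ measurable_const)
  fun_prop

lemma measurable_linkGap (hM : M.Valid) :
    Measurable fun p : ℝ × Plane => linkGap M P s p.1 p.2 := by
  unfold linkGap
  refine Finset.measurable_fun_sum _ fun t _ => ?_
  have h1 : Measurable fun p : ℝ × Plane => lossAt M t p.2 :=
    (measurable_lossAt t).comp measurable_snd
  refine ((measurable_probAt hM t).comp measurable_snd).mul
    (Measurable.ite (measurableSet_le h1 measurable_fst) ?_ measurable_const)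
  fun_prop

variable (hM : M.Valid) (hP : 0 < P) (hs : 0 ≤ s)
include hM hP hs

lemma rate_nonneg (t : Path) (y : Plane) : 0 ≤ s * (P * lossAt M t y) :=
  mul_nonneg hs (mul_nonneg hP.le (lossAt_nonneg hM t y))

lemma linkFactor_eq (c : ℝ) (y : Plane) :
    ∑ t, probAt M t y * ∫⁻ g, expNeg (linkCost M P s c t g y) ∂expMeasure 1 =
      linkFactor M P s c y := by
  refine Finset.sum_congr rfl fun t _ => congrArg _ ?_
  unfold linkCost
  split_ifs
  · rw [← lintegral_expNeg_expMeasure (rate_nonneg hM hP hs t y)]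
    simp_rw [zero_add, ← ENNReal.ofReal_mul hs, mul_assoc]
  · simp

lemma linkFactor_le_one (c : ℝ) (y : Plane) : linkFactor M P s c y ≤ 1 := by
  rw [← sum_probAt hM y]
  refine Finset.sum_le_sum fun t _ => mul_le_of_le_one_right' ?_
  split_ifs
  · have := rate_nonneg hM hP hs t y
    rw [← ENNReal.ofReal_one]
    refine ENNReal.ofReal_le_ofReal ((div_le_one (by positivity)).2 (by linarith))
  · exact zero_le

/-- For an admissible type the two fractions add up to `1`, which is also its factor at `s = 0`. -/
lemma linkFactor_add_linkGap (c : ℝ) (y : Plane) :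
    linkFactor M P s c y + linkGap M P s c y = linkFactor M P 0 c y := by
  rw [linkFactor, linkGap, linkFactor, ← Finset.sum_add_distrib]
  refine Finset.sum_congr rfl fun t _ => ?_
  rw [← mul_add]
  congr 1
  split_ifs
  · have := rate_nonneg hM hP hs t y
    rw [← ENNReal.ofReal_add (by positivity) (by positivity)]
    rw [← add_div, div_self (by positivity)]
    simp
  · simp

/-- This separates the event that no link exceeds `c`, which does not involve `s`, from the
interference of the admissible links. -/
lemma one_sub_linkFactor (c : ℝ) (y : Plane) :
    1 - linkFactor M P s c y = (1 - linkFactor M P 0 c y) + linkGap M P s c y := by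
  have h1 := linkFactor_add_linkGap hM hP hs c y
  have h2 : linkFactor M P s c y ≤ 1 := linkFactor_le_one hM hP hs c y
  have h0 : linkFactor M P 0 c y ≤ 1 := linkFactor_le_one hM hP le_rfl c y
  have hfin : linkFactor M P s c y ≠ ∞ := ne_top_of_le_ne_top ENNReal.one_ne_top h2
  refine ENNReal.sub_eq_of_eq_add hfin ?_
  rw [add_assoc, add_comm (linkGap M P s c y), h1, tsub_add_cancel_of_le h0]

omit hM hP hs in
lemma linkFactor_mono_of_le {c c' : ℝ} (hc : c ≤ c') (y : Plane) :
    linkFactor M P s c y ≤ linkFactor M P s c' y := by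
  refine Finset.sum_le_sum fun t _ => mul_le_mul' le_rfl ?_
  split_ifs with h1 h2
  · exact le_rfl
  · exact absurd (h1.trans hc) h2
  · exact zero_le
  · exact le_rfl

omit hM hP hs in
-- The factor is a right-continuous step function of `c`, with jumps only at the path losses of the
-- two types. For this reason `c` is approximated from above.
lemma linkFactor_eventually_eq {c : ℝ} {u : ℕ → ℝ} (hu : ∀ n, c ≤ u n)
    (hlim : Tendsto u atTop (𝓝 c)) (y : Plane) :
    ∀ᶠ n in atTop, linkFactor M P s (u n) y = linkFactor M P s c y := by
  have : ∀ᶠ n in atTop, ∀ t, lossAt M t y ≤ u n ↔ lossAt M t y ≤ c := by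
    refine eventually_all.2 fun t => ?_
    rcases le_or_gt (lossAt M t y) c with h | h
    · exact .of_forall fun n => iff_of_true (h.trans (hu n)) h
    · filter_upwards [hlim.eventually (gt_mem_nhds h)] with n hn
      exact iff_of_false (not_le.2 hn) (not_le.2 h)
  filter_upwards [this] with n hn
  simp only [linkFactor, hn]

end LinkFactor

/-- The function `-log` on `[0, 1]`, an inverse of `expNeg`. -/
def negLog (v : ℝ≥0∞) : ℝ≥0∞ := (-ENNReal.log v).toENNReal

lemma measurable_negLog : Measurable negLog := by
  unfold negLog
  fun_prop

lemma measurable_linkFactor_comp {M : PathLossModel} {P s : ℝ} (hM : M.Valid) {α : Type*}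
    [MeasurableSpace α] {c : α → ℝ} {y : α → Plane} (hc : Measurable c) (hy : Measurable y) :
    Measurable fun x => negLog (linkFactor M P s (c x) (y x)) := by
  have h1 := measurable_linkFactor (P := P) (s := s) hM
  have h2 := h1.comp (hc.prodMk hy)
  exact measurable_negLog.comp h2

lemma antitone_negLog : Antitone negLog := fun _ _ h =>
  EReal.toENNReal_le_toENNReal (EReal.neg_le_neg_iff.2 (ENNReal.log_monotone h))

lemma expNeg_negLog {v : ℝ≥0∞} (hv : v ≤ 1) : expNeg (negLog v) = v := exists_expNeg_eq hv

/-- The right ends of the dyadic intervals containing `c`: a countable-valued approximation that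
decreases to `c`. -/
lemma floor_approx (c : ℝ) :
    (Antitone fun n : ℕ => ((⌊2 ^ n * c⌋ : ℝ) + 1) / 2 ^ n) ∧
    (∀ n : ℕ, c ≤ ((⌊2 ^ n * c⌋ : ℝ) + 1) / 2 ^ n) ∧
    Tendsto (fun n : ℕ => ((⌊2 ^ n * c⌋ : ℝ) + 1) / 2 ^ n) atTop (𝓝 c) := by
  have hge : ∀ n : ℕ, c ≤ ((⌊2 ^ n * c⌋ : ℝ) + 1) / 2 ^ n := fun n => by
    rw [le_div_iff₀ (by positivity), mul_comm]
    exact (Int.lt_floor_add_one _).le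
  refine ⟨antitone_nat_of_succ_le fun n => ?_, hge, ?_⟩
  · rw [div_le_div_iff₀ (by positivity) (by positivity), pow_succ]
    have h1 : ⌊2 ^ n * 2 * c⌋ + 1 ≤ 2 * (⌊2 ^ n * c⌋ + 1) := by
      rw [Int.add_one_le_iff, Int.floor_lt]
      push_cast
      have := Int.lt_floor_add_one (2 ^ n * c)
      linarith
    have h2 : ((⌊2 ^ n * 2 * c⌋ : ℝ) + 1) ≤ 2 * ((⌊2 ^ n * c⌋ : ℝ) + 1) := by exact_mod_cast h1
    have h3 : (0 : ℝ) < 2 ^ n := by positivity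
    nlinarith
  · have hle : ∀ n : ℕ, ((⌊2 ^ n * c⌋ : ℝ) + 1) / 2 ^ n ≤ c + (1 / 2) ^ n := fun n => by
      rw [div_le_iff₀ (by positivity), add_mul, ← mul_pow]
      have := Int.floor_le (2 ^ n * c)
      norm_num
      linarith
    have hlim : Tendsto (fun n : ℕ => c + (1 / 2 : ℝ) ^ n) atTop (𝓝 (c + 0)) :=
      tendsto_const_nhds.add
        (tendsto_pow_atTop_nhds_zero_of_lt_one (by norm_num) (by norm_num))
    rw [add_zero] at hlim
    exact tendsto_of_tendsto_of_tendsto_of_le_of_le tendsto_const_nhds hlim hge hle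

/-! ### From a distinguished station to a product of link factors. -/

namespace IsNetwork

variable {Ω : Type*} [MeasurableSpace Ω] {M : PathLossModel} {lam : ℝ} {μ : Measure Ω}
  {X : ℕ → Ω → Plane} {T : ℕ → Ω → Path} {G : ℕ → Ω → ℝ}
  (h : IsNetwork M lam μ X T G) (hM : M.Valid) [IsProbabilityMeasure μ]
  {P s : ℝ} (hP : 0 < P) (hs : 0 ≤ s)
include h hM hP hs

/-- Mecke's formula for the product of the link factors of the interferers. -/
lemma mecke_linkFactor (q : Path) {g : Plane → ℝ≥0∞} (hg : Measurable g) :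
    ∫⁻ ω, ∑' i, g (X i ω) * expNeg (sumOthers X
        (fun y => negLog (linkFactor M P s (lossAt M q (X i ω)) y)) i ω) ∂μ =
      ∫⁻ x, g x * expNeg (∫⁻ y, (1 - linkFactor M P s (lossAt M q x) y) ∂intensity lam)
        ∂intensity lam := by
  have hk : ∀ n : ℕ, Measurable fun x => ⌊2 ^ n * lossAt M q x⌋ := fun n =>
    Int.measurable_floor.comp (measurable_const.mul (measurable_lossAt q))
  -- The distinguished point enters through an integer only, its path loss being replaced by a
  -- dyadic upper bound.
  let F : ℕ → ℤ → Plane → ℝ≥0∞ := fun n a y =>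
    negLog (linkFactor M P s (((a : ℝ) + 1) / 2 ^ n) y)
  let f : Plane → Plane → ℝ≥0∞ := fun x y => negLog (linkFactor M P s (lossAt M q x) y)
  have hF : ∀ n a, Measurable (F n a) := fun n a =>
    measurable_linkFactor_comp hM measurable_const measurable_id
  have hf : Measurable (Function.uncurry f) :=
    measurable_linkFactor_comp hM ((measurable_lossAt q).comp measurable_fst) measurable_snd
  have hmono : ∀ x y, Monotone fun n => F n ⌊2 ^ n * lossAt M q x⌋ y := fun x y m n hmn =>
    antitone_negLog (linkFactor_mono_of_le ((floor_approx (lossAt M q x)).1 hmn) y)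
  have hlim : ∀ x y, Tendsto (fun n => F n ⌊2 ^ n * lossAt M q x⌋ y) atTop (𝓝 (f x y)) :=
    fun x y => by
      refine tendsto_const_nhds.congr' ?_
      filter_upwards [linkFactor_eventually_eq (M := M) (P := P) (s := s)
        (floor_approx (lossAt M q x)).2.1 (floor_approx (lossAt M q x)).2.2 y] with n hn
      simp only [F, f, hn]
  refine (h.poisson_intensity.mecke_of_tendsto hk hF hf hmono hlim hg).trans ?_
  refine lintegral_congr fun x => ?_
  simp only [f]
  simp_rw [fun y => expNeg_negLog (linkFactor_le_one hM hP hs (lossAt M q x) y)]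

/-- For the links with index below `N` this is an average of a finite product, and domination by `1`
allows `N → ∞`. -/
lemma lintegral_link_prod (i : ℕ) (q : Path) {a : Plane → ℝ≥0∞} (ha : Measurable a)
    (ha1 : ∀ x, a x ≤ 1) :
    ∫⁻ ω, (if T i ω = q then a (X i ω) else 0) * expNeg (∑' j, if j = i then 0 else
        linkCost M P s (lossAt M q (X i ω)) (T j ω) (G j ω) (X j ω)) ∂μ =
      ∫⁻ ω, (probAt M q (X i ω) * a (X i ω)) * expNeg (sumOthers X
        (fun y => negLog (linkFactor M P s (lossAt M q (X i ω)) y)) i ω) ∂μ := by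
  classical
  have hcost : ∀ j, Measurable fun p : Path × (ℝ × (ℕ → Plane)) =>
      linkCost M P s (lossAt M q (p.2.2 i)) p.1 p.2.1 (p.2.2 j) := fun j =>
    measurable_from_prod_countable_right fun t => by
      have h1 : Measurable fun p : ℝ × (ℕ → Plane) => (lossAt M q (p.2 i), p.1, p.2 j) :=
        ((measurable_lossAt q).comp ((measurable_pi_apply i).comp measurable_snd)).prodMk
          (measurable_fst.prodMk ((measurable_pi_apply j).comp measurable_snd))
      have h2 := (measurable_linkCost (M := M) (P := P) (s := s) t).comp h1
      exact h2
  -- The candidate server carries the type indicator and the weight `a`; every other link carries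
  -- its cost.
  let w : ℕ → Path → ℝ → (ℕ → Plane) → ℝ≥0∞ := fun j t g x =>
    if j = i then (if t = q then a (x i) else 0)
      else expNeg (linkCost M P s (lossAt M q (x i)) t g (x j))
  have hw : ∀ j t, Measurable fun p : ℝ × (ℕ → Plane) => w j t p.1 p.2 := fun j t => by
    by_cases hj : j = i
    · by_cases ht : t = q
      · simp only [w, if_pos hj, if_pos ht]
        exact ha.comp ((measurable_pi_apply i).comp measurable_snd)
      · simp only [w, if_pos hj, if_neg ht]
        exact measurable_const
    · simp only [w, if_neg hj]
      have h1 := (hcost j).comp (f := fun p : ℝ × (ℕ → Plane) => (t, p.1, p.2)) (by fun_prop)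
      exact measurable_expNeg.comp h1
  have hprod : ∀ (N : ℕ) (b : ℝ≥0∞) (e : ℕ → ℝ≥0∞), i < N →
      ∏ j ∈ Finset.range N, (if j = i then b else expNeg (e j)) =
        b * expNeg (∑ j ∈ Finset.range N, if j = i then 0 else e j) := fun N b e hN => by
    have hi : i ∈ Finset.range N := Finset.mem_range.2 hN
    rw [← Finset.mul_prod_erase _ _ hi, if_pos rfl, expNeg_sum, ← Finset.mul_prod_erase _ _ hi,
      if_pos rfl, expNeg_zero, one_mul]
    congr 1
    refine Finset.prod_congr rfl fun j hj => ?_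
    rw [if_neg (Finset.ne_of_mem_erase hj), if_neg (Finset.ne_of_mem_erase hj)]
  have hone : IsProbabilityMeasure (expMeasure 1) := isProbabilityMeasure_expMeasure one_pos
  have hfin : ∀ N, i < N →
      ∫⁻ ω, (if T i ω = q then a (X i ω) else 0) * expNeg (∑ j ∈ Finset.range N, if j = i then 0
        else linkCost M P s (lossAt M q (X i ω)) (T j ω) (G j ω) (X j ω)) ∂μ =
      ∫⁻ ω, (probAt M q (X i ω) * a (X i ω)) * expNeg (∑ j ∈ Finset.range N, if j = i then 0
        else negLog (linkFactor M P s (lossAt M q (X i ω)) (X j ω))) ∂μ := fun N hN => by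
    have key := h.lintegral_prod_links hM (Finset.range N) hw
    have hL : ∀ ω, ∏ j ∈ Finset.range N, w j (T j ω) (G j ω) (fun i => X i ω) =
        (if T i ω = q then a (X i ω) else 0) * expNeg (∑ j ∈ Finset.range N, if j = i then 0
        else linkCost M P s (lossAt M q (X i ω)) (T j ω) (G j ω) (X j ω)) := fun ω => by
      rw [← hprod N _ _ hN]
      refine Finset.prod_congr rfl fun j _ => ?_
      by_cases hj : j = i
      · subst hj; simp [w]
      · simp [w, hj]
    have hR : ∀ ω, ∏ j ∈ Finset.range N, ∑ t, probAt M t (X j ω) *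
        ∫⁻ g, w j t g (fun i => X i ω) ∂expMeasure 1 =
        (probAt M q (X i ω) * a (X i ω)) * expNeg (∑ j ∈ Finset.range N, if j = i then 0
        else negLog (linkFactor M P s (lossAt M q (X i ω)) (X j ω))) := fun ω => by
      rw [← hprod N _ _ hN]
      refine Finset.prod_congr rfl fun j _ => ?_
      by_cases hj : j = i
      · subst hj
        simp only [w, if_true, lintegral_const, measure_univ, mul_one]
        rw [Finset.sum_eq_single_of_mem q (Finset.mem_univ _) fun t _ ht => by
          rw [if_neg ht, mul_zero], if_pos rfl]
      · simp only [w, if_neg hj]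
        rw [linkFactor_eq hM hP hs, expNeg_negLog (linkFactor_le_one hM hP hs _ _)]
    simp_rw [hL, hR] at key
    exact key
  have hcω : ∀ j, Measurable fun ω =>
      linkCost M P s (lossAt M q (X i ω)) (T j ω) (G j ω) (X j ω) := fun j => by
    have h1 := (hcost j).comp ((h.measurable_T j).prodMk ((h.measurable_G j).prodMk h.measurable_X))
    exact h1
  have hfω : ∀ j, Measurable fun ω =>
      negLog (linkFactor M P s (lossAt M q (X i ω)) (X j ω)) := fun j =>
    measurable_linkFactor_comp hM ((measurable_lossAt q).comp (h.poisson.measurable i))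
      (h.poisson.measurable j)
  have hite : ∀ {c : ℕ → Ω → ℝ≥0∞}, (∀ j, Measurable (c j)) →
      ∀ j, Measurable fun ω => if j = i then 0 else c j ω := fun hc j => by
    by_cases hj : j = i
    · simpa only [if_pos hj] using measurable_const
    · simpa only [if_neg hj] using hc j
  have hiTa : Measurable fun ω => if T i ω = q then a (X i ω) else 0 :=
    Measurable.ite (h.measurable_T i (measurableSet_singleton q))
      (ha.comp (h.poisson.measurable i)) measurable_const
  have hpa : Measurable fun ω => probAt M q (X i ω) * a (X i ω) :=
    (((measurable_probAt hM q).mul ha).comp (h.poisson.measurable i))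
  have hlim : ∀ {b : Ω → ℝ≥0∞} {c : ℕ → Ω → ℝ≥0∞}, Measurable b → (∀ ω, b ω ≤ 1) →
      (∀ j, Measurable (c j)) → Tendsto (fun N => ∫⁻ ω, b ω * expNeg
        (∑ j ∈ Finset.range N, if j = i then 0 else c j ω) ∂μ) atTop
        (𝓝 (∫⁻ ω, b ω * expNeg (∑' j, if j = i then 0 else c j ω) ∂μ)) := by
    intro b c hb hb1 hc
    refine tendsto_lintegral_of_dominated_convergence (fun _ => 1) (fun N => ?_)
      (fun N => .of_forall fun ω => mul_le_one' (hb1 ω) (expNeg_le_one _)) (by simp)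
      (.of_forall fun ω => ?_)
    · exact hb.mul (measurable_expNeg.comp (Finset.measurable_fun_sum _ fun j _ => hite hc j))
    · exact ENNReal.Tendsto.const_mul ((continuous_expNeg.tendsto _).comp
        (ENNReal.tendsto_nat_tsum _)) (Or.inr (ne_top_of_le_ne_top ENNReal.one_ne_top (hb1 ω)))
  have hp1 : ∀ x, probAt M q x ≤ 1 := fun x => by
    rw [← sum_probAt hM x]
    exact Finset.single_le_sum (f := fun t => probAt M t x) (fun _ _ => zero_le) (Finset.mem_univ q)
  have hl := hlim hiTa (fun ω => by split_ifs; exacts [ha1 _, zero_le]) hcω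
  have hr := hlim hpa (fun ω => mul_le_one' (hp1 _) (ha1 _)) hfω
  refine tendsto_nhds_unique hl (hr.congr' ?_)
  filter_upwards [eventually_gt_atTop i] with N hN
  exact (hfin N hN).symm

end IsNetwork

/-- A term with `i ≠ i₀` vanishes: if its type is `q`, the link `i₀` exceeds its path loss and has
infinite cost. In the term `i₀` no such penalty occurs, and the costs add up to `s` times the
interference. -/
lemma tsum_links_eq {Ω : Type*} {M : PathLossModel} {X : ℕ → Ω → Plane} {T : ℕ → Ω → Path}
    {G : ℕ → Ω → ℝ} {ω : Ω} {i₀ : ℕ} (hi₀ : ∀ j, j ≠ i₀ → beta M X T j ω < beta M X T i₀ ω)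
    (P s : ℝ) (q : Path) (S : Set ℝ) :
    ∑' i, (if T i ω = q then S.indicator (1 : ℝ → ℝ≥0∞) ‖X i ω‖ else 0) *
        expNeg (∑' j, if j = i then 0 else
          linkCost M P s (lossAt M q (X i ω)) (T j ω) (G j ω) (X j ω)) =
      ({q} ×ˢ S : Set (Path × ℝ)).indicator 1 (servingLink M X T ω) *
        expNeg (ENNReal.ofReal s * interference M X T G P ω) := by
  have hserv := serving_eq hi₀
  rw [tsum_eq_single i₀ fun i hi => ?_]
  · by_cases hT : T i₀ ω = q
    · have h1 : ({q} ×ˢ S : Set (Path × ℝ)).indicator (1 : Path × ℝ → ℝ≥0∞)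
          (servingLink M X T ω) = S.indicator 1 ‖X i₀ ω‖ := by
        rw [servingLink, hserv]
        by_cases hS : ‖X i₀ ω‖ ∈ S <;> simp [hT, hS]
      rw [h1, if_pos hT, interference, hserv, ← ENNReal.tsum_mul_left]
      congr 3
      funext j
      split_ifs with hj
      · rw [mul_zero]
      · have hle : lossAt M (T j ω) (X j ω) ≤ lossAt M q (X i₀ ω) := by
          rw [← hT]; exact (hi₀ j hj).le
        rw [linkCost, if_pos hle, zero_add]
        rfl
    · rw [if_neg hT, zero_mul, indicator_of_notMem, zero_mul]
      rw [servingLink, hserv]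
      simp [hT]
  · by_cases hT : T i ω = q
    · have htop : ∑' j, (if j = i then 0 else
          linkCost M P s (lossAt M q (X i ω)) (T j ω) (G j ω) (X j ω)) = ∞ := by
        refine ENNReal.tsum_eq_top_of_eq_top ⟨i₀, ?_⟩
        have hgt : ¬ lossAt M (T i₀ ω) (X i₀ ω) ≤ lossAt M q (X i ω) := by
          rw [← hT]; exact not_le.2 (hi₀ i hi)
        rw [if_neg (Ne.symm hi), linkCost, if_neg hgt, top_add]
      rw [htop, expNeg_top, mul_zero]
    · rw [if_neg hT, zero_mul]

/-! ### Law of the serving link and conditional Laplace transform. -/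

namespace IsNetwork

variable {Ω : Type*} [MeasurableSpace Ω] {M : PathLossModel} {lam : ℝ} {μ : Measure Ω}
  {X : ℕ → Ω → Plane} {T : ℕ → Ω → Path} {G : ℕ → Ω → ℝ}
  (h : IsNetwork M lam μ X T G)

section

include h

lemma measurable_servingLink : Measurable (servingLink M X T) :=
  CellNet.measurable_servingLink h.poisson.measurable h.measurable_T

lemma lintegral_servingDistLaw (q : Path) {f : ℝ → ℝ≥0∞} (hf : Measurable f) {S : Set ℝ}
    (hS : MeasurableSet S) :
    ∫⁻ r in S, f r ∂servingDistLaw M X T μ q =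
      ∫⁻ ω, ({q} ×ˢ S : Set (Path × ℝ)).indicator 1 (servingLink M X T ω) *
        f (servingLink M X T ω).2 ∂μ := by
  have hZ := h.measurable_servingLink
  have hq : MeasurableSet {ω | T (serving M X T ω) ω = q} :=
    (measurable_fst.comp hZ) (measurableSet_singleton q)
  have hR : Measurable fun ω => ‖X (serving M X T ω) ω‖ := measurable_snd.comp hZ
  rw [servingDistLaw, ← lintegral_indicator hS, lintegral_map (hf.indicator hS) hR,
    ← lintegral_indicator hq]
  refine lintegral_congr fun ω => ?_
  by_cases h1 : T (serving M X T ω) ω = q <;> by_cases h2 : ‖X (serving M X T ω) ω‖ ∈ S <;>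
    simp [servingLink, indicator, h1, h2]

lemma servingDistLaw_apply (q : Path) {S : Set ℝ} (hS : MeasurableSet S) :
    servingDistLaw M X T μ q S =
      ∫⁻ ω, ({q} ×ˢ S : Set (Path × ℝ)).indicator 1 (servingLink M X T ω) ∂μ := by
  rw [← setLIntegral_one, h.lintegral_servingDistLaw q measurable_const hS]
  simp

/-- The disintegration that defines the conditional distribution, restricted to one link type.
Varying `S` turns integral identities into identities for almost every `r`. -/
lemma lintegral_condDistrib_servingLink [IsFiniteMeasure μ] {Y : Ω → ℝ≥0∞} (hY : Measurable Y)
    {φ : (Path × ℝ) × ℝ≥0∞ → ℝ≥0∞} (hφ : Measurable φ) (q : Path) {S : Set ℝ}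
    (hS : MeasurableSet S) :
    ∫⁻ r in S, ∫⁻ y, φ ((q, r), y) ∂condDistrib Y (servingLink M X T) μ (q, r)
        ∂servingDistLaw M X T μ q =
      ∫⁻ ω, ({q} ×ˢ S : Set (Path × ℝ)).indicator 1 (servingLink M X T ω) *
        φ (servingLink M X T ω, Y ω) ∂μ := by
  have hZ := h.measurable_servingLink
  have hA : MeasurableSet ({q} ×ˢ S : Set (Path × ℝ)) := (measurableSet_singleton q).prod hS
  set H : Path × ℝ → ℝ≥0∞ := fun z => ∫⁻ y, φ (z, y) ∂condDistrib Y (servingLink M X T) μ z with hH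
  have hHm : Measurable H := hφ.lintegral_kernel_prod_right'
  have hψ : Measurable fun p : (Path × ℝ) × ℝ≥0∞ =>
      ({q} ×ˢ S : Set (Path × ℝ)).indicator (1 : Path × ℝ → ℝ≥0∞) p.1 * φ p :=
    ((measurable_one.indicator hA).comp measurable_fst).mul hφ
  have h1 := lintegral_map (μ := μ) hψ (hZ.prodMk hY)
  rw [← compProd_map_condDistrib hY.aemeasurable, Measure.lintegral_compProd hψ] at h1
  rw [← h1]
  have h2 : ∀ z, ∫⁻ y, ({q} ×ˢ S : Set (Path × ℝ)).indicator (1 : Path × ℝ → ℝ≥0∞) z * φ (z, y)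
      ∂condDistrib Y (servingLink M X T) μ z =
      ({q} ×ˢ S : Set (Path × ℝ)).indicator (1 : Path × ℝ → ℝ≥0∞) z * H z := fun z =>
    lintegral_const_mul _ (hφ.comp measurable_prodMk_left)
  simp_rw [h2]
  have hmH : Measurable fun z =>
      ({q} ×ˢ S : Set (Path × ℝ)).indicator (1 : Path × ℝ → ℝ≥0∞) z * H z :=
    (measurable_one.indicator hA).mul hHm
  rw [lintegral_map hmH hZ]
  refine (h.lintegral_servingDistLaw q (f := fun r => H (q, r))
    (hHm.comp measurable_prodMk_left) hS).trans (lintegral_congr fun ω => ?_)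
  by_cases hω : servingLink M X T ω ∈ ({q} ×ˢ S : Set (Path × ℝ))
  · have : (q, (servingLink M X T ω).2) = servingLink M X T ω := by
      have : (servingLink M X T ω).1 = q := hω.1
      rw [← this]
    rw [this]
  · rw [indicator_of_notMem hω, zero_mul, zero_mul]

end

variable (hM : M.Valid) [IsProbabilityMeasure μ] {P s : ℝ} (hP : 0 < P) (hs : 0 ≤ s)
include h hM hP hs

/-- The left side is expanded into a sum over candidate servers, each term is averaged over types
and gains, and Mecke's formula evaluates the sum. -/
lemma laplace_servingLink (q : Path) {S : Set ℝ} (hS : MeasurableSet S) :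
    ∫⁻ ω, ({q} ×ˢ S : Set (Path × ℝ)).indicator 1 (servingLink M X T ω) *
        expNeg (ENNReal.ofReal s * interference M X T G P ω) ∂μ =
      ∫⁻ x, probAt M q x * S.indicator 1 ‖x‖ *
        expNeg (∫⁻ y, (1 - linkFactor M P s (lossAt M q x) y) ∂intensity lam) ∂intensity lam := by
  have ha : Measurable fun x : Plane => S.indicator (1 : ℝ → ℝ≥0∞) ‖x‖ :=
    (measurable_one.indicator hS).comp measurable_norm
  have ha1 : ∀ x : Plane, S.indicator (1 : ℝ → ℝ≥0∞) ‖x‖ ≤ 1 := fun x =>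
    indicator_le_self' (fun _ _ => zero_le) _
  have hcost : ∀ i j, Measurable fun ω =>
      linkCost M P s (lossAt M q (X i ω)) (T j ω) (G j ω) (X j ω) := fun i j => by
    have h1 : Measurable fun p : Path × (ℝ × ℝ × Plane) =>
        linkCost M P s p.2.1 p.1 p.2.2.1 p.2.2.2 :=
      measurable_from_prod_countable_right fun t => measurable_linkCost t
    have h2 := h1.comp ((h.measurable_T j).prodMk (((measurable_lossAt (M := M) q).comp
      (h.poisson.measurable i)).prodMk ((h.measurable_G j).prodMk (h.poisson.measurable j))))
    exact h2
  have hterm : ∀ i, Measurable fun ω =>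
      (if T i ω = q then S.indicator (1 : ℝ → ℝ≥0∞) ‖X i ω‖ else 0) *
        expNeg (∑' j, if j = i then 0 else
          linkCost M P s (lossAt M q (X i ω)) (T j ω) (G j ω) (X j ω)) := fun i => by
    refine (Measurable.ite (h.measurable_T i (measurableSet_singleton q))
      (ha.comp (h.poisson.measurable i)) measurable_const).mul
      (measurable_expNeg.comp (Measurable.tsum fun j => ?_))
    by_cases hj : j = i
    · simpa only [if_pos hj] using measurable_const
    · simpa only [if_neg hj] using hcost i j
  have hterm2 : ∀ i, Measurable fun ω => (probAt M q (X i ω) * S.indicator 1 ‖X i ω‖) *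
      expNeg (sumOthers X (fun y => negLog (linkFactor M P s (lossAt M q (X i ω)) y)) i ω) :=
    fun i => by
      have h1 : Measurable (Function.uncurry fun x y =>
          negLog (linkFactor M P s (lossAt M q x) y)) :=
        measurable_linkFactor_comp hM ((measurable_lossAt q).comp measurable_fst) measurable_snd
      exact (((measurable_probAt hM q).mul ha).comp (h.poisson.measurable i)).mul
        (measurable_expNeg.comp (measurable_sumOthers_coupled h.poisson.measurable h1 i))
  have hpa : Measurable fun x : Plane => probAt M q x * S.indicator 1 ‖x‖ :=
    (measurable_probAt hM q).mul ha
  rw [← h.mecke_linkFactor hM hP hs q hpa,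
    lintegral_tsum fun i => (hterm2 i).aemeasurable]
  have hl : ∫⁻ ω, ({q} ×ˢ S : Set (Path × ℝ)).indicator 1 (servingLink M X T ω) *
        expNeg (ENNReal.ofReal s * interference M X T G P ω) ∂μ =
      ∫⁻ ω, ∑' i, (if T i ω = q then S.indicator (1 : ℝ → ℝ≥0∞) ‖X i ω‖ else 0) *
        expNeg (∑' j, if j = i then 0 else
          linkCost M P s (lossAt M q (X i ω)) (T j ω) (G j ω) (X j ω)) ∂μ := by
    refine lintegral_congr_ae ?_
    filter_upwards [h.ae_exists_strict_max hM] with ω ⟨i₀, hi₀⟩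
    exact (tsum_links_eq hi₀ P s q S).symm
  rw [hl, lintegral_tsum fun i => (hterm i).aemeasurable]
  exact tsum_congr fun i => h.lintegral_link_prod hM hP hs i q ha ha1

end IsNetwork

/-- The exponent of the probability that no base station has path loss above `c`. -/
def voidExponent (M : PathLossModel) (P lam c : ℝ) : ℝ≥0∞ :=
  ∫⁻ y, (1 - linkFactor M P 0 c y) ∂intensity lam

/-- The exponent of the Laplace transform of the interference at `s`, given that all path losses
are at most `c`. -/
def gapExponent (M : PathLossModel) (P lam s c : ℝ) : ℝ≥0∞ :=
  ∫⁻ y, linkGap M P s c y ∂intensity lam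

variable {M : PathLossModel} {P s lam : ℝ}

lemma measurable_voidExponent (hM : M.Valid) : Measurable (voidExponent M P lam) := by
  have h1 : Measurable fun p : ℝ × Plane => 1 - linkFactor M P 0 p.1 p.2 :=
    measurable_const.sub (measurable_linkFactor hM)
  exact h1.lintegral_prod_right'

lemma measurable_gapExponent (hM : M.Valid) : Measurable (gapExponent M P lam s) := by
  have h1 : Measurable fun p : ℝ × Plane => linkGap M P s p.1 p.2 := measurable_linkGap hM
  exact h1.lintegral_prod_right'

lemma lintegral_one_sub_linkFactor (hM : M.Valid) (hP : 0 < P) (hs : 0 ≤ s) (c : ℝ) :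
    ∫⁻ y, (1 - linkFactor M P s c y) ∂intensity lam =
      voidExponent M P lam c + gapExponent M P lam s c := by
  have h1 : Measurable fun p : ℝ × Plane => 1 - linkFactor M P 0 p.1 p.2 :=
    measurable_const.sub (measurable_linkFactor hM)
  have h2 := h1.comp (measurable_prodMk_left (x := c))
  replace h2 : Measurable fun y : Plane => 1 - linkFactor M P 0 c y := h2
  simp_rw [one_sub_linkFactor hM hP hs c]
  rw [lintegral_add_left h2]
  rfl

namespace IsNetwork

variable {Ω : Type*} [MeasurableSpace Ω] {μ : Measure Ω}
  {X : ℕ → Ω → Plane} {T : ℕ → Ω → Path} {G : ℕ → Ω → ℝ}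
  (h : IsNetwork M lam μ X T G) (hM : M.Valid) [IsProbabilityMeasure μ] (hP : 0 < P)
include h hM hP

lemma servingDistLaw_eq (q : Path) :
    servingDistLaw M X T μ q = ((intensity lam).withDensity fun x =>
      probAt M q x * expNeg (voidExponent M P lam (lossAt M q x))).map norm := by
  have hD : Measurable fun x => probAt M q x * expNeg (voidExponent M P lam (lossAt M q x)) :=
    (measurable_probAt hM q).mul (measurable_expNeg.comp
      ((measurable_voidExponent hM).comp (measurable_lossAt q)))
  ext S hS
  -- At `s = 0` the interference drops out and only the void probability remains.
  have h1 := h.laplace_servingLink hM hP le_rfl q hS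
  simp only [ENNReal.ofReal_zero, zero_mul, expNeg_zero, mul_one] at h1
  rw [h.servingDistLaw_apply q hS, h1, Measure.map_apply measurable_norm hS,
    withDensity_apply _ (measurable_norm hS), ← lintegral_indicator (measurable_norm hS)]
  refine lintegral_congr fun x => ?_
  by_cases hx : ‖x‖ ∈ S
  · simp [indicator, hx, voidExponent]
  · simp [indicator, hx]

/-- The joint transform has the density of the serving position times `exp` of minus the gap
exponent. That factor depends on the position through its norm only, so it is the conditional
transform. -/
lemma condLaplace_ae_eq (hs : 0 ≤ s) (q : Path) : ∀ᵐ r ∂servingDistLaw M X T μ q,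
    condLaplace M X T G μ P q r s = expNeg (gapExponent M P lam s (M.zeta q (M.dist3 r))) := by
  have hI : Measurable (interference M X T G P) :=
    measurable_interference h.poisson.measurable h.measurable_T h.measurable_G P
  have hφ : Measurable fun p : (Path × ℝ) × ℝ≥0∞ => expNeg (ENNReal.ofReal s * p.2) := by fun_prop
  have hl : Measurable fun r => condLaplace M X T G μ P q r s :=
    (hφ.lintegral_kernel_prod_right' (κ := condDistrib (interference M X T G P)
      (servingLink M X T) μ)).comp measurable_prodMk_left
  have hr : Measurable fun r => expNeg (gapExponent M P lam s (M.zeta q (M.dist3 r))) :=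
    measurable_expNeg.comp ((measurable_gapExponent hM).comp ((measurable_zeta q).comp
      PathLossModel.continuous_dist3.measurable))
  have hfin : IsFiniteMeasure (servingDistLaw M X T μ q) := by
    unfold servingDistLaw; infer_instance
  refine ae_eq_of_forall_setLIntegral_eq_of_sigmaFinite hl hr fun S hS _ => ?_
  unfold condLaplace
  rw [h.lintegral_condDistrib_servingLink hI hφ q hS]
  refine (h.laplace_servingLink hM hP hs q hS).trans ?_
  have hD : Measurable fun x => probAt M q x * expNeg (voidExponent M P lam (lossAt M q x)) :=
    (measurable_probAt hM q).mul (measurable_expNeg.comp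
      ((measurable_voidExponent hM).comp (measurable_lossAt q)))
  have hrn : Measurable fun x : Plane => S.indicator
      (fun r => expNeg (gapExponent M P lam s (M.zeta q (M.dist3 r)))) ‖x‖ :=
    (hr.indicator hS).comp measurable_norm
  rw [h.servingDistLaw_eq hM hP q, ← lintegral_indicator hS,
    lintegral_map (hr.indicator hS) measurable_norm,
    lintegral_withDensity_eq_lintegral_mul _ hD hrn]
  refine lintegral_congr fun x => ?_
  rw [lintegral_one_sub_linkFactor hM hP hs, expNeg_add, Pi.mul_apply]
  by_cases hx : ‖x‖ ∈ S
  · rw [indicator_of_mem hx, indicator_of_mem hx, Pi.one_apply, mul_one, mul_assoc]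
    rfl
  · rw [indicator_of_notMem hx, indicator_of_notMem hx, mul_zero, mul_zero, zero_mul]

end IsNetwork

/-! ### Coverage: integrating out the gain of the serving link. -/

section Coverage

lemma expMeasure_coverage {b γ PN : ℝ} (hb : 0 < b) (hγ : 0 < γ) (hPN : 0 ≤ PN) (I : ℝ≥0∞) :
    expMeasure 1 {g | ENNReal.ofReal γ < ENNReal.ofReal (b * g) / (I + ENNReal.ofReal PN)} =
      ENNReal.ofReal (Real.exp (-(γ * PN / b))) * expNeg (ENNReal.ofReal (γ / b) * I) := by
  have hγb : 0 < γ / b := div_pos hγ hb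
  -- Infinite interference makes the ratio `0`, and both sides vanish.
  rcases eq_or_ne I ∞ with rfl | hI
  · rw [ENNReal.mul_top (by simpa using hγb)]
    simp
  obtain ⟨d, hd, rfl⟩ : ∃ d : ℝ, 0 ≤ d ∧ I = ENNReal.ofReal d :=
    ⟨I.toReal, ENNReal.toReal_nonneg, (ENNReal.ofReal_toReal hI).symm⟩
  have hset : {g | ENNReal.ofReal γ < ENNReal.ofReal (b * g) /
      (ENNReal.ofReal d + ENNReal.ofReal PN)} = Ioi (γ / b * (d + PN)) := by
    ext g
    rw [← ENNReal.ofReal_add hd hPN, mem_ofPred_eq, mem_Ioi]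
    -- With neither interference nor noise the ratio is `∞` for `g > 0` and `0 / 0 = 0` for `g ≤ 0`,
    -- in accordance with the threshold `0`.
    rcases (add_nonneg hd hPN).eq_or_lt with h0 | h0
    · rw [← h0, ENNReal.ofReal_zero, mul_zero]
      rcases le_or_gt g 0 with hg | hg
      · rw [ENNReal.ofReal_of_nonpos (mul_nonpos_of_nonneg_of_nonpos hb.le hg), ENNReal.zero_div]
        simp [hg]
      · rw [ENNReal.div_zero (by simpa using mul_pos hb hg)]
        simp [hg]
    · rw [ENNReal.lt_div_iff_mul_lt (Or.inl (by simpa using h0)) (Or.inl ENNReal.ofReal_ne_top),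
        ← ENNReal.ofReal_mul hγ.le, ENNReal.ofReal_lt_ofReal_iff_of_nonneg (by positivity),
        div_mul_eq_mul_div, div_lt_iff₀ hb, mul_comm g b]
  rw [hset, expMeasure_Ioi (by positivity), ← ENNReal.ofReal_mul hγb.le,
    expNeg_ofReal (by positivity), ← ENNReal.ofReal_mul (by positivity), ← Real.exp_add]
  congr 2
  ring

namespace IsNetwork

variable {Ω : Type*} [MeasurableSpace Ω] {μ : Measure Ω}
  {X : ℕ → Ω → Plane} {T : ℕ → Ω → Path} {G : ℕ → Ω → ℝ}
  (h : IsNetwork M lam μ X T G) (hM : M.Valid) [IsProbabilityMeasure μ] (hP : 0 < P)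
  {γ PN : ℝ} (hγ : 0 < γ) (hPN : 0 ≤ PN)

include h hM hP hγ hPN

/-- Once the serving index is fixed to be `i`, the serving link depends on positions and types only
and the interference does not involve the `i`-th gain, so that gain can be averaged first. -/
lemma lintegral_coverage_serving_eq (i : ℕ) {A : Set (Path × ℝ)} (hA : MeasurableSet A) :
    ∫⁻ ω, (if serving M X T ω = i then A.indicator 1 (servingLink M X T ω) *
        (Ioi (ENNReal.ofReal γ)).indicator 1 (sinr M X T G P PN ω) else 0) ∂μ =
      ∫⁻ ω, (if serving M X T ω = i then A.indicator 1 (servingLink M X T ω) *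
        (ENNReal.ofReal (Real.exp (-(γ * PN / (P * beta M X T (serving M X T ω) ω)))) *
        expNeg (ENNReal.ofReal (γ / (P * beta M X T (serving M X T ω) ω)) *
          interference M X T G P ω)) else 0) ∂μ := by
  -- Positions and types as coordinates on their sequence space, so that serving index and path
  -- losses become functions of them.
  let X' : ℕ → ((ℕ → Plane) × (ℕ → Path)) → Plane := fun j z => z.1 j
  let T' : ℕ → ((ℕ → Plane) × (ℕ → Path)) → Path := fun j z => z.2 j
  have hX' : ∀ j, Measurable (X' j) := fun j => (measurable_pi_apply j).comp measurable_fst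
  have hT' : ∀ j, Measurable (T' j) := fun j => (measurable_pi_apply j).comp measurable_snd
  let J : (ℕ → ℝ) → ((ℕ → Plane) × (ℕ → Path)) → ℝ≥0∞ := fun γ z =>
    ∑' j, if j = i then 0 else ENNReal.ofReal (P * beta M X' T' j z * γ j)
  let F : ℝ × (ℕ → ℝ) × ((ℕ → Plane) × (ℕ → Path)) → ℝ≥0∞ := fun p =>
    if serving M X' T' p.2.2 = i then A.indicator 1 (servingLink M X' T' p.2.2) *
      (Ioi (ENNReal.ofReal γ)).indicator 1 (ENNReal.ofReal (P * beta M X' T' i p.2.2 * p.1) /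
        (J p.2.1 p.2.2 + ENNReal.ofReal PN)) else 0
  have hb : ∀ j, Measurable (beta M X' T' j) := measurable_beta hX' hT'
  have hJ : Measurable fun p : (ℕ → ℝ) × ((ℕ → Plane) × (ℕ → Path)) => J p.1 p.2 := by
    refine Measurable.tsum fun j => ?_
    by_cases hj : j = i
    · simpa only [if_pos hj] using measurable_const
    · simp only [if_neg hj]
      exact ((measurable_const.mul ((hb j).comp measurable_snd)).mul
        ((measurable_pi_apply j).comp measurable_fst)).ennreal_ofReal
  have hF : Measurable F := by
    have hz : Measurable fun p : ℝ × (ℕ → ℝ) × ((ℕ → Plane) × (ℕ → Path)) => p.2.2 := by fun_prop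
    refine Measurable.ite (((measurable_serving hX' hT').comp hz) (measurableSet_singleton i)) ?_
      measurable_const
    refine ((measurable_one.indicator hA).comp ((CellNet.measurable_servingLink hX' hT').comp hz)).mul
      ((measurable_one.indicator measurableSet_Ioi).comp (Measurable.div ?_
        ((hJ.comp measurable_snd).add measurable_const)))
    exact ((measurable_const.mul ((hb i).comp hz)).mul measurable_fst).ennreal_ofReal
  have hJω : ∀ ω, serving M X T ω = i → J (Function.update (fun j => G j ω) i 0)
      ((fun j => X j ω), fun j => T j ω) = interference M X T G P ω := fun ω hω => by
    rw [interference, hω]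
    refine tsum_congr fun j => ?_
    split_ifs with hj
    · rfl
    · rw [Function.update_of_ne hj]
      rfl
  have hL : ∀ ω, (if serving M X T ω = i then A.indicator (1 : Path × ℝ → ℝ≥0∞) (servingLink M X T ω) *
        (Ioi (ENNReal.ofReal γ)).indicator 1 (sinr M X T G P PN ω) else 0) =
      F (G i ω, Function.update (fun j => G j ω) i 0, ((fun j => X j ω), fun j => T j ω)) :=
    fun ω => by
      change _ = ite (serving M X T ω = i) _ _
      by_cases hω : serving M X T ω = i
      · rw [if_pos hω, if_pos hω]
        dsimp only
        rw [hJω ω hω, sinr, hω]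
        rfl
      · rw [if_neg hω, if_neg hω]
  simp_rw [hL]
  rw [h.lintegral_single_gain i hF]
  refine lintegral_congr_ae ?_
  filter_upwards [h.ae_ne_zero] with ω h0
  by_cases hω : serving M X T ω = i
  · have hpos : 0 < P * beta M X T i ω := mul_pos hP (lossAt_pos hM _ (h0 i))
    rw [if_pos hω]
    have hF' : ∀ g, F (g, Function.update (fun j => G j ω) i 0,
        ((fun j => X j ω), fun j => T j ω)) = A.indicator 1 (servingLink M X T ω) *
        {g | ENNReal.ofReal γ < ENNReal.ofReal (P * beta M X T i ω * g) /
          (interference M X T G P ω + ENNReal.ofReal PN)}.indicator 1 g := fun g => by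
      change ite (serving M X T ω = i) _ _ = _
      rw [if_pos hω]
      dsimp only
      rw [hJω ω hω]
      rfl
    have hms : MeasurableSet {g | ENNReal.ofReal γ < ENNReal.ofReal (P * beta M X T i ω * g) /
          (interference M X T G P ω + ENNReal.ofReal PN)} :=
      measurableSet_lt measurable_const (by fun_prop)
    simp_rw [hF']
    rw [lintegral_const_mul _ (measurable_one.indicator hms), lintegral_indicator_one hms,
      expMeasure_coverage hpos hγ hPN, hω]
  · rw [if_neg hω]
    have hF' : ∀ g, F (g, Function.update (fun j => G j ω) i 0,
        ((fun j => X j ω), fun j => T j ω)) = 0 := fun g => if_neg hω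
    simp_rw [hF']
    simp

end IsNetwork

end Coverage

namespace IsNetwork

variable {M : PathLossModel} {P lam : ℝ} {Ω : Type*} [MeasurableSpace Ω] {μ : Measure Ω}
  {X : ℕ → Ω → Plane} {T : ℕ → Ω → Path} {G : ℕ → Ω → ℝ}
  (h : IsNetwork M lam μ X T G) (hM : M.Valid) [IsProbabilityMeasure μ] (hP : 0 < P)
  {γ PN : ℝ} (hγ : 0 < γ) (hPN : 0 ≤ PN)

include h hM hP hγ hPN

lemma lintegral_coverage {A : Set (Path × ℝ)} (hA : MeasurableSet A) :
    ∫⁻ ω, A.indicator 1 (servingLink M X T ω) *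
        (Ioi (ENNReal.ofReal γ)).indicator 1 (sinr M X T G P PN ω) ∂μ =
      ∫⁻ ω, A.indicator 1 (servingLink M X T ω) *
        (ENNReal.ofReal (Real.exp (-(γ * PN / (P * beta M X T (serving M X T ω) ω)))) *
        expNeg (ENNReal.ofReal (γ / (P * beta M X T (serving M X T ω) ω)) *
          interference M X T G P ω)) ∂μ := by
  have hX := h.poisson.measurable
  have hT := h.measurable_T
  have hZ := h.measurable_servingLink
  have hI := measurable_interference (M := M) hX hT h.measurable_G P
  have hb : Measurable fun ω => beta M X T (serving M X T ω) ω := by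
    have h1 : Measurable fun p : ℕ × Ω => beta M X T p.1 p.2 :=
      measurable_from_prod_countable_right fun i => measurable_beta hX hT i
    have h2 := h1.comp ((measurable_serving (M := M) hX hT).prodMk measurable_id)
    exact h2
  have hA1 : Measurable (A.indicator (1 : Path × ℝ → ℝ≥0∞)) := measurable_one.indicator hA
  have hi := hA1.comp hZ
  replace hi : Measurable fun ω => A.indicator (1 : Path × ℝ → ℝ≥0∞) (servingLink M X T ω) := hi
  have hγ1 : Measurable ((Ioi (ENNReal.ofReal γ)).indicator (1 : ℝ≥0∞ → ℝ≥0∞)) :=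
    measurable_one.indicator measurableSet_Ioi
  have hc := hγ1.comp (measurable_sinr (M := M) hX hT h.measurable_G P PN)
  have hL : Measurable fun ω => A.indicator (1 : Path × ℝ → ℝ≥0∞) (servingLink M X T ω) *
      (Ioi (ENNReal.ofReal γ)).indicator 1 (sinr M X T G P PN ω) :=
    hi.mul hc
  have hR : Measurable fun ω => A.indicator (1 : Path × ℝ → ℝ≥0∞) (servingLink M X T ω) *
        (ENNReal.ofReal (Real.exp (-(γ * PN / (P * beta M X T (serving M X T ω) ω)))) *
        expNeg (ENNReal.ofReal (γ / (P * beta M X T (serving M X T ω) ω)) *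
          interference M X T G P ω)) := by
    refine hi.mul (Measurable.mul ?_ (measurable_expNeg.comp (Measurable.mul ?_ hI)))
    · fun_prop
    · fun_prop
  -- The serving index is random; the space is partitioned by its value.
  have hsum : ∀ f : Ω → ℝ≥0∞, Measurable f →
      ∫⁻ ω, f ω ∂μ = ∑' i, ∫⁻ ω, (if serving M X T ω = i then f ω else 0) ∂μ := fun f hf => by
    have hfi : ∀ i, Measurable fun ω => if serving M X T ω = i then f ω else 0 := fun i =>
      Measurable.ite (measurable_serving hX hT (measurableSet_singleton i)) hf measurable_const
    rw [← lintegral_tsum fun i => (hfi i).aemeasurable]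
    exact lintegral_congr fun ω => (tsum_ite_eq' (serving M X T ω) fun _ => f ω).symm
  rw [hsum _ hL, hsum _ hR]
  exact tsum_congr fun i => h.lintegral_coverage_serving_eq hM hP hγ hPN i hA

/-- The argument of the Laplace transform varies with `r`. The test functions therefore depend on
the link as well, and the comparison is made in integrated form, without an explicit formula for the
transform. -/
lemma condCoverage_ae_eq (q : Path) : ∀ᵐ r ∂servingDistLaw M X T μ q,
    condCoverage M X T G μ P PN γ q r =
      ENNReal.ofReal (Real.exp (-(γ * PN / (P * M.zeta q (M.dist3 r))))) *
        condLaplace M X T G μ P q r (γ / (P * M.zeta q (M.dist3 r))) := by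
  have hX := h.poisson.measurable
  have hT := h.measurable_T
  have hI := measurable_interference (M := M) hX hT h.measurable_G P
  have hS := measurable_sinr (M := M) hX hT h.measurable_G P PN
  have hz : Measurable fun z : Path × ℝ => M.zeta z.1 (M.dist3 z.2) :=
    measurable_from_prod_countable_right fun q =>
      (measurable_zeta q).comp PathLossModel.continuous_dist3.measurable
  let φ : (Path × ℝ) × ℝ≥0∞ → ℝ≥0∞ := fun p => (Ioi (ENNReal.ofReal γ)).indicator 1 p.2
  have hφ : Measurable φ := (measurable_one.indicator measurableSet_Ioi).comp measurable_snd
  let ψ : (Path × ℝ) × ℝ≥0∞ → ℝ≥0∞ := fun p =>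
    ENNReal.ofReal (Real.exp (-(γ * PN / (P * M.zeta p.1.1 (M.dist3 p.1.2))))) *
      expNeg (ENNReal.ofReal (γ / (P * M.zeta p.1.1 (M.dist3 p.1.2))) * p.2)
  have hψ : Measurable ψ := by
    have hz' := hz.comp (measurable_fst : Measurable (Prod.fst : (Path × ℝ) × ℝ≥0∞ → Path × ℝ))
    replace hz' : Measurable fun p : (Path × ℝ) × ℝ≥0∞ => M.zeta p.1.1 (M.dist3 p.1.2) := hz'
    refine Measurable.mul ?_ (measurable_expNeg.comp (Measurable.mul ?_ measurable_snd))
    · fun_prop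
    · fun_prop
  have hcov : ∀ r, condCoverage M X T G μ P PN γ q r =
      ∫⁻ y, φ ((q, r), y) ∂condDistrib (sinr M X T G P PN) (servingLink M X T) μ (q, r) :=
    fun r => (lintegral_indicator_one measurableSet_Ioi).symm
  have hlap : ∀ r, ENNReal.ofReal (Real.exp (-(γ * PN / (P * M.zeta q (M.dist3 r))))) *
        condLaplace M X T G μ P q r (γ / (P * M.zeta q (M.dist3 r))) =
      ∫⁻ y, ψ ((q, r), y) ∂condDistrib (interference M X T G P) (servingLink M X T) μ (q, r) :=
    fun r => (lintegral_const_mul' _ _ ENNReal.ofReal_ne_top).symm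
  simp_rw [hcov, hlap]
  have hfin : IsFiniteMeasure (servingDistLaw M X T μ q) := by
    unfold servingDistLaw; infer_instance
  refine ae_eq_of_forall_setLIntegral_eq_of_sigmaFinite
    ((hφ.lintegral_kernel_prod_right' (κ := condDistrib (sinr M X T G P PN)
      (servingLink M X T) μ)).comp measurable_prodMk_left)
    ((hψ.lintegral_kernel_prod_right' (κ := condDistrib (interference M X T G P)
      (servingLink M X T) μ)).comp measurable_prodMk_left) fun S hS' _ => ?_
  refine (h.lintegral_condDistrib_servingLink hS hφ q hS').trans
    (Eq.trans ?_ (h.lintegral_condDistrib_servingLink hI hψ q hS').symm)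
  exact h.lintegral_coverage hM hP hγ hPN ((measurableSet_singleton q).prod hS')

end IsNetwork

/-! ### Polar coordinates and the radial form of the exponent. -/

lemma lintegral_fun_norm_addHaar {E : Type*} [NormedAddCommGroup E] [NormedSpace ℝ E]
    [Nontrivial E] [FiniteDimensional ℝ E] [MeasurableSpace E] [BorelSpace E] (μ : Measure E)
    [μ.IsAddHaarMeasure] {f : ℝ → ℝ≥0∞} (hf : Measurable f) :
    ∫⁻ x, f ‖x‖ ∂μ = Module.finrank ℝ E * μ (Metric.ball 0 1) *
      ∫⁻ u in Ioi (0 : ℝ), ENNReal.ofReal (u ^ (Module.finrank ℝ E - 1)) * f u := by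
  have hf' : Measurable fun u : Ioi (0 : ℝ) => f u := hf.comp measurable_subtype_coe
  calc
    ∫⁻ x, f ‖x‖ ∂μ = ∫⁻ x : ({(0)}ᶜ : Set E), f ‖x.1‖ ∂(μ.comap (↑)) := by
      -- The origin is null, and its complement is the product of the unit sphere and `(0, ∞)`.
      rw [lintegral_subtype_comap (measurableSet_singleton _).compl fun x ↦ f ‖x‖,
        restrict_compl_singleton]
    _ = ∫⁻ x, f x.2 ∂μ.toSphere.prod (.volumeIoiPow (Module.finrank ℝ E - 1)) := by
      simpa using μ.measurePreserving_homeomorphUnitSphereProd.lintegral_comp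
        (hf'.comp measurable_snd)
    _ = μ.toSphere univ *
        ∫⁻ u : Ioi (0 : ℝ), f u ∂.volumeIoiPow (Module.finrank ℝ E - 1) := by
      have := lintegral_prod_mul (μ := μ.toSphere)
        (ν := .volumeIoiPow (Module.finrank ℝ E - 1)) (f := fun _ => 1)
        (g := fun u : Ioi (0 : ℝ) => f u) aemeasurable_const hf'.aemeasurable
      simpa using this
    _ = _ := by
      have hp : Measurable fun u : Ioi (0 : ℝ) =>
          ENNReal.ofReal (u.1 ^ (Module.finrank ℝ E - 1)) := by fun_prop
      rw [μ.toSphere_apply_univ, Measure.volumeIoiPow,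
        lintegral_withDensity_eq_lintegral_mul _ hp hf',
        ← lintegral_subtype_comap measurableSet_Ioi]
      rfl

lemma lintegral_intensity_norm (lam : ℝ) {f : ℝ → ℝ≥0∞} (hf : Measurable f) :
    ∫⁻ x, f ‖x‖ ∂intensity lam =
      ENNReal.ofReal (2 * Real.pi * lam) * ∫⁻ u in Ioi (0 : ℝ), ENNReal.ofReal u * f u := by
  rw [intensity, lintegral_smul_measure, lintegral_fun_norm_addHaar _ hf,
    EuclideanSpace.volume_ball_fin_two]
  simp only [finrank_euclideanSpace, Fintype.card_fin, ENNReal.ofReal_one, one_pow, one_mul,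
    Nat.add_one_sub_one, pow_one, smul_eq_mul]
  rw [← mul_assoc]
  congr 1
  rw [ENNReal.ofReal_mul (by positivity), ENNReal.ofReal_mul (by positivity), mul_comm]
  simp

/-- The threshold `c` for the path loss becomes the radius `a`, and `x / (1 + x) = 1 / (1 + x⁻¹)` at
`x = s P ζ`. -/
lemma lintegral_link_gap {M : PathLossModel} (hM : M.Valid) {P s lam c a : ℝ} (hP : 0 < P)
    (hs : 0 < s) (t : Path) (ha : 0 ≤ a)
    (hac : ∀ u, 0 < u → (M.zeta t (M.dist3 u) ≤ c ↔ a ≤ u)) :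
    ∫⁻ y, probAt M t y * (if lossAt M t y ≤ c then
        ENNReal.ofReal (s * (P * lossAt M t y) / (1 + s * (P * lossAt M t y))) else 0)
        ∂intensity lam =
      ENNReal.ofReal (2 * Real.pi * lam) * M.interfIntegral P s t a := by
  have hd : Measurable M.dist3 := PathLossModel.continuous_dist3.measurable
  have hz : Measurable fun u => M.zeta t (M.dist3 u) := (measurable_zeta t).comp hd
  have hp : Measurable fun u => M.prPath t (M.dist3 u) := (hM.measurable_prPath t).comp hd
  have hf : Measurable fun u => ENNReal.ofReal (M.prPath t (M.dist3 u)) *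
      (if M.zeta t (M.dist3 u) ≤ c then ENNReal.ofReal (s * (P * M.zeta t (M.dist3 u)) /
        (1 + s * (P * M.zeta t (M.dist3 u)))) else 0) :=
    hp.ennreal_ofReal.mul (Measurable.ite (measurableSet_le hz measurable_const)
      (by fun_prop) measurable_const)
  refine (lintegral_intensity_norm lam hf).trans ?_
  congr 1
  rw [PathLossModel.interfIntegral, ← lintegral_indicator measurableSet_Ioi,
    ← lintegral_indicator measurableSet_Ioi]
  -- The threshold gives `a ≤ u` while the integral runs over `a < u`; the endpoint is null.
  have hne : ∀ᵐ u : ℝ, u ≠ a := by simp [ae_iff]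
  refine lintegral_congr_ae ?_
  filter_upwards [hne] with u hu
  rcases lt_or_gt_of_ne hu with hlt | hgt
  · rw [indicator_of_notMem (s := Ioi a) (not_lt.2 hlt.le)]
    rcases le_or_gt u 0 with hu0 | hu0
    · rw [indicator_of_notMem (s := Ioi 0) (not_lt.2 hu0)]
    · rw [indicator_of_mem (mem_Ioi.2 hu0), if_neg fun hle => not_le.2 hlt ((hac u hu0).1 hle),
        mul_zero, mul_zero]
  · have hu0 : 0 < u := ha.trans_lt hgt
    have hζ : 0 < M.zeta t (M.dist3 u) := hM.zeta_pos t (PathLossModel.dist3_mem hu0.ne')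
    have hpr : 0 ≤ M.prPath t (M.dist3 u) := hM.prPath_nonneg t (PathLossModel.L_le_dist3 _)
    rw [indicator_of_mem (mem_Ioi.2 hu0), indicator_of_mem (mem_Ioi.2 hgt),
      if_pos ((hac u hu0).2 hgt.le), ← ENNReal.ofReal_mul hpr, ← ENNReal.ofReal_mul hu0.le]
    congr 1
    field_simp
    ring

lemma gapExponent_eq {M : PathLossModel} (hM : M.Valid) {P s lam c : ℝ} (hP : 0 < P)
    (hs : 0 < s) {a : Path → ℝ} (ha : ∀ t, 0 ≤ a t)
    (hac : ∀ t u, 0 < u → (M.zeta t (M.dist3 u) ≤ c ↔ a t ≤ u)) :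
    gapExponent M P lam s c =
      ENNReal.ofReal (2 * Real.pi * lam) * M.interfIntegral P s .LoS (a .LoS) +
      ENNReal.ofReal (2 * Real.pi * lam) * M.interfIntegral P s .NLoS (a .NLoS) := by
  unfold gapExponent linkGap
  rw [lintegral_finsetSum, sum_path, lintegral_link_gap hM hP hs _ (ha _) (hac _),
    lintegral_link_gap hM hP hs _ (ha _) (hac _)]
  intro t _
  exact (measurable_probAt hM t).mul (Measurable.ite (measurableSet_le (measurable_lossAt t)
    measurable_const) (by have := measurable_lossAt (M := M) t; fun_prop) measurable_const)

/-- Positivity of `s` matters: at `x = ∞` the integrand jumps from `0` to `1` as the parameter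
reaches `0`. -/
lemma tendsto_lintegral_expNeg_mul (ν : Measure ℝ≥0∞) [IsFiniteMeasure ν] {u : ℕ → ℝ} {s : ℝ}
    (hs : 0 < s) (hu : Tendsto u atTop (𝓝 s)) :
    Tendsto (fun k => ∫⁻ x, expNeg (ENNReal.ofReal (u k) * x) ∂ν) atTop
      (𝓝 (∫⁻ x, expNeg (ENNReal.ofReal s * x) ∂ν)) := by
  refine tendsto_lintegral_of_dominated_convergence (fun _ => 1) (fun k => by fun_prop)
    (fun k => ae_of_all _ fun x => expNeg_le_one _) (by simp) (ae_of_all _ fun x => ?_)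
  exact (continuous_expNeg.tendsto _).comp (ENNReal.Tendsto.mul_const
    (ENNReal.tendsto_ofReal hu) (Or.inl (by simpa using hs)))

/-- The exponent may be infinite, so the limit is taken along increasing parameters, by monotone
convergence. -/
lemma tendsto_gapExponent {M : PathLossModel} (hM : M.Valid) {P lam c s : ℝ} (hP : 0 < P)
    {u : ℕ → ℝ} (hu0 : ∀ k, 0 ≤ u k) (hmono : Monotone u) (hu : Tendsto u atTop (𝓝 s)) :
    Tendsto (fun k => gapExponent M P lam (u k) c) atTop (𝓝 (gapExponent M P lam s c)) := by
  have hs : 0 ≤ s := ge_of_tendsto' hu hu0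
  refine lintegral_tendsto_of_tendsto_of_monotone (fun k => ?_) (ae_of_all _ fun y => ?_)
    (ae_of_all _ fun y => ?_)
  · have h1 : Measurable fun p : ℝ × Plane => linkGap M P (u k) p.1 p.2 := measurable_linkGap hM
    have h2 := h1.comp (measurable_prodMk_left (x := c))
    exact h2.aemeasurable
  · intro k l hkl
    refine Finset.sum_le_sum fun t _ => ?_
    have hb : 0 ≤ P * lossAt M t y := mul_nonneg hP.le (lossAt_nonneg hM t y)
    gcongr
    split_ifs
    · refine ENNReal.ofReal_le_ofReal ?_
      rw [div_le_div_iff₀ (by nlinarith [mul_nonneg (hu0 k) hb])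
        (by nlinarith [mul_nonneg (hu0 l) hb])]
      nlinarith [mul_le_mul_of_nonneg_right (hmono hkl) hb]
    · exact le_rfl
  · refine tendsto_finsetSum _ fun t _ => ENNReal.Tendsto.const_mul ?_
      (Or.inr ENNReal.ofReal_ne_top)
    split_ifs
    · have hb : 0 ≤ P * lossAt M t y := mul_nonneg hP.le (lossAt_nonneg hM t y)
      refine ENNReal.tendsto_ofReal (Tendsto.div (hu.mul_const _)
        ((hu.mul_const _).const_add 1) ?_)
      nlinarith [mul_nonneg hs hb]
    · exact tendsto_const_nhds

/-! ### The conditional Laplace transform for all `s` at once. -/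

namespace IsNetwork

variable {M : PathLossModel} {P lam : ℝ} {Ω : Type*} [MeasurableSpace Ω] {μ : Measure Ω}
  {X : ℕ → Ω → Plane} {T : ℕ → Ω → Path} {G : ℕ → Ω → ℝ}
  (h : IsNetwork M lam μ X T G)

include h in
lemma ae_servingDistLaw_pos (q : Path) : ∀ᵐ r ∂servingDistLaw M X T μ q, 0 < r := by
  have hR := measurable_snd.comp h.measurable_servingLink
  refine (ae_map_iff hR.aemeasurable measurableSet_Ioi).2 ?_
  refine ae_restrict_of_ae ?_
  filter_upwards [h.ae_ne_zero] with ω hω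
  exact norm_pos_iff.2 (hω _)

variable (hM : M.Valid) [IsProbabilityMeasure μ] (hP : 0 < P)

include h hM hP

/-- The exceptional set of `r` depends on `s`. It is made common for the rational `s`, and the other
values follow by approximation from below. -/
lemma ae_forall_condLaplace_eq (q : Path) : ∀ᵐ r ∂servingDistLaw M X T μ q, ∀ s, 0 < s →
    condLaplace M X T G μ P q r s = expNeg (gapExponent M P lam s (M.zeta q (M.dist3 r))) := by
  have hrat : ∀ᵐ r ∂servingDistLaw M X T μ q, ∀ s : ℚ, 0 ≤ s → condLaplace M X T G μ P q r s =
      expNeg (gapExponent M P lam s (M.zeta q (M.dist3 r))) :=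
    ae_all_iff.2 fun s => by
      by_cases hs : 0 ≤ s
      · filter_upwards [h.condLaplace_ae_eq hM hP (Rat.cast_nonneg.2 hs) q] with r hr _
        exact hr
      · exact ae_of_all _ fun r hs' => absurd hs' hs
  filter_upwards [hrat] with r hr s hs
  obtain ⟨u, hu, -, hlim⟩ := Real.exists_seq_rat_strictMono_tendsto s
  -- The maximum with `0` keeps the approximants nonnegative without destroying monotonicity.
  have hlim' : Tendsto (fun k => ((max (u k) 0 : ℚ) : ℝ)) atTop (𝓝 s) := by
    have := hlim.max (tendsto_const_nhds (x := (0 : ℝ)))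
    simpa [max_eq_left hs.le] using this
  refine tendsto_nhds_unique (tendsto_lintegral_expNeg_mul _ hs hlim') ?_
  refine ((continuous_expNeg.tendsto _).comp (tendsto_gapExponent hM hP (fun k => ?_)
    (fun k l hkl => ?_) hlim')).congr fun k => (hr _ (le_max_right _ _)).symm
  · exact_mod_cast le_max_right _ _
  · exact_mod_cast max_le_max (hu.monotone hkl) le_rfl

/-- The Laplace transform of the interference in terms of the radii `a t` beyond which a link
of type `t` has path loss below that of the serving link. -/
lemma ae_condLaplace_eq_interfIntegral (q : Path) :
    ∀ᵐ r ∂servingDistLaw M X T μ q, ∀ s, 0 < s →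
      ∀ a : Path → ℝ, (∀ t, a t = if t = q then r else M.crossDist t (M.zeta q (M.dist3 r))) →
      condLaplace M X T G μ P q r s =
        expNeg (ENNReal.ofReal (2 * Real.pi * lam) * M.interfIntegral P s .LoS (a .LoS)) *
        expNeg (ENNReal.ofReal (2 * Real.pi * lam) * M.interfIntegral P s .NLoS (a .NLoS)) := by
  filter_upwards [h.ae_forall_condLaplace_eq hM hP q, h.ae_servingDistLaw_pos q]
    with r hr hr0 s hs a ha
  rw [hr s hs, gapExponent_eq hM hP hs (a := a), expNeg_add]
  · intro t
    rw [ha]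
    split_ifs
    · exact hr0.le
    · exact Real.sSup_nonneg fun u hu => hu.1
  · intro t u hu
    rw [ha]
    split_ifs with htq
    · rw [htq]
      exact hM.zeta_dist3_le_iff q hu hr0
    · exact hM.zeta_dist3_le_iff_crossDist_le t
        (hM.zeta_pos q (PathLossModel.dist3_mem hr0.ne')) hu

end IsNetwork

end CellNet

end

theorem lemma1 {Ω : Type*} [MeasurableSpace Ω] (μ : Measure Ω) [IsProbabilityMeasure μ]
    (M : CellNet.PathLossModel) (hM : M.Valid)
    (lam P PN γ : ℝ) (hlam : 0 < lam) (hP : 0 < P) (hPN : 0 ≤ PN) (hγ : 0 < γ)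
    (X : ℕ → Ω → CellNet.Plane) (T : ℕ → Ω → CellNet.Path) (G : ℕ → Ω → ℝ)
    (hnet : CellNet.IsNetwork M lam μ X T G) (n : ℕ) (hn : n ∈ Finset.Icc 1 M.N) :
    -- the serving link is LoS
    (∀ᵐ r ∂(CellNet.servingDistLaw M X T μ .LoS), M.dist3 r ∈ M.piece n →
      CellNet.condCoverage M X T G μ P PN γ .LoS r =
          ENNReal.ofReal (Real.exp (-(γ * PN / (P * M.zetaPiece .LoS n (M.dist3 r))))) *
            CellNet.condLaplace M X T G μ P .LoS r (γ / (P * M.zetaPiece .LoS n (M.dist3 r))) ∧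
      ∀ s : ℝ, 0 < s →
        CellNet.condLaplace M X T G μ P .LoS r s =
          CellNet.expNeg (ENNReal.ofReal (2 * Real.pi * lam) *
              M.interfIntegral P s .LoS r) *
            CellNet.expNeg (ENNReal.ofReal (2 * Real.pi * lam) *
              M.interfIntegral P s .NLoS
                (M.crossDist .NLoS (M.zetaPiece .LoS n (M.dist3 r))))) ∧
    -- the serving link is NLoS
    (∀ᵐ r ∂(CellNet.servingDistLaw M X T μ .NLoS), M.dist3 r ∈ M.piece n →
      CellNet.condCoverage M X T G μ P PN γ .NLoS r =
          ENNReal.ofReal (Real.exp (-(γ * PN / (P * M.zetaPiece .NLoS n (M.dist3 r))))) *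
            CellNet.condLaplace M X T G μ P .NLoS r (γ / (P * M.zetaPiece .NLoS n (M.dist3 r))) ∧
      ∀ s : ℝ, 0 < s →
        CellNet.condLaplace M X T G μ P .NLoS r s =
          CellNet.expNeg (ENNReal.ofReal (2 * Real.pi * lam) *
              M.interfIntegral P s .LoS
                (M.crossDist .LoS (M.zetaPiece .NLoS n (M.dist3 r)))) *
            CellNet.expNeg (ENNReal.ofReal (2 * Real.pi * lam) *
              M.interfIntegral P s .NLoS r)) := by
  refine ⟨?_, ?_⟩
  · filter_upwards [hnet.condCoverage_ae_eq hM hP hγ hPN .LoS,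
      hnet.ae_condLaplace_eq_interfIntegral hM hP .LoS] with r hcov hlap hr
    rw [← hM.zeta_eq hn hr .LoS]
    -- The exclusion radius is `r` itself for the type of the serving link and the crossing distance
    -- for the other type.
    exact ⟨hcov, fun s hs => hlap s hs (fun | .LoS => r | .NLoS => M.crossDist .NLoS _)
      (by rintro (_ | _) <;> simp)⟩
  · filter_upwards [hnet.condCoverage_ae_eq hM hP hγ hPN .NLoS,
      hnet.ae_condLaplace_eq_interfIntegral hM hP .NLoS] with r hcov hlap hr
    rw [← hM.zeta_eq hn hr .NLoS]
    exact ⟨hcov, fun s hs => hlap s hs (fun | .LoS => M.crossDist .LoS _ | .NLoS => r)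
      (by rintro (_ | _) <;> simp)⟩
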